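/- **Setting.** A vector-valued MDP (VMDP) $\mathcal M=(\mathcal S,\mathcal A,H,\Pr,\mathbf r)$ has measurable state and action spaces (possibly infinite), horizon $H\ge 1$, transition kernels $\Pr_h(\cdot\mid s,a)$ and measurable mean returns $\mathbf r_h:\mathcal S\times\mathcal A\to\mathcal B(1)\subset\mathbb R^d$, $d\ge 1$, where $\mathcal B(1)$ is the closed Euclidean unit ball. Episodes start in a fixed state $s_1$; return samples lie in $\mathcal B(1)$ almost surely and have conditional mean $\mathbf r_h(s_h,a_h)$ given the past. For $\theta\in\mathcal B(1)$ and a Markov policy $\pi$, $V_1^\pi(s_1;\theta)=\mathbb E_\pi[\sum_{h=1}^H\langle\theta,\mathbf r_h(s_h,a_h)\rangle]$ and $V_1^\star(s_1;\theta)=\sup_\pi V_1^\pi(s_1;\theta)$. The VMDP is *linear* with (known, measurable) feature map $\phi:\mathcal S\times\mathcal A\to\mathbb R^{d_{\rm lin}}$, $d_{\rm lin}\ge1$, $\|\phi\|\le 1$, if for every $h\in[H]$ there are signed measures $\mu_h=(\mu_h^{(1)},\dots,\mu_h^{(d_{\rm lin})})$ on $\mathcal S$ with $\Pr_h(\cdot\mid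 s,a)=\langle\mu_h(\cdot),\phi(s,a)\rangle$ and $\|(|\mu_h^{(i)}|(\mathcal S))_i\|_2\le\sqrt{d_{\rm lin}}$, and a matrix $W_h\in\mathbb R^{d\times d_{\rm lin}}$ with $\mathbf r_h(s,a)=W_h\phi(s,a)$ and operator norm $\|W_h\|\le\sqrt{d_{\rm lin}}$. **Algorithm** (bonus coefficient $\beta$, $K$ episodes). Write $\phi_h^i=\phi(s_h^i,a_h^i)$ and $\|x\|_{M}=\sqrt{x^\top M x}$. *Exploration.* In episode $k=1,\dots,K$, set $\widetilde V_{H+1}^k=0$ and for $h=H,\dots,1$ let $\widetilde\Lambda_h^k=I+\sum_{i<k}\phi_h^i(\phi_h^i)^\top$, $\;\widetilde b_h^k=\beta\|\phi(\cdot,\cdot)\|_{(\widetilde\Lambda_h^k)^{-1}}$, $\;\widetilde r_h^k=\min\{\widetilde b_h^k,H\}/H$, $\;\widetilde w_h^k=(\widetilde\Lambda_h^k)^{-1}\sum_{i<k}\phi_h^i\widetilde V_{h+1}^k(s_{h+1}^i)$, $\;\widetilde Q_h^k=\min\{(\widetilde w_h^k)^\top\phi+\widetilde r_h^k+\widetilde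 b_h^k,\,H\}$, $\;\widetilde V_h^k=\max_a\widetilde Q_h^k(\cdot,a)$; then play $a_h^k\in\arg\max_a\widetilde Q_h^k(s_h^k,a)$, without using any return. *Planning.* Given $\theta\in\mathcal B(1)$ and the revealed return samples $\mathbf r_h^i$, set $\widehat V_{H+1}=0$ and for $h=H,\dots,1$ let $\widehat\Lambda_h=I+\sum_{i\le K}\phi_h^i(\phi_h^i)^\top$, $\;\widehat w_h=\widehat\Lambda_h^{-1}\sum_{i\le K}\phi_h^i[\widehat V_{h+1}(s_{h+1}^i)+\theta^\top\mathbf r_h^i]$, $\;\widehat Q_h=\min\{\widehat w_h^\top\phi+\beta\|\phi\|_{\widehat\Lambda_h^{-1}},\,H\}$, $\;\widehat V_h=\max_a\widehat Q_h(\cdot,a)$; output $\pi_\theta$ with $\pi_{\theta,h}(s)\in\arg\max_a\widehat Q_h(s,a)$. Ties in the argmax are broken by an arbitrary measurable rule (assumed to exist, as it does for finite $\mathcal A$). **Theorem.** There are absolute constants $c_\beta,c_K>0$ such that for all $d_{\rm lin},d,H\ge1$, $\epsilon\in(0,H]$, $\delta\in(0,1]$, with $\iota'=\log\frac{d_{\rm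 lin}dH}{\epsilon\delta}$, and for every $K\ge c_K\, d_{\rm lin}^3H^6(\iota')^2/\epsilon^2$: if $\beta=c_\beta\, d_{\rm lin}H\sqrt{\iota}$ with $\iota=\log\frac{d_{\rm lin}dKH}{\delta}$, then on every linear VMDP, after $K$ episodes of exploration, with probability at least $1-\delta$, $$\forall\,\theta\in\mathcal B(1):\qquad V_1^\star(s_1;\theta)-V_1^{\pi_\theta}(s_1;\theta)\le\epsilon .$$ Consequently, with the same $c_\beta$, the algorithm is a reward-free algorithm with sample complexity $m_{\rm RFE}(\epsilon,\delta)\le C\,d_{\rm lin}^3H^6(\iota')^2/\epsilon^2$ for an absolute constant $C$: for some number of episodes $K$ not exceeding this bound, the above guarantee holds on every linear VMDP. -/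

import Mathlib

open MeasureTheory ProbabilityTheory

universe u v w

noncomputable section

namespace RewardFree

/-- An episodic vector-valued Markov decision process with `d`-dimensional returns. Steps are
numbered from `0`; in an episode of length `H` only the steps `h < H` play a role. -/
structure VMDP (S A : Type*) [MeasurableSpace S] [MeasurableSpace A] (d : ℕ) where
  /-- transition probabilities of step `h` -/
  P : ℕ → Kernel (S × A) S
  markov : ∀ h, IsMarkovKernel (P h)
  /-- expected return vector of step `h`, with values in the unit ball -/
  r : ℕ → S × A → EuclideanSpace ℝ (Fin d)
  measurable_r : ∀ h, Measurable (r h)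
  norm_r_le : ∀ h z, ‖r h z‖ ≤ 1

/-- A (randomized) policy: at every step a Markov kernel from states to actions. -/
structure Policy (S A : Type*) [MeasurableSpace S] [MeasurableSpace A] where
  act : ℕ → Kernel S A
  markov : ∀ h, IsMarkovKernel (act h)

section Basic

variable {S A : Type*} [MeasurableSpace S] [MeasurableSpace A] {d : ℕ}

/-- The deterministic policy that plays `f h s` in state `s` at step `h`. -/
def Policy.ofFun (f : ℕ → S → A) (hf : ∀ h, Measurable (f h)) : Policy S A where
  act h := Kernel.deterministic (f h) (hf h)
  markov h := Kernel.isMarkovKernel_deterministic (hf h)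

/-- The law of the next `n` state-action pairs `(s_h, a_h), …, (s_{h+n-1}, a_{h+n-1})` when the
state at step `h` is given and the policy `π` is followed. -/
def VMDP.traj (M : VMDP S A d) (π : Policy S A) : (n : ℕ) → (h : ℕ) → Kernel S (Fin n → S × A)
  | 0, _ => Kernel.const S (Measure.dirac Fin.elim0)
  | n + 1, h =>
      ((Kernel.id ×ₖ (M.traj π n (h + 1) ∘ₖ M.P h)) ∘ₖ (Kernel.id ×ₖ π.act h)).map
        (fun q : (S × A) × (Fin n → S × A) => (Fin.cons q.1 q.2 : Fin (n + 1) → S × A))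

/-- The scalarized value `V^π_h(s; θ)` in episodes of length `H`: the expectation, under `π` and
given `s_h = s`, of the sum of `⟨θ, r_{h'}(s_{h'}, a_{h'})⟩` over `h ≤ h' < H`. -/
def VMDP.value (M : VMDP S A d) (H : ℕ) (θ : EuclideanSpace ℝ (Fin d)) (π : Policy S A)
    (h : ℕ) (s : S) : ℝ :=
  ∫ τ, ∑ i : Fin (H - h), inner ℝ θ (M.r (h + i) (τ i)) ∂(M.traj π (H - h) h s)

/-- The optimal scalarized value `V^⋆_h(s; θ)`, the supremum over all policies. -/
def VMDP.optValue (M : VMDP S A d) (H : ℕ) (θ : EuclideanSpace ℝ (Fin d)) (h : ℕ) (s : S) : ℝ :=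
  ⨆ π : Policy S A, M.value H θ π h s

/-- Linear VMDP with feature map `φ`. The bound on `‖μ_h(S)‖` for signed measures is read as the
bound on the vector of total variation masses, and `‖W_h‖` is the operator norm. -/
structure VMDP.IsLinear (M : VMDP S A d) (H : ℕ) {m : ℕ} (φ : S × A → EuclideanSpace ℝ (Fin m)) :
    Prop where
  measurable_feature : Measurable φ
  norm_feature_le : ∀ z, ‖φ z‖ ≤ 1
  transition : ∀ h < H, ∃ μ : Fin m → SignedMeasure S,
    ‖WithLp.toLp 2 (fun i => (μ i).totalVariation.real Set.univ)‖ ≤ Real.sqrt m ∧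
    ∀ z B, MeasurableSet B → (M.P h z).real B = ∑ i, μ i B * φ z i
  returns : ∀ h < H, ∃ W : Matrix (Fin d) (Fin m) ℝ,
    ‖(Matrix.toEuclideanLin W).toContinuousLinearMap‖ ≤ Real.sqrt m ∧
    ∀ z, M.r h z = Matrix.toEuclideanLin W (φ z)

end Basic

section Algorithm

/-- Regression parameters: a weight vector `w` and an inverse Gram matrix `Λ⁻¹`. -/
abbrev Param (m : ℕ) : Type := EuclideanSpace ℝ (Fin m) × (Fin m → Fin m → ℝ)

variable {S A : Type*} {m : ℕ}

/-- The regularized Gram matrix `∑_{i < n} x_i x_iᵀ + I`. -/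
def gram (x : ℕ → EuclideanSpace ℝ (Fin m)) (n : ℕ) : Matrix (Fin m) (Fin m) ℝ :=
  ∑ i ∈ Finset.range n, Matrix.vecMulVec (x i).ofLp (x i).ofLp + 1

/-- The ridge regression estimate `Λ⁻¹ ∑_{i < n} y_i x_i`. -/
def ridge (x : ℕ → EuclideanSpace ℝ (Fin m)) (y : ℕ → ℝ) (n : ℕ) : EuclideanSpace ℝ (Fin m) :=
  WithLp.toLp 2 ((gram x n)⁻¹.mulVec (∑ i ∈ Finset.range n, y i • (x i).ofLp))

/-- The elliptical bonus `β √(vᵀ G v)`. -/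
def bonus (β : ℝ) (G : Fin m → Fin m → ℝ) (v : EuclideanSpace ℝ (Fin m)) : ℝ :=
  β * Real.sqrt (v.ofLp ⬝ᵥ (Matrix.of G).mulVec v.ofLp)

/-- The truncated bonus `u = min {β √(φᵀ G φ), H}`, which drives the exploration through the
intrinsic reward `u / H`. -/
def truncBonus (β : ℝ) (H : ℕ) (φ : S × A → EuclideanSpace ℝ (Fin m)) (p : Param m)
    (s : S) (a : A) : ℝ :=
  min (bonus β p.2 (φ (s, a))) H

/-- Exploration phase: `Q̃ = min {wᵀφ + u/H + β √(φᵀ Λ⁻¹ φ), H}`. -/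
def exploreQ (β : ℝ) (H : ℕ) (φ : S × A → EuclideanSpace ℝ (Fin m)) (p : Param m)
    (s : S) (a : A) : ℝ :=
  min (inner ℝ p.1 (φ (s, a)) + truncBonus β H φ p s a / H + bonus β p.2 (φ (s, a))) H

/-- Planning phase: `Q̂ = min {wᵀφ + β √(φᵀ Λ⁻¹ φ), H}`. -/
def planQ (β : ℝ) (H : ℕ) (φ : S × A → EuclideanSpace ℝ (Fin m)) (p : Param m)
    (s : S) (a : A) : ℝ :=
  min (inner ℝ p.1 (φ (s, a)) + bonus β p.2 (φ (s, a))) H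

/-- The regression of step `h` on the first `n` episodes of the data `(s, a)`, with targets
`V (s^i_{h+1}) + g^i_h`. -/
def fit (φ : S × A → EuclideanSpace ℝ (Fin m)) (s : ℕ → ℕ → S) (a : ℕ → ℕ → A)
    (g : ℕ → ℕ → ℝ) (n h : ℕ) (V : S → ℝ) : Param m :=
  (ridge (fun i => φ (s i h, a i h)) (fun i => V (s i (h + 1)) + g i h) n,
    fun i j => (gram (fun i => φ (s i h, a i h)) n)⁻¹ i j)

/-- Least-squares value iteration: `lsviValue … j` is the function `V_h` at step `h = H - j`,
that is, with `j` steps to go; it is `0` after the last step, and `V_h(s) = max_a Q_h(s, a)`. -/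
def lsviValue (Q : Param m → S → A → ℝ) (H : ℕ) (φ : S × A → EuclideanSpace ℝ (Fin m))
    (s : ℕ → ℕ → S) (a : ℕ → ℕ → A) (g : ℕ → ℕ → ℝ) (n : ℕ) : ℕ → S → ℝ
  | 0 => fun _ => 0
  | j + 1 => fun x =>
      ⨆ b : A, Q (fit φ s a g n (H - (j + 1)) (lsviValue Q H φ s a g n j)) x b

/-- The regression parameters of least-squares value iteration at step `h < H`. -/
def lsviParam (Q : Param m → S → A → ℝ) (H : ℕ) (φ : S × A → EuclideanSpace ℝ (Fin m))
    (s : ℕ → ℕ → S) (a : ℕ → ℕ → A) (g : ℕ → ℕ → ℝ) (n h : ℕ) : Param m :=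
  fit φ s a g n h (lsviValue Q H φ s a g n (H - (h + 1)))

/-- A measurable choice of `argmax_a Q_p(s, a)`, with an arbitrary tie-breaking rule, for the
functions `Q_p` that the algorithm can produce. -/
structure Greedy [MeasurableSpace S] [MeasurableSpace A] (Q : Param m → S → A → ℝ) where
  act : Param m → S → A
  measurable_act : Measurable (fun q : Param m × S => act q.1 q.2)
  isMax : ∀ p : Param m, (Matrix.of p.2).PosDef → ∀ s a, Q p s a ≤ Q p s (act p s)

variable [MeasurableSpace S] [MeasurableSpace A]

/-- The exploration rule: the action taken in episode `k` at step `h` in state `x`, computed from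
the states and actions of the episodes `i < k` only. -/
def exploreAct (β : ℝ) (H : ℕ) (φ : S × A → EuclideanSpace ℝ (Fin m))
    (G : Greedy (exploreQ β H φ)) (s : ℕ → ℕ → S) (a : ℕ → ℕ → A) (k h : ℕ) (x : S) : A :=
  G.act (lsviParam (exploreQ β H φ) H φ s a (fun _ _ => 0) k h) x

/-- The output of the planning phase for the vector `θ`, computed from the `K` explored episodes
`(s, a)` and the revealed return samples `r`. -/
def planPolicy {d : ℕ} (β : ℝ) (H : ℕ) (φ : S × A → EuclideanSpace ℝ (Fin m))
    (G : Greedy (planQ β H φ)) (K : ℕ) (s : ℕ → ℕ → S) (a : ℕ → ℕ → A)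
    (r : ℕ → ℕ → EuclideanSpace ℝ (Fin d)) (θ : EuclideanSpace ℝ (Fin d)) : Policy S A :=
  Policy.ofFun
    (fun h => G.act (lsviParam (planQ β H φ) H φ s a (fun i j => inner ℝ θ (r i j)) K h))
    (fun _ => G.measurable_act.comp (measurable_const.prodMk measurable_id))

end Algorithm

section Interaction

variable {S A Ω : Type*} [MeasurableSpace S] [MeasurableSpace A] [MeasurableSpace Ω] {d : ℕ}

/-- The information available after the action of step `h` of episode `k`: the states, actions
and returns of the earlier episodes, the states and actions of episode `k` up to step `h`, and
its returns before step `h`. -/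
@[reducible]
def history (H : ℕ) (s : ℕ → ℕ → Ω → S) (a : ℕ → ℕ → Ω → A)
    (r : ℕ → ℕ → Ω → EuclideanSpace ℝ (Fin d)) (k h : ℕ) : MeasurableSpace Ω :=
  (⨆ (i : ℕ) (j : ℕ) (_ : (i < k ∧ j ≤ H) ∨ (i = k ∧ j ≤ h)),
      MeasurableSpace.comap (s i j) inferInstance) ⊔
  (⨆ (i : ℕ) (j : ℕ) (_ : (i < k ∧ j < H) ∨ (i = k ∧ j ≤ h)),
      MeasurableSpace.comap (a i j) inferInstance) ⊔
  (⨆ (i : ℕ) (j : ℕ) (_ : (i < k ∧ j < H) ∨ (i = k ∧ j < h)),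
      MeasurableSpace.comap (r i j) inferInstance)

/-- The random variables `s k h`, `a k h`, `r k h` record `K` episodes of interaction with `M`
from the initial state `s₁`, the actions being chosen by the exploration rule `rule`. Return
samples lie in the unit ball and have the right conditional mean. -/
structure IsRun (M : VMDP S A d) (s₁ : S) (H K : ℕ)
    (rule : (ℕ → ℕ → S) → (ℕ → ℕ → A) → ℕ → ℕ → S → A) (Pr : Measure Ω)
    (s : ℕ → ℕ → Ω → S) (a : ℕ → ℕ → Ω → A) (r : ℕ → ℕ → Ω → EuclideanSpace ℝ (Fin d)) :
    Prop where
  measurable_s : ∀ k h, Measurable (s k h)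
  measurable_a : ∀ k h, Measurable (a k h)
  measurable_r : ∀ k h, Measurable (r k h)
  start : ∀ k < K, ∀ᵐ ω ∂Pr, s k 0 ω = s₁
  action : ∀ k < K, ∀ h < H, ∀ᵐ ω ∂Pr,
    a k h ω = rule (fun i j => s i j ω) (fun i j => a i j ω) k h (s k h ω)
  transition : ∀ k < K, ∀ h < H, ∀ B : Set S, MeasurableSet B →
    Pr[((s k (h + 1)) ⁻¹' B).indicator (fun _ => (1 : ℝ)) | history H s a r k h]
      =ᵐ[Pr] fun ω => (M.P h (s k h ω, a k h ω)).real B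
  return_ball : ∀ k < K, ∀ h < H, ∀ᵐ ω ∂Pr, ‖r k h ω‖ ≤ 1
  return_mean : ∀ k < K, ∀ h < H,
    Pr[r k h | history H s a r k h] =ᵐ[Pr] fun ω => M.r h (s k h ω, a k h ω)

end Interaction

/-- The bonus coefficient `β = c_β · d_lin · H · √ι` with `ι = log (d_lin d K H / δ)`. -/
def bonusCoeff (cβ : ℝ) (m d H K : ℕ) (δ : ℝ) : ℝ :=
  cβ * m * H * Real.sqrt (Real.log (m * d * K * H / δ))

/-- The rate `d_lin³ H⁶ ι'² / ε²` with `ι' = log (d_lin d H / (ε δ))`. -/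
def rate (m d H : ℕ) (ε δ : ℝ) : ℝ :=
  (m : ℝ) ^ 3 * (H : ℝ) ^ 6 * Real.log (m * d * H / (ε * δ)) ^ 2 / ε ^ 2

/-- The reward-free guarantee of the algorithm with bonus constant `cβ` run for `K` episodes, on
all linear VMDPs with `m`-dimensional features, `d`-dimensional returns and horizon `H`: with
probability at least `1 - δ`, simultaneously for all `θ` in the unit ball, the planning phase
returns a policy that is `ε`-optimal for `θ` from the initial state. -/
def Guarantee (cβ : ℝ) (m d H K : ℕ) (ε δ : ℝ) : Prop :=
  ∀ (S : Type u) (A : Type v) (Ω : Type w) [MeasurableSpace S] [MeasurableSpace A]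
    [MeasurableSpace Ω] (φ : S × A → EuclideanSpace ℝ (Fin m)) (M : VMDP S A d) (s₁ : S)
    (Ge : Greedy (exploreQ (bonusCoeff cβ m d H K δ) H φ))
    (Gp : Greedy (planQ (bonusCoeff cβ m d H K δ) H φ))
    (Pr : Measure Ω) [IsProbabilityMeasure Pr]
    (s : ℕ → ℕ → Ω → S) (a : ℕ → ℕ → Ω → A) (r : ℕ → ℕ → Ω → EuclideanSpace ℝ (Fin d)),
    M.IsLinear H φ →
    IsRun M s₁ H K (exploreAct (bonusCoeff cβ m d H K δ) H φ Ge) Pr s a r →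
    ∃ E : Set Ω, MeasurableSet E ∧ 1 - δ ≤ Pr.real E ∧
      ∀ ω ∈ E, ∀ θ : EuclideanSpace ℝ (Fin d), ‖θ‖ ≤ 1 →
        M.optValue H θ 0 s₁ -
          M.value H θ (planPolicy (bonusCoeff cβ m d H K δ) H φ Gp K (fun i j => s i j ω)
            (fun i j => a i j ω) (fun i j => r i j ω) θ) 0 s₁ ≤ ε

end RewardFree

end

/-! One-dimensional features are degenerate: total mass one forces `φ` to be constant, hence all
policies have the same value (`returns_const_of_dim_one`). This case is split off because `ι'`, and
with it the bound on `K`, can vanish there. For at least two dimensions the proof has a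
probabilistic and a deterministic half.

Probability. A ridge prediction errs by at most `‖φ‖_{Λ⁻¹}` times the self-normalized size of the
noise plus the norm of the true weight (`abs_inner_ridge_sub_le`). The noise is controlled by
`measure_selfNorm_gt_le`: under rank-one updates of the Gram matrix, the exponential of the
compensated self-normalized norm is a supermartingale. The noise may be vector-valued at no cost in
its dimension, so one event for the return vectors serves every `θ` by Cauchy-Schwarz. The value
functions in the targets depend on the data and on `θ`, but all of them are described by the `m +
m²` bounded numbers in `(w, Λ⁻¹)`. A union bound over a grid of such parameters
(`exists_bad_transition`) therefore covers all `θ` and all data at once, and its logarithm, of order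
`m² ι`, gives a bonus coefficient of order `m H √ι`.

Determinism. On `GoodData` the planned value is optimistic (`valueN_le_planValue`). It exceeds the
true value of the planned policy by at most four times the exploration value of any episode `k`
(`planValue_sub_valueN_le`): planning loses at most two bonuses per step, the Gram matrix only
grows, so these are at most the bonuses of episode `k`, and the exploration value is at least the
expected sum of half bonuses, up to truncation at `H`. The exploration values in turn sum to `O(H β
√(K m ι))` over the episodes, by telescoping along the observed trajectories and the elliptical
potential (`sum_exploreValue_le`). Averaging over `k` bounds the suboptimality by a multiple of
`m^{3/2} H² ι / √K`, and `log_bonus_le` shows that the assumed number of episodes brings this below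
`ε` although `ι` itself contains `log K`. -/

noncomputable section

namespace RewardFree

/-! ### Seminorms given by positive semidefinite matrices. -/

section QuadraticForm

variable {m : ℕ}

/-- The quadratic form `vᵀ G v`. -/
def quad (G : Matrix (Fin m) (Fin m) ℝ) (v : Fin m → ℝ) : ℝ := v ⬝ᵥ G.mulVec v

lemma quad_nonneg {G : Matrix (Fin m) (Fin m) ℝ} (hG : G.PosSemidef) (v : Fin m → ℝ) :
    0 ≤ quad G v := by
  simpa [quad] using hG.dotProduct_mulVec_nonneg v

lemma dotProduct_mulVec_comm {G : Matrix (Fin m) (Fin m) ℝ} (hG : G.PosSemidef)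
    (v w : Fin m → ℝ) : v ⬝ᵥ G.mulVec w = w ⬝ᵥ G.mulVec v := by
  have hT : G.transpose = G := 
    (Matrix.conjTranspose_eq_transpose_of_trivial G).symm.trans hG.isHermitian.eq
  calc v ⬝ᵥ G.mulVec w = G.mulVec w ⬝ᵥ v := dotProduct_comm _ _
    _ = w ⬝ᵥ G.transpose.mulVec v := by
        rw [Matrix.mulVec_transpose, dotProduct_comm, Matrix.dotProduct_mulVec, dotProduct_comm]
    _ = _ := by rw [hT]

lemma quad_add_smul {G : Matrix (Fin m) (Fin m) ℝ} (hG : G.PosSemidef) (v w : Fin m → ℝ)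
    (t : ℝ) : quad G (v + t • w) = quad G v + 2 * t * (v ⬝ᵥ G.mulVec w) + t ^ 2 * quad G w := by
  simp only [quad, Matrix.mulVec_add, Matrix.mulVec_smul, add_dotProduct, dotProduct_add,
    smul_dotProduct, dotProduct_smul, smul_eq_mul, dotProduct_mulVec_comm hG w v]
  ring

/-- Cauchy-Schwarz for a possibly degenerate form: `t ↦ quad G (v + t • w)` is a nonnegative
quadratic polynomial, so its discriminant is nonpositive. -/
lemma sq_dotProduct_mulVec_le {G : Matrix (Fin m) (Fin m) ℝ} (hG : G.PosSemidef)
    (v w : Fin m → ℝ) : (v ⬝ᵥ G.mulVec w) ^ 2 ≤ quad G v * quad G w := by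
  have h := discrim_le_zero (a := quad G w) (b := 2 * (v ⬝ᵥ G.mulVec w)) (c := quad G v)
    (fun t => by
      have := quad_nonneg hG (v + t • w)
      rw [quad_add_smul hG] at this
      linarith)
  rw [discrim] at h
  linarith

lemma abs_dotProduct_mulVec_le {G : Matrix (Fin m) (Fin m) ℝ} (hG : G.PosSemidef)
    (v w : Fin m → ℝ) : |v ⬝ᵥ G.mulVec w| ≤ √(quad G v) * √(quad G w) := by
  rw [← Real.sqrt_mul (quad_nonneg hG v)]
  exact Real.abs_le_sqrt (sq_dotProduct_mulVec_le hG v w)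

lemma sqrt_quad_add_le {G : Matrix (Fin m) (Fin m) ℝ} (hG : G.PosSemidef)
    (v w : Fin m → ℝ) : √(quad G (v + w)) ≤ √(quad G v) + √(quad G w) := by
  rw [Real.sqrt_le_left (by positivity)]
  have h := quad_add_smul hG v w 1
  have h2 := (abs_le.mp (abs_dotProduct_mulVec_le hG v w)).2
  have h3 := Real.sq_sqrt (quad_nonneg hG v)
  have h4 := Real.sq_sqrt (quad_nonneg hG w)
  rw [one_smul] at h
  nlinarith

lemma quad_smul (G : Matrix (Fin m) (Fin m) ℝ) (t : ℝ) (v : Fin m → ℝ) :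
    quad G (t • v) = t ^ 2 * quad G v := by
  simp only [quad, Matrix.mulVec_smul, smul_dotProduct, dotProduct_smul, smul_eq_mul]
  ring

lemma sqrt_quad_smul (G : Matrix (Fin m) (Fin m) ℝ) (t : ℝ) (v : Fin m → ℝ) :
    √(quad G (t • v)) = |t| * √(quad G v) := by
  rw [quad_smul, Real.sqrt_mul (sq_nonneg t), Real.sqrt_sq_eq_abs]

lemma quad_zero (G : Matrix (Fin m) (Fin m) ℝ) : quad G 0 = 0 := by simp [quad]

lemma sqrt_quad_sum_le {G : Matrix (Fin m) (Fin m) ℝ} (hG : G.PosSemidef) {ι : Type*}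
    (t : Finset ι) (v : ι → Fin m → ℝ) :
    √(quad G (∑ i ∈ t, v i)) ≤ ∑ i ∈ t, √(quad G (v i)) := by
  classical
  induction t using Finset.induction_on with
  | empty => simp [quad_zero]
  | insert a t ha ih =>
    rw [Finset.sum_insert ha, Finset.sum_insert ha]
    exact (sqrt_quad_add_le hG _ _).trans (by gcongr)

/-- The squared norm of a linear combination is controlled by the sum of the squared norms. -/
lemma sqrt_quad_sum_smul_le {G : Matrix (Fin m) (Fin m) ℝ} (hG : G.PosSemidef) {ι : Type*}
    [Fintype ι] (c : ι → ℝ) (v : ι → Fin m → ℝ) :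
    √(quad G (∑ i, c i • v i)) ≤ √(∑ i, c i ^ 2) * √(∑ i, quad G (v i)) := by
  refine (sqrt_quad_sum_le hG _ _).trans ?_
  simp only [sqrt_quad_smul]
  refine (Real.sum_mul_le_sqrt_mul_sqrt _ _ _).trans_eq ?_
  simp [Real.sq_sqrt (quad_nonneg hG _)]

lemma dotProduct_self_eq (v : EuclideanSpace ℝ (Fin m)) : v.ofLp ⬝ᵥ v.ofLp = ‖v‖ ^ 2 := by
  rw [EuclideanSpace.real_norm_sq_eq]
  simp [dotProduct, sq]

lemma inner_eq_dotProduct (v w : EuclideanSpace ℝ (Fin m)) :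
    inner ℝ v w = v.ofLp ⬝ᵥ w.ofLp := by
  simp [PiLp.inner_apply, dotProduct, mul_comm]

end QuadraticForm

/-! ### Inverse and determinant under a rank-one update. -/

section RankOneUpdate

variable {m : ℕ} {Λ : Matrix (Fin m) (Fin m) ℝ}

/-- The Sherman-Morrison formula, checked by multiplying out. -/
lemma inv_add_vecMulVec (hΛ : Λ.PosDef) (x : Fin m → ℝ) :
    (Λ + Matrix.vecMulVec x x)⁻¹ =
      Λ⁻¹ - (1 + quad Λ⁻¹ x)⁻¹ • Matrix.vecMulVec (Λ⁻¹.mulVec x) (Λ⁻¹.mulVec x) := by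
  have hu : 0 ≤ quad Λ⁻¹ x := quad_nonneg hΛ.inv.posSemidef x
  have hT : Λ⁻¹.transpose = Λ⁻¹ := 
    (Matrix.conjTranspose_eq_transpose_of_trivial _).symm.trans hΛ.inv.isHermitian.eq
  have hdet : IsUnit Λ.det := (Matrix.isUnit_iff_isUnit_det _).mp hΛ.isUnit
  apply Matrix.inv_eq_right_inv
  have h1 : Λ * Matrix.vecMulVec (Λ⁻¹.mulVec x) (Λ⁻¹.mulVec x)
      = Matrix.vecMulVec x (Λ⁻¹.mulVec x) := by
    rw [Matrix.mul_vecMulVec, Matrix.mulVec_mulVec, Matrix.mul_nonsing_inv _ hdet,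
      Matrix.one_mulVec]
  have h2 : Matrix.vecMulVec x x * Λ⁻¹ = Matrix.vecMulVec x (Λ⁻¹.mulVec x) := by
    rw [Matrix.vecMulVec_mul, ← Matrix.mulVec_transpose, hT]
  have h3 : Matrix.vecMulVec x x * Matrix.vecMulVec (Λ⁻¹.mulVec x) (Λ⁻¹.mulVec x)
      = quad Λ⁻¹ x • Matrix.vecMulVec x (Λ⁻¹.mulVec x) := by
    rw [Matrix.vecMulVec_mul_vecMulVec]
    ext i j
    simp [Matrix.vecMulVec_apply, quad, Matrix.smul_apply]
    ring
  rw [Matrix.mul_sub, Matrix.add_mul, Matrix.mul_smul, Matrix.add_mul, h1, h2, h3,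
    Matrix.mul_nonsing_inv _ hdet]
  ext i j
  simp only [Matrix.sub_apply, Matrix.add_apply, Matrix.smul_apply, smul_eq_mul]
  field_simp
  ring

lemma quad_inv_add_vecMulVec (hΛ : Λ.PosDef) (x v : Fin m → ℝ) :
    quad (Λ + Matrix.vecMulVec x x)⁻¹ v =
      quad Λ⁻¹ v - (v ⬝ᵥ Λ⁻¹.mulVec x) ^ 2 / (1 + quad Λ⁻¹ x) := by
  rw [inv_add_vecMulVec hΛ]
  simp only [quad, Matrix.sub_mulVec, Matrix.smul_mulVec, Matrix.vecMulVec_mulVec,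
    dotProduct_sub, dotProduct_smul, smul_eq_mul, op_smul_eq_smul]
  rw [dotProduct_comm (Λ⁻¹.mulVec x) v]
  ring

lemma det_add_vecMulVec (hΛ : Λ.PosDef) (x : Fin m → ℝ) :
    (Λ + Matrix.vecMulVec x x).det = Λ.det * (1 + quad Λ⁻¹ x) := by
  have hdet : IsUnit Λ.det := (Matrix.isUnit_iff_isUnit_det _).mp hΛ.isUnit
  rw [Matrix.vecMulVec_eq Unit, Matrix.det_add_replicateCol_mul_replicateRow hdet]
  congr 1
  rw [Matrix.det_unique, Matrix.mul_assoc]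
  simp [Matrix.mul_apply, quad, dotProduct, Matrix.mulVec]

end RankOneUpdate

/-! ### Regularized Gram matrices, the elliptical potential and ridge regression. -/

section Gram

variable {m : ℕ} (x : ℕ → EuclideanSpace ℝ (Fin m))

lemma gram_zero : gram x 0 = 1 := by simp [gram]

lemma gram_succ (n : ℕ) :
    gram x (n + 1) = gram x n + Matrix.vecMulVec (x n).ofLp (x n).ofLp := by
  rw [gram, gram, Finset.sum_range_succ]
  abel

lemma gram_posDef (n : ℕ) : (gram x n).PosDef := by
  induction n with
  | zero => rw [gram_zero]; exact Matrix.PosDef.one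
  | succ n ih =>
    rw [gram_succ]
    refine ih.add_posSemidef ?_
    simpa using Matrix.posSemidef_vecMulVec_self_star (x n).ofLp

lemma gram_inv_posSemidef (n : ℕ) : (gram x n)⁻¹.PosSemidef := (gram_posDef x n).inv.posSemidef

/-- The leverage `x_nᵀ Λ_n⁻¹ x_n` of the next regressor. -/
def lever (n : ℕ) : ℝ := quad (gram x n)⁻¹ (x n).ofLp

lemma lever_nonneg (n : ℕ) : 0 ≤ lever x n := quad_nonneg (gram_inv_posSemidef x n) _

lemma quad_gram_succ (n : ℕ) (v : Fin m → ℝ) :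
    quad (gram x (n + 1))⁻¹ v =
      quad (gram x n)⁻¹ v - (v ⬝ᵥ (gram x n)⁻¹.mulVec (x n).ofLp) ^ 2 / (1 + lever x n) := by
  rw [gram_succ, quad_inv_add_vecMulVec (gram_posDef x n)]
  rfl

/-- Each update subtracts a square. Besides the bounds below, this is what makes the bonus of the
planning phase at most that of every exploration episode. -/
lemma quad_gram_antitone (v : Fin m → ℝ) : Antitone fun n => quad (gram x n)⁻¹ v := by
  refine antitone_nat_of_succ_le fun n => ?_
  have := lever_nonneg x n
  rw [quad_gram_succ]
  have : 0 ≤ (v ⬝ᵥ (gram x n)⁻¹.mulVec (x n).ofLp) ^ 2 / (1 + lever x n) := by positivity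
  linarith

lemma quad_gram_le (n : ℕ) (v : Fin m → ℝ) : quad (gram x n)⁻¹ v ≤ v ⬝ᵥ v := by
  refine (quad_gram_antitone x v (Nat.zero_le n)).trans ?_
  simp [gram_zero, quad]

lemma sqrt_quad_gram_le (n : ℕ) (v : EuclideanSpace ℝ (Fin m)) :
    √(quad (gram x n)⁻¹ v.ofLp) ≤ ‖v‖ := by
  rw [Real.sqrt_le_left (norm_nonneg _), ← dotProduct_self_eq]
  exact quad_gram_le x n _

lemma abs_gram_inv_apply_le (n : ℕ) (i j : Fin m) : |(gram x n)⁻¹ i j| ≤ 1 := by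
  have h := abs_dotProduct_mulVec_le (gram_inv_posSemidef x n) (Pi.single i 1) (Pi.single j 1)
  have h1 := sqrt_quad_gram_le x n (EuclideanSpace.single i 1)
  have h2 := sqrt_quad_gram_le x n (EuclideanSpace.single j 1)
  rw [PiLp.norm_single, norm_one] at h1 h2
  have h3 : (Pi.single i 1 : Fin m → ℝ) ⬝ᵥ (gram x n)⁻¹.mulVec (Pi.single j 1)
    = (gram x n)⁻¹ i j := by simp
  rw [h3] at h
  refine h.trans ?_
  exact mul_le_one₀ h1 (Real.sqrt_nonneg _) h2

/-- Each new regressor multiplies the determinant by `1 + u`, where `u` is its leverage, and `log (1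
+ u) ≥ u / (1 + u)`. The fraction is kept because it is exactly the compensator of the
supermartingale below. -/
lemma sum_lever_le_log_det (n : ℕ) :
    ∑ i ∈ Finset.range n, lever x i / (1 + lever x i) ≤ Real.log (gram x n).det := by
  induction n with
  | zero => simp [gram_zero]
  | succ n ih =>
    have hu := lever_nonneg x n
    have hd := (gram_posDef x n).det_pos
    rw [Finset.sum_range_succ, gram_succ, det_add_vecMulVec (gram_posDef x n),
      Real.log_mul hd.ne' (by change 1 + lever x n ≠ 0; positivity)]
    have h := Real.one_sub_inv_le_log_of_pos (x := 1 + lever x n) (by positivity)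
    have h' : 1 - (1 + lever x n)⁻¹ = lever x n / (1 + lever x n) := by field_simp; ring
    rw [h'] at h
    exact add_le_add ih h

lemma trace_gram_le (hx : ∀ i, ‖x i‖ ≤ 1) (n : ℕ) : (gram x n).trace ≤ m + n := by
  induction n with
  | zero => simp [gram_zero]
  | succ n ih =>
    rw [gram_succ, Matrix.trace_add, Matrix.trace_vecMulVec, dotProduct_self_eq]
    have : ‖x n‖ ^ 2 ≤ 1 := pow_le_one₀ (norm_nonneg _) (hx n)
    push_cast
    linarith

/-- Each of the `m` eigenvalues is at most the trace. -/
lemma log_det_gram_le (hx : ∀ i, ‖x i‖ ≤ 1) (n : ℕ) :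
    Real.log (gram x n).det ≤ m * Real.log (m + n) := by
  have hP := gram_posDef x n
  have hev := hP.eigenvalues_pos
  rcases Nat.eq_zero_or_pos m with rfl | hm
  · simp
  have hle : ∀ i, hP.1.eigenvalues i ≤ m + n := fun i => by
    refine le_trans ?_ (trace_gram_le x hx n)
    rw [hP.1.trace_eq_sum_eigenvalues]
    exact Finset.single_le_sum (f := fun i => hP.1.eigenvalues i)
      (fun j _ => (hev j).le) (Finset.mem_univ i)
  rw [hP.1.det_eq_prod_eigenvalues]
  simp only [RCLike.ofReal_real_eq_id, id]
  rw [Real.log_prod fun i _ => (hev i).ne']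
  calc ∑ i, Real.log (hP.1.eigenvalues i) ≤ ∑ _i : Fin m, Real.log (m + n) :=
        Finset.sum_le_sum fun i _ => Real.log_le_log (hev i) (hle i)
    _ = _ := by simp

/-- The elliptical potential bound. -/
lemma sum_lever_le (hx : ∀ i, ‖x i‖ ≤ 1) (n : ℕ) :
    ∑ i ∈ Finset.range n, lever x i ≤ 2 * (m * Real.log (m + n)) := by
  have h := (sum_lever_le_log_det x n).trans (log_det_gram_le x hx n)
  calc ∑ i ∈ Finset.range n, lever x i
      ≤ ∑ i ∈ Finset.range n, 2 * (lever x i / (1 + lever x i)) := by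
        refine Finset.sum_le_sum fun i _ => ?_
        have h0 := lever_nonneg x i
        have h1 : lever x i ≤ 1 := by
          refine (quad_gram_le x i _).trans ?_
          rw [dotProduct_self_eq]
          exact pow_le_one₀ (norm_nonneg _) (hx i)
        rw [mul_div_assoc', le_div_iff₀ (by positivity)]
        nlinarith
    _ ≤ _ := by rw [← Finset.mul_sum]; linarith

/-- The error of ridge regression in terms of the residuals of a reference vector. -/
lemma abs_inner_ridge_sub_le (y : ℕ → ℝ) (n : ℕ) (w v : EuclideanSpace ℝ (Fin m)) :
    |inner ℝ (ridge x y n) v - inner ℝ w v| ≤ √(quad (gram x n)⁻¹ v.ofLp) *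
      (√(quad (gram x n)⁻¹ (∑ i ∈ Finset.range n, (y i - inner ℝ w (x i)) • (x i).ofLp))
        + ‖w‖) := by
  have hG := gram_inv_posSemidef x n
  have hdet : IsUnit (gram x n).det := (Matrix.isUnit_iff_isUnit_det _).mp (gram_posDef x n).isUnit
  set e := ∑ i ∈ Finset.range n, (y i - inner ℝ w (x i)) • (x i).ofLp with he
  have h1 : (gram x n).mulVec w.ofLp
      = ∑ i ∈ Finset.range n, (inner ℝ w (x i) : ℝ) • (x i).ofLp + w.ofLp := by
    rw [gram, Matrix.add_mulVec, Matrix.one_mulVec, Matrix.sum_mulVec]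
    congr 1
    refine Finset.sum_congr rfl fun i _ => ?_
    rw [Matrix.vecMulVec_mulVec, op_smul_eq_smul, inner_eq_dotProduct, dotProduct_comm]
  -- The regularizer accounts for the bias `-Λ⁻¹ w`; all the rest is the residual sum `e`.
  have h2 : (ridge x y n).ofLp - w.ofLp = (gram x n)⁻¹.mulVec (e + (-1 : ℝ) • w.ofLp) := by
    have h3 : w.ofLp = (gram x n)⁻¹.mulVec ((gram x n).mulVec w.ofLp) := by
      rw [Matrix.mulVec_mulVec, Matrix.nonsing_inv_mul _ hdet, Matrix.one_mulVec]
    conv_lhs => rw [h3]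
    simp only [ridge]
    rw [← Matrix.mulVec_sub, h1, he]
    congr 1
    simp only [sub_smul, Finset.sum_sub_distrib, neg_smul, one_smul]
    abel
  rw [← inner_sub_left, inner_eq_dotProduct, WithLp.ofLp_sub, h2, dotProduct_comm]
  refine (abs_dotProduct_mulVec_le hG _ _).trans ?_
  gcongr
  refine (sqrt_quad_add_le hG _ _).trans ?_
  rw [sqrt_quad_smul]
  simpa using sqrt_quad_gram_le x n w

lemma abs_ridge_apply_le (hx : ∀ i, ‖x i‖ ≤ 1) (y : ℕ → ℝ) {C : ℝ} (n : ℕ)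
    (hy : ∀ i < n, |y i| ≤ C) (j : Fin m) : |ridge x y n j| ≤ n * C := by
  have hG := gram_inv_posSemidef x n
  have h := abs_dotProduct_mulVec_le hG (Pi.single j 1)
    (∑ i ∈ Finset.range n, y i • (x i).ofLp)
  have h1 := sqrt_quad_gram_le x n (EuclideanSpace.single j 1)
  rw [PiLp.norm_single, norm_one] at h1
  have h3 : (Pi.single j 1 : Fin m → ℝ) ⬝ᵥ (gram x n)⁻¹.mulVec
      (∑ i ∈ Finset.range n, y i • (x i).ofLp) = ridge x y n j := by simp [ridge]
  rw [h3] at h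
  refine h.trans ((mul_le_of_le_one_left (Real.sqrt_nonneg _) h1).trans ?_)
  refine (sqrt_quad_sum_le hG _ _).trans ?_
  calc ∑ i ∈ Finset.range n, √(quad (gram x n)⁻¹ (y i • (x i).ofLp))
      ≤ ∑ _i ∈ Finset.range n, C := by
        refine Finset.sum_le_sum fun i hi => ?_
        rw [sqrt_quad_smul]
        have := hy i (Finset.mem_range.mp hi)
        calc |y i| * _ ≤ |y i| * 1 :=
              mul_le_mul_of_nonneg_left ((sqrt_quad_gram_le x n _).trans (hx i)) (abs_nonneg _)
          _ ≤ C := by simpa using this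
    _ = n * C := by simp

end Gram

/-! ### Self-normalized concentration for vector-valued noise. -/

section SelfNormalized

/-- This separates a linear term, which integrates to zero against centered noise, from a term
quadratic in the noise. -/
lemma exp_le_add_exp_sq (y : ℝ) : Real.exp y ≤ y + Real.exp (y ^ 2) := by
  have h1 := Real.add_one_le_exp (y ^ 2)
  rcases le_or_gt |y| 1 with h | h
  · have := (abs_le.mp (Real.abs_exp_sub_one_sub_id_le h)).2
    linarith
  · rcases lt_abs.mp h with h | h
    · have : Real.exp y ≤ Real.exp (y ^ 2) := Real.exp_le_exp.mpr (by nlinarith)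
      linarith
    · have : Real.exp y ≤ 1 := Real.exp_le_one_iff.mpr (by linarith)
      nlinarith

variable {m : ℕ} {ι : Type*}

/-- The noise sum `∑_{i < n} η_i x_i` of the `j`-th noise coordinate. -/
def noiseSum (x : ℕ → EuclideanSpace ℝ (Fin m)) (η : ℕ → ι → ℝ) (n : ℕ) (j : ι) : Fin m → ℝ :=
  ∑ i ∈ Finset.range n, η i j • (x i).ofLp

variable [Fintype ι]

/-- The self-normalized squared norm of a vector-valued noise sum. -/
def selfNorm (x : ℕ → EuclideanSpace ℝ (Fin m)) (η : ℕ → ι → ℝ) (n : ℕ) : ℝ :=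
  ∑ j, quad (gram x n)⁻¹ (noiseSum x η n j)

/-- The correlation `S_jᵀ Λ_n⁻¹ x_n` of the noise sum with the next regressor. -/
def noiseCorr (x : ℕ → EuclideanSpace ℝ (Fin m)) (η : ℕ → ι → ℝ) (n : ℕ) (j : ι) : ℝ :=
  noiseSum x η n j ⬝ᵥ (gram x n)⁻¹.mulVec (x n).ofLp

section Deterministic

variable (x : ℕ → EuclideanSpace ℝ (Fin m)) (η : ℕ → ι → ℝ)

/-- The rank-one update turns the increment into a term linear in the new noise, a negative square
of the correlations, and a term `u / (1 + u)` times the squared noise. The negative square is what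
later pays for the exponential moment of the linear term. -/
lemma selfNorm_succ (n : ℕ) :
    selfNorm x η (n + 1) = selfNorm x η n +
      (2 * ∑ j, noiseCorr x η n j * η n j - ∑ j, noiseCorr x η n j ^ 2
        + lever x n * ∑ j, η n j ^ 2) / (1 + lever x n) := by
  have hu := lever_nonneg x n
  simp only [selfNorm, Finset.mul_sum, ← Finset.sum_sub_distrib, ← Finset.sum_add_distrib,
    Finset.sum_div]
  refine Finset.sum_congr rfl fun j _ => ?_
  have h1 : noiseSum x η (n + 1) j = noiseSum x η n j + η n j • (x n).ofLp := by
    simp [noiseSum, Finset.sum_range_succ]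
  have h2 : (noiseSum x η n j + η n j • (x n).ofLp) ⬝ᵥ (gram x n)⁻¹.mulVec (x n).ofLp
      = noiseCorr x η n j + η n j * lever x n := by
    simp [add_dotProduct, noiseCorr, lever, quad]
  rw [quad_gram_succ, h1, h2, quad_add_smul (gram_inv_posSemidef x n)]
  change _ + 2 * η n j * noiseCorr x η n j + η n j ^ 2 * lever x n - _ = _
  field_simp
  ring

/-- A crude bound that holds for every outcome, since `2 c η - c² ≤ η²`. It serves only for the
boundedness, hence integrability, of the exponentials. -/
lemma selfNorm_le {B : ℝ} (hη : ∀ i, ∑ j, η i j ^ 2 ≤ B ^ 2) (n : ℕ) :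
    selfNorm x η n ≤ n * B ^ 2 := by
  induction n with
  | zero => simp [selfNorm, noiseSum, quad_zero]
  | succ n ih =>
    have hu := lever_nonneg x n
    rw [selfNorm_succ]
    have h : (2 * ∑ j, noiseCorr x η n j * η n j - ∑ j, noiseCorr x η n j ^ 2
        + lever x n * ∑ j, η n j ^ 2) / (1 + lever x n) ≤ B ^ 2 := by
      rw [div_le_iff₀ (by positivity)]
      have h0 : 2 * ∑ j, noiseCorr x η n j * η n j
          ≤ ∑ j, noiseCorr x η n j ^ 2 + ∑ j, η n j ^ 2 := by
        rw [Finset.mul_sum, ← Finset.sum_add_distrib]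
        exact Finset.sum_le_sum fun j _ => by nlinarith [sq_nonneg (noiseCorr x η n j - η n j)]
      nlinarith [hη n]
    push_cast
    linarith

lemma sq_noiseCorr_le {B : ℝ} (hx : ∀ i, ‖x i‖ ≤ 1) (hη : ∀ i, ∑ j, η i j ^ 2 ≤ B ^ 2) (n : ℕ)
    (j : ι) : noiseCorr x η n j ^ 2 ≤ n * B ^ 2 := by
  have hG := gram_inv_posSemidef x n
  have h1 : quad (gram x n)⁻¹ (noiseSum x η n j) ≤ n * B ^ 2 :=
    (Finset.single_le_sum (f := fun j => quad (gram x n)⁻¹ (noiseSum x η n j))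
      (fun _ _ => quad_nonneg hG _) (Finset.mem_univ j)).trans (selfNorm_le x η hη n)
  have h2 : quad (gram x n)⁻¹ (x n).ofLp ≤ 1 := by
    refine (quad_gram_le x n _).trans ?_
    rw [dotProduct_self_eq]
    exact pow_le_one₀ (norm_nonneg _) (hx n)
  refine (sq_dotProduct_mulVec_le hG _ _).trans ?_
  calc _ ≤ quad (gram x n)⁻¹ (noiseSum x η n j) * 1 :=
        mul_le_mul_of_nonneg_left h2 (quad_nonneg hG _)
    _ ≤ _ := by linarith

/-- The exponential of the compensated self-normalized norm. -/
def expSelfNorm (l B : ℝ) (n : ℕ) : ℝ :=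
  Real.exp (l * (selfNorm x η n
    - B ^ 2 * ∑ i ∈ Finset.range n, lever x i / (1 + lever x i)))

/-- The predictable factor in front of the noise in `expSelfNorm_succ_le`. -/
def expWeight (l B : ℝ) (n : ℕ) (j : ι) : ℝ :=
  expSelfNorm x η l B n * Real.exp (-(l * (∑ j, noiseCorr x η n j ^ 2) / (1 + lever x n)))
    * (2 * l / (1 + lever x n)) * noiseCorr x η n j

/-- The supermartingale step, before taking expectations. The compensator absorbs the squared noise,
and `exp_le_add_exp_sq` is applied to the linear term. The resulting quadratic exponent is at most
`4 l² a2 B² / D²`, which `4 l B² ≤ 1` and `D ≥ 1` bound by the available `l a2 / D`. Only a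
predictable multiple of the noise remains. -/
lemma expSelfNorm_succ_le {l B : ℝ} (hl : 0 ≤ l) (hlB : 4 * l * B ^ 2 ≤ 1)
    (hη : ∀ i, ∑ j, η i j ^ 2 ≤ B ^ 2) (n : ℕ) :
    expSelfNorm x η l B (n + 1) ≤
      expSelfNorm x η l B n + ∑ j, expWeight x η l B n j * η n j := by
  have hu := lever_nonneg x n
  set D := 1 + lever x n with hD
  have hD1 : 1 ≤ D := by linarith
  set a2 := ∑ j, noiseCorr x η n j ^ 2 with ha2
  have ha0 : 0 ≤ a2 := Finset.sum_nonneg fun _ _ => sq_nonneg _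
  set c := ∑ j, noiseCorr x η n j * η n j with hc
  have hcs : c ^ 2 ≤ a2 * B ^ 2 :=
    (Finset.sum_mul_sq_le_sq_mul_sq _ _ _).trans (mul_le_mul_of_nonneg_left (hη n) ha0)
  have hstep : expSelfNorm x η l B (n + 1) ≤
      expSelfNorm x η l B n * (Real.exp (-(l * a2 / D)) * Real.exp (2 * l / D * c)) := by
    rw [expSelfNorm, expSelfNorm, ← Real.exp_add, ← Real.exp_add, Real.exp_le_exp, selfNorm_succ,
      Finset.sum_range_succ]
    have h1 : lever x n / D * ∑ j, η n j ^ 2 ≤ lever x n / D * B ^ 2 :=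
      mul_le_mul_of_nonneg_left (hη n) (by positivity)
    have h2 := mul_le_mul_of_nonneg_left h1 hl
    have h3 : (2 * c - a2 + lever x n * ∑ j, η n j ^ 2) / D
      = 2 / D * c - a2 / D + lever x n / D * ∑ j, η n j ^ 2 := by ring
    rw [h3]
    have e1 : l * a2 / D = l * (a2 / D) := by ring
    have e2 : 2 * l / D * c = l * (2 / D * c) := by ring
    rw [e1, e2]
    nlinarith [h2]
  refine hstep.trans ?_
  have hexp : Real.exp (2 * l / D * c) ≤ 2 * l / D * c + Real.exp (l * a2 / D) := by
    refine (exp_le_add_exp_sq _).trans (add_le_add le_rfl (Real.exp_le_exp.mpr ?_))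
    have e : (2 * l / D * c) ^ 2 = l / D * (4 * l / D * c ^ 2) := by ring
    have e' : l * a2 / D = l / D * a2 := by ring
    rw [e, e']
    refine mul_le_mul_of_nonneg_left ?_ (by positivity)
    calc 4 * l / D * c ^ 2 ≤ 4 * l * (a2 * B ^ 2) := by
          refine mul_le_mul (div_le_self (by positivity) hD1) hcs (sq_nonneg _) (by positivity)
      _ = a2 * (4 * l * B ^ 2) := by ring
      _ ≤ a2 := mul_le_of_le_one_right ha0 hlB
  have hZ : 0 ≤ expSelfNorm x η l B n := (Real.exp_pos _).le
  have hE : 0 ≤ Real.exp (-(l * a2 / D)) := (Real.exp_pos _).le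
  calc _ ≤ expSelfNorm x η l B n *
        (Real.exp (-(l * a2 / D)) * (2 * l / D * c + Real.exp (l * a2 / D))) := by gcongr
    _ = expSelfNorm x η l B n
        + expSelfNorm x η l B n * Real.exp (-(l * a2 / D)) * (2 * l / D) * c := by
        rw [mul_add, ← Real.exp_add, neg_add_cancel, Real.exp_zero]
        ring
    _ = _ := by
        rw [hc, Finset.mul_sum]
        simp only [expWeight]
        congr 1
        exact Finset.sum_congr rfl fun j _ => by ring

lemma expSelfNorm_le {l B : ℝ} (hl : 0 ≤ l) (hη : ∀ i, ∑ j, η i j ^ 2 ≤ B ^ 2) (n : ℕ) :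
    expSelfNorm x η l B n ≤ Real.exp (l * (n * B ^ 2)) := by
  refine Real.exp_le_exp.mpr (mul_le_mul_of_nonneg_left ?_ hl)
  have h1 := selfNorm_le x η hη n
  have h2 : 0 ≤ ∑ i ∈ Finset.range n, lever x i / (1 + lever x i) :=
    Finset.sum_nonneg fun i _ => div_nonneg (lever_nonneg x i) (by linarith [lever_nonneg x i])
  nlinarith [sq_nonneg B]

lemma abs_expSelfNorm_le {l B : ℝ} (hl : 0 ≤ l) (hη : ∀ i, ∑ j, η i j ^ 2 ≤ B ^ 2) (n : ℕ) :
    |expSelfNorm x η l B n| ≤ Real.exp (l * (n * B ^ 2)) := by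
  rw [expSelfNorm, Real.abs_exp]
  exact expSelfNorm_le x η hl hη n

lemma abs_expWeight_le {l B : ℝ} (hl : 0 ≤ l) (hx : ∀ i, ‖x i‖ ≤ 1)
    (hη : ∀ i, ∑ j, η i j ^ 2 ≤ B ^ 2) (n : ℕ) (j : ι) :
    |expWeight x η l B n j| ≤ Real.exp (l * (n * B ^ 2)) * 1 * (2 * l) * √(n * B ^ 2) := by
  have hu := lever_nonneg x n
  have h1 := expSelfNorm_le x η hl hη n
  have h2 := Real.abs_le_sqrt (sq_noiseCorr_le x η hx hη n j)
  have h3 : 0 ≤ expSelfNorm x η l B n := (Real.exp_pos _).le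
  rw [expWeight, abs_mul, abs_mul, abs_mul, abs_of_nonneg h3, Real.abs_exp]
  gcongr
  · rw [Real.exp_le_one_iff]
    have : 0 ≤ ∑ j, noiseCorr x η n j ^ 2 := Finset.sum_nonneg fun _ _ => sq_nonneg _
    have : 0 ≤ l * (∑ j, noiseCorr x η n j ^ 2) / (1 + lever x n) := by positivity
    linarith
  · rw [abs_of_nonneg (by positivity)]
    exact div_le_self (by positivity) (by linarith)

end Deterministic

/-! ### Measurability of the self-normalized quantities with respect to the past. -/

section Measurability

variable {Ω : Type*} {mΩ : MeasurableSpace Ω} {x : ℕ → Ω → EuclideanSpace ℝ (Fin m)}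
  {η : ℕ → Ω → ι → ℝ} {n : ℕ}

lemma measurable_matrix_det {M : Ω → Matrix (Fin m) (Fin m) ℝ}
    (hM : ∀ i j, Measurable fun ω => M ω i j) : Measurable fun ω => (M ω).det := by
  simp only [Matrix.det_apply']
  exact Finset.measurable_sum _ fun σ _ =>
    (Finset.measurable_prod _ fun i _ => hM _ _).const_mul _

/-- The inverse is the adjugate divided by the determinant, hence a rational expression in the
entries. -/
lemma measurable_matrix_inv_apply {M : Ω → Matrix (Fin m) (Fin m) ℝ}
    (hM : ∀ i j, Measurable fun ω => M ω i j) (i j : Fin m) :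
    Measurable fun ω => (M ω)⁻¹ i j := by
  simp only [Matrix.inv_def, Matrix.smul_apply, Ring.inverse_eq_inv', smul_eq_mul,
    Matrix.adjugate_apply]
  refine (measurable_matrix_det hM).inv.mul (measurable_matrix_det fun k l => ?_)
  by_cases hk : k = j
  · subst hk; simp
  · simpa [Matrix.updateRow_ne hk] using hM k l

lemma measurable_euclidean_apply {f : Ω → EuclideanSpace ℝ (Fin m)} (hf : Measurable f)
    (i : Fin m) : Measurable fun ω => f ω i :=
  (PiLp.continuous_apply 2 _ i).measurable.comp hf

lemma measurable_gram_inv_apply (hx : ∀ i < n, Measurable (x i)) (i j : Fin m) :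
    Measurable fun ω => (gram (fun k => x k ω) n)⁻¹ i j := by
  refine measurable_matrix_inv_apply (fun i j => ?_) i j
  simp only [gram, Matrix.add_apply, Matrix.sum_apply, Matrix.vecMulVec_apply]
  refine (Finset.measurable_sum _ fun k hk => ?_).add_const _
  have := hx k (Finset.mem_range.mp hk)
  exact (measurable_euclidean_apply this i).mul (measurable_euclidean_apply this j)

lemma measurable_dotProduct_gram_inv (hx : ∀ i < n, Measurable (x i)) {v w : Ω → Fin m → ℝ}
    (hv : ∀ i, Measurable fun ω => v ω i) (hw : ∀ i, Measurable fun ω => w ω i) :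
    Measurable fun ω => v ω ⬝ᵥ (gram (fun k => x k ω) n)⁻¹.mulVec (w ω) := by
  simp only [dotProduct, Matrix.mulVec]
  exact Finset.measurable_sum _ fun i _ => (hv i).mul
    (Finset.measurable_sum _ fun j _ => (measurable_gram_inv_apply hx i j).mul (hw j))

lemma measurable_noiseSum {κ : Type*} {η : ℕ → Ω → κ → ℝ} (hx : ∀ i < n, Measurable (x i))
    (hη : ∀ i < n, ∀ j, Measurable fun ω => η i ω j) (j : κ) (l : Fin m) :
    Measurable fun ω => noiseSum (fun k => x k ω) (fun k => η k ω) n j l := by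
  simp only [noiseSum, Finset.sum_apply, Pi.smul_apply, smul_eq_mul]
  refine Finset.measurable_sum _ fun k hk => ?_
  have hk := Finset.mem_range.mp hk
  exact (hη k hk j).mul (measurable_euclidean_apply (hx k hk) l)

lemma measurable_selfNorm (hx : ∀ i < n, Measurable (x i))
    (hη : ∀ i < n, ∀ j, Measurable fun ω => η i ω j) :
    Measurable fun ω => selfNorm (fun k => x k ω) (fun k => η k ω) n :=
  Finset.measurable_sum _ fun j _ => measurable_dotProduct_gram_inv hx
    (measurable_noiseSum hx hη j) (measurable_noiseSum hx hη j)

lemma measurable_lever (hx : ∀ i ≤ n, Measurable (x i)) :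
    Measurable fun ω => lever (fun k => x k ω) n :=
  measurable_dotProduct_gram_inv (fun i hi => hx i hi.le)
    (measurable_euclidean_apply (hx n le_rfl)) (measurable_euclidean_apply (hx n le_rfl))

lemma measurable_noiseCorr {κ : Type*} {η : ℕ → Ω → κ → ℝ} (hx : ∀ i ≤ n, Measurable (x i))
    (hη : ∀ i < n, ∀ j, Measurable fun ω => η i ω j) (j : κ) :
    Measurable fun ω => noiseCorr (fun k => x k ω) (fun k => η k ω) n j :=
  measurable_dotProduct_gram_inv (fun i hi => hx i hi.le)
    (measurable_noiseSum (fun i hi => hx i hi.le) hη j)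
    (measurable_euclidean_apply (hx n le_rfl))

lemma measurable_expSelfNorm (hx : ∀ i < n, Measurable (x i))
    (hη : ∀ i < n, ∀ j, Measurable fun ω => η i ω j) (l B : ℝ) :
    Measurable fun ω => expSelfNorm (fun k => x k ω) (fun k => η k ω) l B n := by
  refine Real.measurable_exp.comp (Measurable.const_mul (Measurable.sub
    (measurable_selfNorm hx hη) (Measurable.const_mul ?_ _)) _)
  refine Finset.measurable_sum _ fun k hk => ?_
  have h : ∀ i ≤ k, Measurable (x i) := fun i hi =>
    hx i (hi.trans_lt (Finset.mem_range.mp hk))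
  exact (measurable_lever h).div ((measurable_lever h).const_add 1)

/-- The index ranges matter: the regressor at time `n` is used but the noise at time `n` is not, so
the weight is predictable. -/
lemma measurable_expWeight (hx : ∀ i ≤ n, Measurable (x i))
    (hη : ∀ i < n, ∀ j, Measurable fun ω => η i ω j) (l B : ℝ) (j : ι) :
    Measurable fun ω => expWeight (fun k => x k ω) (fun k => η k ω) l B n j := by
  have hlev := measurable_lever hx
  refine ((Measurable.mul (measurable_expSelfNorm (fun i hi => hx i hi.le) hη l B) ?_).mul
    (measurable_const.div (hlev.const_add 1))).mul (measurable_noiseCorr hx hη j)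
  refine Real.measurable_exp.comp (Measurable.neg (Measurable.div (Measurable.const_mul ?_ _)
    (hlev.const_add 1)))
  exact Finset.measurable_sum _ fun j _ => (measurable_noiseCorr hx hη j).pow_const 2

end Measurability

/-! ### The supermartingale and its tail bound. -/

section Concentration

variable {Ω : Type*} {mΩ : MeasurableSpace Ω} {Pr : Measure Ω} [IsProbabilityMeasure Pr]
  {ℱ : ℕ → MeasurableSpace Ω} {x : ℕ → Ω → EuclideanSpace ℝ (Fin m)} {η : ℕ → Ω → ι → ℝ}
  {B : ℝ} {K : ℕ}

lemma integrable_of_measurable_of_abs_le {f : Ω → ℝ} (hf : Measurable f) {C : ℝ}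
    (hC : ∀ ω, |f ω| ≤ C) : Integrable f Pr :=
  Integrable.of_bound hf.aestronglyMeasurable C (Filter.Eventually.of_forall hC)

/-- `η` is a bounded noise sequence that is centered given the past `ℱ`. -/
structure IsNoise (Pr : Measure Ω) (ℱ : ℕ → MeasurableSpace Ω) (η : ℕ → Ω → ι → ℝ) (B : ℝ)
    (K : ℕ) : Prop where
  meas : ∀ n j, Measurable[ℱ (n + 1)] fun ω => η n ω j
  bound : ∀ n ω, ∑ j, η n ω j ^ 2 ≤ B ^ 2
  mean : ∀ n < K, ∀ j, ∀ g : Ω → ℝ, Measurable[ℱ n] g → (∃ C, ∀ ω, |g ω| ≤ C) →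
    ∫ ω, g ω * η n ω j ∂Pr = 0

/-- Integrate `expSelfNorm_succ_le`: its noise term vanishes because the weight is bounded and known
before the noise. -/
lemma integral_expSelfNorm_le_one (hmono : Monotone ℱ) (hle : ∀ n, ℱ n ≤ mΩ)
    (hxm : ∀ n, Measurable[ℱ n] (x n)) (hx : ∀ n ω, ‖x n ω‖ ≤ 1)
    (hη : IsNoise Pr ℱ η B K) {l : ℝ} (hl : 0 ≤ l) (hlB : 4 * l * B ^ 2 ≤ 1) (n : ℕ)
    (hn : n ≤ K) :
    ∫ ω, expSelfNorm (fun k => x k ω) (fun k => η k ω) l B n ∂Pr ≤ 1 := by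
  have hxm' : ∀ n i, i ≤ n → Measurable[ℱ n] (x i) := fun n i hi =>
    (hxm i).mono (hmono hi) le_rfl
  have hηm' : ∀ n i, i < n → ∀ j, Measurable[ℱ n] fun ω => η i ω j := fun n i hi j =>
    (hη.meas i j).mono (hmono hi) le_rfl
  have hmZ : ∀ n, Measurable fun ω => expSelfNorm (fun k => x k ω) (fun k => η k ω) l B n :=
    fun n => (measurable_expSelfNorm (fun i hi => hxm' n i hi.le) (hηm' n) l B).mono
      (hle n) le_rfl
  have hiZ : ∀ n, Integrable
      (fun ω => expSelfNorm (fun k => x k ω) (fun k => η k ω) l B n) Pr := fun n =>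
    integrable_of_measurable_of_abs_le (hmZ n) fun ω =>
      abs_expSelfNorm_le _ _ hl (fun i => hη.bound i ω) n
  induction n with
  | zero => simp [expSelfNorm, selfNorm, noiseSum, quad_zero]
  | succ n ih =>
    have hmW : ∀ j, Measurable[ℱ n]
        fun ω => expWeight (fun k => x k ω) (fun k => η k ω) l B n j :=
      fun j => measurable_expWeight (hxm' n) (hηm' n) l B j
    have hbW : ∀ j ω, |expWeight (fun k => x k ω) (fun k => η k ω) l B n j| ≤ _ := fun j ω =>
      abs_expWeight_le _ _ hl (fun i => hx i ω) (fun i => hη.bound i ω) n j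
    have hηb : ∀ j ω, |η n ω j| ≤ |B| := fun j ω => by
      refine sq_le_sq.mp (le_trans ?_ (hη.bound n ω))
      exact Finset.single_le_sum (f := fun j => η n ω j ^ 2) (fun _ _ => sq_nonneg _)
        (Finset.mem_univ j)
    have hiW : ∀ j, Integrable
        (fun ω => expWeight (fun k => x k ω) (fun k => η k ω) l B n j * η n ω j) Pr :=
      fun j => integrable_of_measurable_of_abs_le
        (((hmW j).mono (hle n) le_rfl).mul ((hη.meas n j).mono (hle _) le_rfl))
        fun ω => by
          rw [abs_mul]
          exact mul_le_mul (hbW j ω) (hηb j ω) (abs_nonneg _) ((abs_nonneg _).trans (hbW j ω))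
    calc ∫ ω, expSelfNorm (fun k => x k ω) (fun k => η k ω) l B (n + 1) ∂Pr
        ≤ ∫ ω, (expSelfNorm (fun k => x k ω) (fun k => η k ω) l B n
            + ∑ j, expWeight (fun k => x k ω) (fun k => η k ω) l B n j * η n ω j) ∂Pr :=
          integral_mono (hiZ _) ((hiZ n).add (integrable_finsetSum _ fun j _ => hiW j))
            fun ω => expSelfNorm_succ_le _ _ hl hlB (fun i => hη.bound i ω) n
      _ = ∫ ω, expSelfNorm (fun k => x k ω) (fun k => η k ω) l B n ∂Pr := by
          rw [integral_add (hiZ n) (integrable_finsetSum _ fun j _ => hiW j),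
            integral_finsetSum _ fun j _ => hiW j]
          simp only [add_eq_left]
          exact Finset.sum_eq_zero fun j _ => hη.mean n hn j _ (hmW j) ⟨_, hbW j⟩
      _ ≤ 1 := ih (Nat.le_of_succ_le hn)

/-- **Self-normalized concentration** for vector-valued noise, free of the noise dimension. -/
theorem measure_selfNorm_gt_le (hmono : Monotone ℱ) (hle : ∀ n, ℱ n ≤ mΩ)
    (hxm : ∀ n, Measurable[ℱ n] (x n)) (hx : ∀ n ω, ‖x n ω‖ ≤ 1) (hB : 0 < B)
    (hη : IsNoise Pr ℱ η B K) {δ : ℝ} (hδ : 0 < δ) {n : ℕ} (hn : n ≤ K) :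
    Pr {ω | B ^ 2 * (m * Real.log (m + n)) + 4 * B ^ 2 * Real.log (1 / δ)
      < selfNorm (fun k => x k ω) (fun k => η k ω) n} ≤ ENNReal.ofReal δ := by
  -- The largest exponent that the supermartingale step allows; Markov's inequality turns it into
  -- the factor `4 B²` of `log (1 / δ)`.
  set l : ℝ := 1 / (4 * B ^ 2) with hl
  have hl0 : 0 < l := by positivity
  have hlB : 4 * l * B ^ 2 ≤ 1 := le_of_eq (by rw [hl]; field_simp)
  set Z : Ω → ℝ := fun ω => expSelfNorm (fun k => x k ω) (fun k => η k ω) l B n with hZ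
  have hmZ : Measurable Z := (measurable_expSelfNorm (n := n)
    (fun i hi => (hxm i).mono (hmono hi.le) le_rfl)
    (fun i hi j => (hη.meas i j).mono (hmono hi) le_rfl) l B).mono (hle n) le_rfl
  have hfint : Integrable Z Pr := integrable_of_measurable_of_abs_le hmZ fun ω =>
    abs_expSelfNorm_le _ _ hl0.le (fun i => hη.bound i ω) n
  have h1 : ∫ ω, Z ω ∂Pr ≤ 1 :=
    integral_expSelfNorm_le_one hmono hle hxm hx hη hl0.le hlB n hn
  have h2 := mul_meas_ge_le_integral_of_nonneg (μ := Pr) (f := Z)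
    (Filter.Eventually.of_forall fun ω => (Real.exp_pos _).le) hfint (1 / δ)
  have h3 : Pr.real {ω | 1 / δ ≤ Z ω} ≤ δ := by
    have h4 : 1 / δ * Pr.real {ω | 1 / δ ≤ Z ω} ≤ 1 := h2.trans h1
    rwa [div_mul_eq_mul_div, one_mul, div_le_one hδ] at h4
  refine le_trans (measure_mono fun ω hω => ?_)
    ((ENNReal.le_ofReal_iff_toReal_le (measure_ne_top _ _) hδ.le).mpr h3)
  simp only [Set.mem_ofPred_eq] at hω ⊢
  have h5 : ∑ i ∈ Finset.range n, lever (fun k => x k ω) i / (1 + lever (fun k => x k ω) i)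
      ≤ m * Real.log (m + n) :=
    (sum_lever_le_log_det _ n).trans (log_det_gram_le _ (fun i => hx i ω) n)
  rw [← Real.exp_log (by positivity : 0 < 1 / δ)]
  refine Real.exp_le_exp.mpr ?_
  rw [hl, div_mul_eq_mul_div, one_mul, le_div_iff₀ (by positivity)]
  nlinarith [sq_nonneg B, mul_le_mul_of_nonneg_left h5 (sq_nonneg B)]

end Concentration

end SelfNormalized

/-! ### Integrating out a fresh variable while the past is held fixed. -/

section Freezing

variable {Ω S T : Type*} [MeasurableSpace Ω] [MeasurableSpace S] [MeasurableSpace T]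

/-- Two finite measures on a product agree once they agree on rectangles, and on rectangles the
composition product is the assumed disintegration. -/
lemma map_prodMk_eq_compProd {Pr : Measure Ω} [IsProbabilityMeasure Pr] {X : Ω → T} {Y : Ω → S}
    (hX : Measurable X) (hY : Measurable Y) (κ : Kernel T S) [IsMarkovKernel κ]
    (h : ∀ A B, MeasurableSet A → MeasurableSet B →
      Pr.real (X ⁻¹' A ∩ Y ⁻¹' B) = ∫ ω in X ⁻¹' A, (κ (X ω)).real B ∂Pr) :
    Pr.map (fun ω => (X ω, Y ω)) = (Pr.map X).compProd κ := by
  have := Measure.isProbabilityMeasure_map (μ := Pr) (hX.prodMk hY).aemeasurable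
  have := Measure.isProbabilityMeasure_map (μ := Pr) hX.aemeasurable
  refine Measure.ext_prod fun {A B} hA hB => ?_
  rw [Measure.map_apply (hX.prodMk hY) (hA.prod hB), Measure.compProd_apply_prod hA hB,
    setLIntegral_map hA (κ.measurable_coe hB) hX]
  have h1 : (fun ω => (X ω, Y ω)) ⁻¹' (A ×ˢ B) = X ⁻¹' A ∩ Y ⁻¹' B := rfl
  have h2 : ∀ ω, κ (X ω) B = ENNReal.ofReal ((κ (X ω)).real B) := fun ω =>
    (ofReal_measureReal (measure_ne_top _ _)).symm
  have hm : Measurable fun ω => (κ (X ω)).real B :=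
    ((κ.measurable_coe hB).comp hX).ennreal_toReal
  rw [h1, lintegral_congr h2, ← ofReal_integral_eq_lintegral_ofReal, ← h A B hA hB,
    ofReal_measureReal (measure_ne_top _ _)]
  · exact integrable_of_measurable_of_abs_le (Pr := Pr) (C := 1) hm (fun ω => by
      rw [abs_of_nonneg measureReal_nonneg]; exact measureReal_le_one) |>.integrableOn
  · exact Filter.Eventually.of_forall fun ω => measureReal_nonneg

lemma integral_eq_of_forall_rectangle {Pr : Measure Ω} [IsProbabilityMeasure Pr] {X : Ω → T}
    {Y : Ω → S} (hX : Measurable X) (hY : Measurable Y) (κ : Kernel T S) [IsMarkovKernel κ]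
    (h : ∀ A B, MeasurableSet A → MeasurableSet B →
      Pr.real (X ⁻¹' A ∩ Y ⁻¹' B) = ∫ ω in X ⁻¹' A, (κ (X ω)).real B ∂Pr)
    {f : T × S → ℝ} (hf : Measurable f) {C : ℝ} (hC : ∀ z, |f z| ≤ C) :
    ∫ ω, f (X ω, Y ω) ∂Pr = ∫ ω, ∫ y, f (X ω, y) ∂κ (X ω) ∂Pr := by
  have := Measure.isProbabilityMeasure_map (μ := Pr) hX.aemeasurable
  calc ∫ ω, f (X ω, Y ω) ∂Pr = ∫ z, f z ∂(Pr.map fun ω => (X ω, Y ω)) :=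
        (integral_map (hX.prodMk hY).aemeasurable hf.aestronglyMeasurable).symm
    _ = ∫ z, f z ∂((Pr.map X).compProd κ) := by rw [map_prodMk_eq_compProd hX hY κ h]
    _ = ∫ t, ∫ y, f (t, y) ∂κ t ∂(Pr.map X) :=
        Measure.integral_compProd (integrable_of_measurable_of_abs_le hf hC)
    _ = _ := integral_map hX.aemeasurable
        (hf.stronglyMeasurable.integral_kernel_prod_right').aestronglyMeasurable

end Freezing

/-- Conditional expectations of functions of the past and one fresh variable. -/
lemma integral_freeze {Ω S : Type*} {𝓖 mΩ : MeasurableSpace Ω} {mS : MeasurableSpace S}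
    (hle : 𝓖 ≤ mΩ) {Pr : Measure Ω} [IsProbabilityMeasure Pr]
    {Y : Ω → S} (hY : Measurable Y) (κ : @Kernel Ω S 𝓖 mS) (hκ : ∀ ω, IsProbabilityMeasure (κ ω))
    (h : ∀ B, MeasurableSet B →
      Pr[(Y ⁻¹' B).indicator (fun _ => (1 : ℝ)) | 𝓖] =ᵐ[Pr] fun ω => (κ ω).real B)
    {f : Ω → S → ℝ} (hf : Measurable[𝓖.prod mS] (Function.uncurry f)) {C : ℝ}
    (hC : ∀ ω y, |f ω y| ≤ C) :
    ∫ ω, f ω (Y ω) ∂Pr = ∫ ω, ∫ y, f ω y ∂κ ω ∂Pr := by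
  have hmk : @IsMarkovKernel Ω S 𝓖 mS κ := @IsMarkovKernel.mk Ω S 𝓖 mS κ hκ
  -- The past is represented by the identity map from `(Ω, mΩ)` to `(Ω, 𝓖)`, so no random variable
  -- generating `𝓖` is needed.
  refine @integral_eq_of_forall_rectangle Ω S Ω mΩ mS 𝓖 Pr _ id Y (measurable_id'' hle) hY κ hmk
    (fun A B hA hB => ?_) (Function.uncurry f) hf C (fun z => hC z.1 z.2)
  have hfint : Integrable ((Y ⁻¹' B).indicator (fun _ => (1 : ℝ))) Pr :=
    (integrable_const 1).indicator (hY hB)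
  have h1 := setIntegral_condExp hle hfint hA
  rw [setIntegral_congr_ae (g := fun ω => (κ ω).real B) (hle _ hA)
    ((h B hB).mono fun ω hω _ => hω)] at h1
  simp only [Set.preimage_id, id]
  rw [h1, setIntegral_indicator (hY hB), setIntegral_const, smul_eq_mul, mul_one]

/-! ### The filtration over episodes and the noise of transitions and returns. -/

section History

variable {S A Ω : Type*} [MeasurableSpace S] [MeasurableSpace A] {d H : ℕ}
  {s : ℕ → ℕ → Ω → S} {a : ℕ → ℕ → Ω → A} {r : ℕ → ℕ → Ω → EuclideanSpace ℝ (Fin d)}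

lemma measurable_history_state {k h i j : ℕ} (hij : (i < k ∧ j ≤ H) ∨ (i = k ∧ j ≤ h)) :
    Measurable[history H s a r k h] (s i j) := by
  refine (comap_measurable (s i j)).mono (le_trans ?_ (le_sup_left.trans le_sup_left)) le_rfl
  exact le_iSup_of_le i (le_iSup_of_le j (le_iSup_of_le hij le_rfl))

lemma measurable_history_action {k h i j : ℕ} (hij : (i < k ∧ j < H) ∨ (i = k ∧ j ≤ h)) :
    Measurable[history H s a r k h] (a i j) := by
  refine (comap_measurable (a i j)).mono (le_trans ?_ (le_sup_right.trans le_sup_left)) le_rfl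
  exact le_iSup_of_le i (le_iSup_of_le j (le_iSup_of_le hij le_rfl))

lemma measurable_history_return {k h i j : ℕ} (hij : (i < k ∧ j < H) ∨ (i = k ∧ j < h)) :
    Measurable[history H s a r k h] (r i j) := by
  refine (comap_measurable (r i j)).mono (le_trans ?_ le_sup_right) le_rfl
  exact le_iSup_of_le i (le_iSup_of_le j (le_iSup_of_le hij le_rfl))

/-- Time is the episode number, with the step `h` fixed. The condition `h < H` ensures that the
action of step `h` is still recorded in the history of the next episode. -/
lemma history_mono {h : ℕ} (hh : h < H) : Monotone fun k => history H s a r k h := by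
  refine monotone_nat_of_le_succ fun k => ?_
  refine sup_le (sup_le ?_ ?_) ?_
  · exact iSup_le fun i => iSup_le fun j => iSup_le fun hij =>
      (measurable_history_state (by omega)).comap_le
  · exact iSup_le fun i => iSup_le fun j => iSup_le fun hij =>
      (measurable_history_action (by omega)).comap_le
  · exact iSup_le fun i => iSup_le fun j => iSup_le fun hij =>
      (measurable_history_return (by omega)).comap_le

variable {mΩ : MeasurableSpace Ω} {M : VMDP S A d} {s₁ : S} {K : ℕ}
  {rule : (ℕ → ℕ → S) → (ℕ → ℕ → A) → ℕ → ℕ → S → A} {Pr : Measure Ω}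

lemma IsRun.history_le (hrun : IsRun M s₁ H K rule Pr s a r) (k h : ℕ) :
    history H s a r k h ≤ mΩ := by
  refine sup_le (sup_le ?_ ?_) ?_
  · exact iSup_le fun i => iSup_le fun j => iSup_le fun _ => (hrun.measurable_s i j).comap_le
  · exact iSup_le fun i => iSup_le fun j => iSup_le fun _ => (hrun.measurable_a i j).comap_le
  · exact iSup_le fun i => iSup_le fun j => iSup_le fun _ => (hrun.measurable_r i j).comap_le

lemma measurable_history_pair (k h : ℕ) :
    Measurable[history H s a r k h] fun ω => (s k h ω, a k h ω) :=
  (measurable_history_state (Or.inr ⟨rfl, le_rfl⟩)).prodMk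
    (measurable_history_action (Or.inr ⟨rfl, le_rfl⟩))

variable [IsProbabilityMeasure Pr]

lemma VMDP.measurable_integral_P (M : VMDP S A d) (h : ℕ) {𝓖 : MeasurableSpace Ω}
    {z : Ω → S × A} (hz : Measurable[𝓖] z) {f : Ω → S → ℝ}
    (hf : Measurable[𝓖.prod inferInstance] (Function.uncurry f)) :
    Measurable[𝓖] fun ω => ∫ y, f ω y ∂M.P h (z ω) := by
  have := M.markov h
  let κ : @Kernel Ω S 𝓖 _ := @Kernel.comap (S × A) S _ _ Ω 𝓖 (M.P h) z hz
  have hκ : @IsMarkovKernel Ω S 𝓖 _ κ := ⟨fun ω => (M.markov h).isProbabilityMeasure (z ω)⟩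
  exact (@StronglyMeasurable.integral_kernel_prod_right' Ω S 𝓖 _ κ ℝ _ _ _ _
    hf.stronglyMeasurable).measurable

/-- The transition noise of step `h` for bounded test functions that are known before the
transition. -/
lemma IsRun.isNoise_transition (hrun : IsRun M s₁ H K rule Pr s a r) {h : ℕ} (hh : h < H)
    {f : ℕ → Ω → S → ℝ}
    (hf : ∀ k, Measurable[(history H s a r k h).prod inferInstance] (Function.uncurry (f k)))
    {C : ℝ} (hC : ∀ k ω y, |f k ω y| ≤ C) :
    IsNoise Pr (fun k => history H s a r k h)
      (fun k ω (_ : Unit) =>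
        f k ω (s k (h + 1) ω) - ∫ y, f k ω y ∂M.P h (s k h ω, a k h ω)) (2 * C) K := by
  have hP : ∀ z, IsProbabilityMeasure (M.P h z) := (M.markov h).isProbabilityMeasure
  have hmono := history_mono (s := s) (a := a) (r := r) hh
  have hI : ∀ k ω, |∫ y, f k ω y ∂M.P h (s k h ω, a k h ω)| ≤ C := fun k ω => by
    have := norm_integral_le_of_norm_le_const (μ := M.P h (s k h ω, a k h ω))
      (f := f k ω) (Filter.Eventually.of_forall (hC k ω))
    simpa using this
  have hmI : ∀ k, Measurable[history H s a r k h]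
      fun ω => ∫ y, f k ω y ∂M.P h (s k h ω, a k h ω) := fun k =>
    M.measurable_integral_P h (measurable_history_pair k h) (hf k)
  have hmf : ∀ k, Measurable[history H s a r (k + 1) h] fun ω => f k ω (s k (h + 1) ω) := by
    intro k
    -- The test function is known before the transition, but the next state is only known to the
    -- history of episode `k + 1`, whose states are recorded up to step `H` inclusive.
    have h1 : @Measurable Ω (Ω × S) (history H s a r (k + 1) h)
        ((history H s a r k h).prod inferInstance) fun ω => (ω, s k (h + 1) ω) :=
      @Measurable.prodMk Ω (history H s a r (k + 1) h) Ω S (history H s a r k h) _ _ _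
        (measurable_id'' (hmono k.le_succ)) (measurable_history_state (Or.inl ⟨by omega, hh⟩))
    exact (hf k).comp h1
  refine ⟨fun n _ => ?_, fun n ω => ?_, fun n hn _ g hg ⟨D, hD⟩ => ?_⟩
  · exact (hmf n).sub ((hmI n).mono (hmono n.le_succ) le_rfl)
  · simp only [Finset.univ_unique, Finset.sum_singleton]
    refine sq_le_sq' ?_ ?_ <;> linarith [abs_le.mp (hC n ω (s n (h + 1) ω)), abs_le.mp (hI n ω)]
  · have hle := hrun.history_le n h
    let κ : @Kernel Ω S (history H s a r n h) _ := @Kernel.comap (S × A) S _ _ Ω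
      (history H s a r n h) (M.P h) (fun ω => (s n h ω, a n h ω)) (measurable_history_pair n h)
    -- Multiplying the test function by the predictable weight `g` reduces the centering claim to
    -- one application of `integral_freeze`.
    have hgf : Measurable[(history H s a r n h).prod inferInstance]
        (Function.uncurry fun ω y => g ω * f n ω y) :=
      Measurable.mul (hg.comp (@measurable_fst Ω S (history H s a r n h) _)) (hf n)
    have h1 := integral_freeze hle (hrun.measurable_s n (h + 1)) κ (fun ω => hP _)
      (hrun.transition n hn h hh) hgf (C := D * C) (fun ω y => by
        rw [abs_mul]
        exact mul_le_mul (hD ω) (hC n ω y) (abs_nonneg _) ((abs_nonneg _).trans (hD ω)))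
    have h2 : ∀ ω, ∫ y, g ω * f n ω y ∂κ ω
        = g ω * ∫ y, f n ω y ∂M.P h (s n h ω, a n h ω) := fun ω => integral_const_mul _ _
    simp only [h2] at h1
    have hg' := hg.mono hle le_rfl
    simp only [mul_sub]
    rw [integral_sub, h1, sub_self]
    · exact integrable_of_measurable_of_abs_le (C := D * C)
        (hg'.mul ((hmf n).mono (hrun.history_le _ _) le_rfl)) fun ω => by
          rw [abs_mul]
          exact mul_le_mul (hD ω) (hC n ω _) (abs_nonneg _) ((abs_nonneg _).trans (hD ω))
    · exact integrable_of_measurable_of_abs_le (C := D * C)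
        (hg'.mul ((hmI n).mono hle le_rfl)) fun ω => by
          rw [abs_mul]
          exact mul_le_mul (hD ω) (hI n ω) (abs_nonneg _) ((abs_nonneg _).trans (hD ω))

/-- The return sample, set to zero on the null event that it leaves the unit ball. -/
def truncReturn (v : EuclideanSpace ℝ (Fin d)) : EuclideanSpace ℝ (Fin d) :=
  if ‖v‖ ≤ 1 then v else 0

lemma norm_truncReturn_le (v : EuclideanSpace ℝ (Fin d)) : ‖truncReturn v‖ ≤ 1 := by
  unfold truncReturn
  split_ifs with h
  · exact h
  · simp

lemma measurable_truncReturn : Measurable (truncReturn (d := d)) :=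
  Measurable.ite (measurableSet_le measurable_norm measurable_const) measurable_id
    measurable_const

/-- Truncation makes the bound hold for every outcome and changes no integral. The whole return
vector is one noise variable of norm at most two; this later gives uniformity in `θ` without a net.
-/
lemma IsRun.isNoise_return (hrun : IsRun M s₁ H K rule Pr s a r) {h : ℕ} (hh : h < H) :
    IsNoise Pr (fun k => history H s a r k h)
      (fun k ω (j : Fin d) => truncReturn (r k h ω) j - M.r h (s k h ω, a k h ω) j) 2 K := by
  have hmono := history_mono (s := s) (a := a) (r := r) hh
  have hmr : ∀ k, Measurable[history H s a r k h] fun ω => M.r h (s k h ω, a k h ω) := fun k =>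
    (M.measurable_r h).comp (measurable_history_pair k h)
  refine ⟨fun n j => ?_, fun n ω => ?_, fun n hn j g hg ⟨D, hD⟩ => ?_⟩
  · exact (measurable_euclidean_apply (measurable_truncReturn.comp
      (measurable_history_return (Or.inl ⟨by omega, hh⟩))) j).sub
      ((measurable_euclidean_apply (hmr n) j).mono (hmono n.le_succ) le_rfl)
  · have h1 : ∑ j, (truncReturn (r n h ω) j - M.r h (s n h ω, a n h ω) j) ^ 2
        = ‖truncReturn (r n h ω) - M.r h (s n h ω, a n h ω)‖ ^ 2 := by
      rw [EuclideanSpace.real_norm_sq_eq]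
      rfl
    rw [h1]
    refine pow_le_pow_left₀ (norm_nonneg _) ?_ 2
    refine (norm_sub_le _ _).trans ?_
    linarith [norm_truncReturn_le (r n h ω), M.norm_r_le h (s n h ω, a n h ω)]
  · have hle := hrun.history_le n h
    have hrint : Integrable (r n h) Pr := Integrable.of_bound
      (hrun.measurable_r n h).aestronglyMeasurable 1 (hrun.return_ball n hn h hh)
    have hrj : Integrable (fun ω => r n h ω j) Pr :=
      (EuclideanSpace.proj (𝕜 := ℝ) j).integrable_comp hrint
    -- Coordinate projections are continuous and linear, hence commute with conditional expectation.
    have h1 : (fun ω => M.r h (s n h ω, a n h ω) j)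
        =ᵐ[Pr] Pr[fun ω => r n h ω j | history H s a r n h] := by
      have h2 := (EuclideanSpace.proj (𝕜 := ℝ) j).comp_condExp_comm (m := history H s a r n h)
        hrint
      refine Filter.EventuallyEq.trans ?_ h2
      filter_upwards [hrun.return_mean n hn h hh] with ω hω
      simp [hω]
    have hgint : Integrable (fun ω => g ω * r n h ω j) Pr :=
      hrj.bdd_mul (hg.mono hle le_rfl).aestronglyMeasurable (Filter.Eventually.of_forall hD)
    have h3 := condExp_mul_of_stronglyMeasurable_left (μ := Pr) (m := history H s a r n h)
      hg.stronglyMeasurable hgint hrj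
    have h4 : ∫ ω, g ω * r n h ω j ∂Pr
        = ∫ ω, g ω * M.r h (s n h ω, a n h ω) j ∂Pr := by
      rw [← integral_condExp hle]
      refine integral_congr_ae (h3.trans ?_)
      filter_upwards [h1] with ω hω
      simp [hω]
    have h5 : ∫ ω, g ω * (truncReturn (r n h ω) j - M.r h (s n h ω, a n h ω) j) ∂Pr
        = ∫ ω, (g ω * r n h ω j - g ω * M.r h (s n h ω, a n h ω) j) ∂Pr := by
      refine integral_congr_ae ?_
      filter_upwards [hrun.return_ball n hn h hh] with ω hω
      simp only [truncReturn, if_pos hω, mul_sub]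
    rw [h5, integral_sub hgint, h4, sub_self]
    have hbr : ∀ ω, |M.r h (s n h ω, a n h ω) j| ≤ 1 := fun ω =>
      (PiLp.norm_apply_le _ j).trans (M.norm_r_le _ _)
    exact integrable_of_measurable_of_abs_le (C := D * 1)
      ((hg.mul (measurable_euclidean_apply (hmr n) j)).mono hle le_rfl) fun ω => by
        rw [abs_mul]
        exact mul_le_mul (hD ω) (hbr ω) (abs_nonneg _) ((abs_nonneg _).trans (hD ω))

end History

/-! ### Values of policies and the Bellman equation. -/

section Values

variable {S A : Type*} [MeasurableSpace S] [MeasurableSpace A] {d : ℕ}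

lemma abs_integral_le_of_abs_le {T : Type*} [MeasurableSpace T] {μ : Measure T}
    [IsProbabilityMeasure μ] {f : T → ℝ} {C : ℝ} (hC : ∀ t, |f t| ≤ C) : |∫ t, f t ∂μ| ≤ C := by
  have := norm_integral_le_of_norm_le_const (μ := μ) (f := f) (Filter.Eventually.of_forall hC)
  simpa using this

lemma measurable_finCons {T : Type*} [MeasurableSpace T] (n : ℕ) :
    Measurable fun q : T × (Fin n → T) => (Fin.cons q.1 q.2 : Fin (n + 1) → T) := by
  refine measurable_pi_lambda _ fun i => ?_
  refine Fin.cases ?_ (fun i => ?_) i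
  · simpa using measurable_fst
  · simp only [Fin.cons_succ]
    exact (measurable_pi_apply i).comp measurable_snd

instance VMDP.isMarkovKernel_traj (M : VMDP S A d) (π : Policy S A) (n h : ℕ) :
    IsMarkovKernel (M.traj π n h) := by
  induction n generalizing h with
  | zero => rw [VMDP.traj]; infer_instance
  | succ n ih =>
    have := M.markov h
    have := π.markov h
    have := ih (h + 1)
    rw [VMDP.traj]
    exact Kernel.IsMarkovKernel.map _ (measurable_finCons n)

/-- The scalarized value of the next `n` steps from step `h`. -/
def VMDP.valueN (M : VMDP S A d) (θ : EuclideanSpace ℝ (Fin d)) (π : Policy S A) (n h : ℕ)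
    (s : S) : ℝ :=
  ∫ τ, ∑ i : Fin n, inner ℝ θ (M.r (h + i) (τ i)) ∂(M.traj π n h s)

lemma VMDP.value_eq_valueN (M : VMDP S A d) (H : ℕ) (θ : EuclideanSpace ℝ (Fin d))
    (π : Policy S A) (h : ℕ) (s : S) : M.value H θ π h s = M.valueN θ π (H - h) h s := rfl

variable (M : VMDP S A d) {θ : EuclideanSpace ℝ (Fin d)} (π : Policy S A)

lemma VMDP.abs_inner_r_le (hθ : ‖θ‖ ≤ 1) (h : ℕ) (z : S × A) :
    |inner ℝ θ (M.r h z)| ≤ 1 :=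
  (abs_real_inner_le_norm _ _).trans (mul_le_one₀ hθ (norm_nonneg _) (M.norm_r_le h z))

lemma VMDP.measurable_inner_r (h : ℕ) : Measurable fun z => inner ℝ θ (M.r h z) :=
  measurable_const.inner (M.measurable_r h)

lemma VMDP.abs_return_le (hθ : ‖θ‖ ≤ 1) (n h : ℕ) (τ : Fin n → S × A) :
    |∑ i : Fin n, inner ℝ θ (M.r (h + i) (τ i))| ≤ n := by
  refine (Finset.abs_sum_le_sum_abs _ _).trans ?_
  refine (Finset.sum_le_sum fun (i : Fin n) _ => M.abs_inner_r_le hθ (h + i) (τ i)).trans ?_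
  simp

lemma VMDP.measurable_return (n h : ℕ) :
    Measurable fun τ : Fin n → S × A => ∑ i : Fin n, inner ℝ θ (M.r (h + i) (τ i)) :=
  Finset.measurable_sum _ fun i _ => (M.measurable_inner_r _).comp (measurable_pi_apply i)

lemma VMDP.abs_valueN_le (hθ : ‖θ‖ ≤ 1) (n h : ℕ) (s : S) : |M.valueN θ π n h s| ≤ n :=
  abs_integral_le_of_abs_le (M.abs_return_le hθ n h)

lemma VMDP.measurable_valueN (n h : ℕ) : Measurable (M.valueN θ π n h) :=
  ((M.measurable_return n h).stronglyMeasurable.integral_kernel).measurable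

lemma VMDP.valueN_zero (h : ℕ) (s : S) : M.valueN θ π 0 h s = 0 := by
  simp [VMDP.valueN]

/-- The Bellman equation. -/
lemma VMDP.valueN_succ (hθ : ‖θ‖ ≤ 1) (n h : ℕ) (s : S) :
    M.valueN θ π (n + 1) h s = ∫ a, (inner ℝ θ (M.r h (s, a))
      + ∫ s', M.valueN θ π n (h + 1) s' ∂M.P h (s, a)) ∂π.act h s := by
  have hP := M.markov h
  have hπ := π.markov h
  have hcons := measurable_finCons (T := S × A) n
  have hm := M.measurable_return (θ := θ) (n + 1) h
  set F : (S × A) × (Fin n → S × A) → ℝ := fun q =>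
    inner ℝ θ (M.r h q.1) + ∑ i : Fin n, inner ℝ θ (M.r (h + 1 + i) (q.2 i)) with hF
  have hFm : Measurable F := ((M.measurable_inner_r h).comp measurable_fst).add
    ((M.measurable_return n (h + 1)).comp measurable_snd)
  have hFb : ∀ q, |F q| ≤ 1 + n := fun q => (abs_add_le _ _).trans
    (add_le_add (M.abs_inner_r_le hθ h q.1) (M.abs_return_le hθ n (h + 1) q.2))
  have h0 : M.valueN θ π (n + 1) h s = ∫ q, F q
      ∂(((Kernel.id ×ₖ (M.traj π n (h + 1) ∘ₖ M.P h)) ∘ₖ (Kernel.id ×ₖ π.act h)) s) := by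
    rw [VMDP.valueN, VMDP.traj, Kernel.map_apply _ hcons,
      integral_map hcons.aemeasurable hm.aestronglyMeasurable]
    refine integral_congr_ae (Filter.Eventually.of_forall fun q => ?_)
    simp only [Fin.sum_univ_succ, Fin.cons_zero, Fin.cons_succ, Fin.val_zero, add_zero,
      Fin.val_succ, hF, add_right_inj]
    refine Finset.sum_congr rfl fun i _ => ?_
    rw [show h + (↑i + 1) = h + 1 + ↑i by ring]
  have hFi : ∀ {ν : Measure ((S × A) × (Fin n → S × A))} [IsProbabilityMeasure ν],
      Integrable F ν := fun {ν} _ => integrable_of_measurable_of_abs_le hFm hFb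
  rw [h0, Kernel.integral_comp hFi, Kernel.prod_apply, Kernel.id_apply,
    Measure.dirac_prod, integral_map measurable_prodMk_left.aemeasurable
      (hFm.stronglyMeasurable.integral_kernel).aestronglyMeasurable]
  refine integral_congr_ae (Filter.Eventually.of_forall fun a => ?_)
  simp only
  rw [Kernel.prod_apply, Kernel.id_apply, Measure.dirac_prod,
    integral_map measurable_prodMk_left.aemeasurable hFm.aestronglyMeasurable]
  have hR : Integrable (fun τ : Fin n → S × A =>
      ∑ i : Fin n, inner ℝ θ (M.r (h + 1 + i) (τ i)))
      ((M.traj π n (h + 1) ∘ₖ M.P h) (s, a)) :=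
    integrable_of_measurable_of_abs_le (M.measurable_return n (h + 1))
      (M.abs_return_le hθ n (h + 1))
  simp only [hF]
  rw [integral_add (integrable_const _) hR, integral_const, Kernel.integral_comp hR]
  simp [VMDP.valueN]

end Values

/-! ### Linear structure of transitions and returns. -/

section Linear

variable {S A : Type*} [MeasurableSpace S] [MeasurableSpace A] {d m H : ℕ}
  {M : VMDP S A d} {φ : S × A → EuclideanSpace ℝ (Fin m)}

/-- Splitting coefficients and signed measures into positive and negative parts, and moving the
negative terms to the left, gives an identity between genuine measures, against which functions can
be integrated. -/
lemma eq_sum_smul_measure {μ : Fin m → SignedMeasure S} {c : Fin m → ℝ} {P : Measure S}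
    [IsFiniteMeasure P] (h : ∀ B, MeasurableSet B → P.real B = ∑ i, μ i B * c i) :
    P + ∑ i, ((c i).toNNReal • (μ i).toJordanDecomposition.negPart
        + (-c i).toNNReal • (μ i).toJordanDecomposition.posPart)
      = ∑ i, ((c i).toNNReal • (μ i).toJordanDecomposition.posPart
        + (-c i).toNNReal • (μ i).toJordanDecomposition.negPart) := by
  ext B hB
  rw [← measureReal_eq_measureReal_iff (measure_ne_top _ _) (measure_ne_top _ _)]
  have hsum : ∀ f : Fin m → Measure S, (∀ i, IsFiniteMeasure (f i)) →
      (∑ i, f i).real B = ∑ i, (f i).real B := fun f hf => by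
    simp only [Measure.real, Measure.finsetSum_apply]
    exact ENNReal.toReal_sum fun i _ => measure_ne_top _ _
  rw [measureReal_add_apply, hsum _ (fun _ => inferInstance), hsum _ (fun _ => inferInstance),
    h B hB, ← Finset.sum_add_distrib]
  refine Finset.sum_congr rfl fun i _ => ?_
  have h1 : μ i B = (μ i).toJordanDecomposition.posPart.real B
      - (μ i).toJordanDecomposition.negPart.real B := by
    conv_lhs => rw [← SignedMeasure.toSignedMeasure_toJordanDecomposition (μ i)]
    simp [JordanDecomposition.toSignedMeasure, hB]
  have h2 : c i = max (c i) 0 - max (-c i) 0 := by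
    rcases le_total (c i) 0 with hc | hc
    · rw [max_eq_right hc, max_eq_left (by linarith)]; ring
    · rw [max_eq_left hc, max_eq_right (by linarith)]; ring
  have h3 : ∀ (a b : NNReal) (ν ν' : Measure S) [IsFiniteMeasure ν] [IsFiniteMeasure ν'],
      (a • ν + b • ν').real B = a * ν.real B + b * ν'.real B := fun a b ν ν' _ _ => by
    rw [measureReal_add_apply, measureReal_nnreal_smul_apply, measureReal_nnreal_smul_apply]
  rw [h3, h3, Real.coe_toNNReal', Real.coe_toNNReal', h1]
  conv_lhs => enter [1, 2]; rw [h2]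
  ring

/-- In a linear VMDP, conditional expectations of bounded functions of the next state are linear
in the features. -/
lemma VMDP.IsLinear.exists_weight (hM : M.IsLinear H φ) {h : ℕ} (hh : h < H) {V : S → ℝ}
    (hV : Measurable V) {C : ℝ} (hC0 : 0 ≤ C) (hC : ∀ s, |V s| ≤ C) :
    ∃ w : EuclideanSpace ℝ (Fin m), ‖w‖ ≤ C * √m ∧
      ∀ z, ∫ y, V y ∂M.P h z = inner ℝ w (φ z) := by
  obtain ⟨μ, hμ, hP⟩ := hM.transition h hh
  have hPm : ∀ z, IsProbabilityMeasure (M.P h z) := (M.markov h).isProbabilityMeasure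
  let p := fun i => (μ i).toJordanDecomposition.posPart
  let q := fun i => (μ i).toJordanDecomposition.negPart
  have hfint : ∀ ν : Measure S, IsFiniteMeasure ν → Integrable V ν := fun ν _ =>
    Integrable.of_bound hV.aestronglyMeasurable C (Filter.Eventually.of_forall hC)
  -- The weight is the vector of integrals of `V` against the signed measures; each entry is at most
  -- `C` times a total variation mass.
  refine ⟨WithLp.toLp 2 fun i => ∫ y, V y ∂p i - ∫ y, V y ∂q i, ?_, fun z => ?_⟩
  · refine le_trans ?_ (mul_le_mul_of_nonneg_left hμ hC0)
    rw [← Real.norm_of_nonneg hC0, ← norm_smul]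
    simp only [EuclideanSpace.norm_eq]
    refine Real.sqrt_le_sqrt (Finset.sum_le_sum fun i _ => ?_)
    refine pow_le_pow_left₀ (norm_nonneg _) ?_ 2
    have h1 := norm_integral_le_of_norm_le_const (μ := p i) (f := V)
      (Filter.Eventually.of_forall hC)
    have h2 := norm_integral_le_of_norm_le_const (μ := q i) (f := V)
      (Filter.Eventually.of_forall hC)
    have h3 : (μ i).totalVariation.real Set.univ = (p i).real Set.univ + (q i).real Set.univ :=
      measureReal_add_apply
    simp only [PiLp.smul_apply, smul_eq_mul, norm_mul, Real.norm_of_nonneg hC0]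
    rw [Real.norm_of_nonneg measureReal_nonneg, h3, mul_add]
    exact (norm_sub_le _ _).trans (add_le_add h1 h2)
  · have h1 := congrArg (fun ν => ∫ y, V y ∂ν) (eq_sum_smul_measure (hP z))
    simp only at h1
    rw [integral_add_measure (hfint _ inferInstance) (hfint _ inferInstance),
      integral_finsetSum_measure (fun i _ => hfint _ inferInstance),
      integral_finsetSum_measure (fun i _ => hfint _ inferInstance)] at h1
    have h2 : ∀ (a b : NNReal) (ν ν' : Measure S), IsFiniteMeasure ν → IsFiniteMeasure ν' →
        ∫ y, V y ∂(a • ν + b • ν') = a * ∫ y, V y ∂ν + b * ∫ y, V y ∂ν' := by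
      intro a b ν ν' _ _
      rw [integral_add_measure (hfint _ inferInstance) (hfint _ inferInstance),
        integral_smul_nnreal_measure, integral_smul_nnreal_measure]
      rfl
    simp only [h2 _ _ _ _ inferInstance inferInstance] at h1
    rw [eq_sub_of_add_eq h1, ← Finset.sum_sub_distrib, inner_eq_dotProduct]
    refine Finset.sum_congr rfl fun i _ => ?_
    have h3 : φ z i = ((φ z i).toNNReal : ℝ) - ((-φ z i).toNNReal : ℝ) := by
      simp only [Real.coe_toNNReal']
      rcases le_total (φ z i) 0 with hc | hc
      · rw [max_eq_right hc, max_eq_left (by linarith)]; ring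
      · rw [max_eq_left hc, max_eq_right (by linarith)]; ring
    conv_rhs => enter [2]; rw [h3]
    simp only [p, q]
    ring

/-- The weight is the adjoint of the return matrix applied to `θ`, and the adjoint has the same
operator norm. -/
lemma VMDP.IsLinear.exists_return_weight (hM : M.IsLinear H φ) {h : ℕ} (hh : h < H)
    {θ : EuclideanSpace ℝ (Fin d)} (hθ : ‖θ‖ ≤ 1) :
    ∃ w : EuclideanSpace ℝ (Fin m), ‖w‖ ≤ √m ∧ ∀ z, inner ℝ θ (M.r h z) = inner ℝ w (φ z) := by
  obtain ⟨W, hW, hr⟩ := hM.returns h hh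
  set L := (Matrix.toEuclideanLin W).toContinuousLinearMap with hL
  refine ⟨ContinuousLinearMap.adjoint L θ, ?_, fun z => ?_⟩
  · calc ‖ContinuousLinearMap.adjoint L θ‖ ≤ ‖ContinuousLinearMap.adjoint L‖ * ‖θ‖ :=
          ContinuousLinearMap.le_opNorm _ _
      _ ≤ ‖ContinuousLinearMap.adjoint L‖ * 1 := by gcongr
      _ ≤ √m := by rw [mul_one, LinearIsometryEquiv.norm_map]; exact hW
  · rw [ContinuousLinearMap.adjoint_inner_left, hr z]
    rfl

/-- With one-dimensional features the returns do not depend on the state and action. -/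
lemma VMDP.IsLinear.returns_const_of_dim_one {φ : S × A → EuclideanSpace ℝ (Fin 1)}
    (hM : M.IsLinear H φ) {h : ℕ} (hh : h < H) (z z' : S × A) : M.r h z = M.r h z' := by
  obtain ⟨μ, -, hP⟩ := hM.transition h hh
  obtain ⟨W, -, hr⟩ := hM.returns h hh
  have hPm : ∀ z, IsProbabilityMeasure (M.P h z) := (M.markov h).isProbabilityMeasure
  have h1 : ∀ z, 1 = μ 0 Set.univ * φ z 0 := fun z => by
    simpa using hP z Set.univ MeasurableSet.univ
  have hne : μ 0 Set.univ ≠ 0 := fun h0 => by simpa [h0] using h1 z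
  have h2 : φ z = φ z' := by
    ext i
    rw [Subsingleton.elim i 0]
    exact mul_left_cancel₀ hne ((h1 z).symm.trans (h1 z'))
  rw [hr z, hr z', h2]

lemma VMDP.valueN_eq_of_returns_const (hr : ∀ h < H, ∀ z z', M.r h z = M.r h z')
    {θ : EuclideanSpace ℝ (Fin d)} (π π' : Policy S A) (n h : ℕ) (hn : n + h ≤ H) (s : S) :
    M.valueN θ π n h s = M.valueN θ π' n h s := by
  have key : ∀ (τ₀ : Fin n → S × A) (π : Policy S A), M.valueN θ π n h s
      = ∑ i : Fin n, inner ℝ θ (M.r (h + i) (τ₀ i)) := fun τ₀ π => by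
    have : ∀ τ : Fin n → S × A, ∑ i : Fin n, inner ℝ θ (M.r (h + i) (τ i))
        = ∑ i : Fin n, inner ℝ θ (M.r (h + i) (τ₀ i)) := fun τ =>
      Finset.sum_congr rfl fun i _ => by rw [hr (h + i) (by omega) (τ i) (τ₀ i)]
    simp [VMDP.valueN, this]
  obtain ⟨τ₀⟩ : Nonempty (Fin n → S × A) :=
    nonempty_of_isProbabilityMeasure (M.traj π n h s)
  rw [key τ₀ π, key τ₀ π']

end Linear

/-! ### Grids of bounded parameters. -/

section Net

/-- A set with coordinates bounded by `L` has an internal net, indexed by the cells of a grid. -/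
lemma exists_grid_net {T I : Type*} (coord : T → I → ℝ) {D : Set T} (hne : D.Nonempty)
    {L ε : ℝ} (hε : 0 < ε) (hL : ∀ p ∈ D, ∀ i, |coord p i| ≤ L) :
    ∃ rep : (I → Fin (⌊2 * L / ε⌋₊ + 1)) → T, (∀ c, rep c ∈ D) ∧
      ∀ p ∈ D, ∃ c, ∀ i, |coord p i - coord (rep c) i| ≤ ε := by
  classical
  have hcell : ∀ p ∈ D, ∀ i, ⌊(coord p i + L) / ε⌋₊ < ⌊2 * L / ε⌋₊ + 1 := fun p hp i => by
    refine Nat.lt_succ_of_le (Nat.floor_mono ?_)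
    gcongr
    linarith [(abs_le.mp (hL p hp i)).2]
  -- A cell that misses `D` receives an arbitrary element of `D`. Keeping the net inside `D` matters
  -- for `paramClass`, where positive definiteness is required of the representatives as well.
  let rep : (I → Fin (⌊2 * L / ε⌋₊ + 1)) → T := fun c =>
    if h : ∃ p ∈ D, ∀ i, ⌊(coord p i + L) / ε⌋₊ = c i then h.choose else hne.some
  refine ⟨rep, fun c => ?_, fun p hp => ⟨fun i => ⟨_, hcell p hp i⟩, fun i => ?_⟩⟩
  · by_cases h : ∃ p ∈ D, ∀ i, ⌊(coord p i + L) / ε⌋₊ = c i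
    · simp only [rep, dif_pos h]
      exact h.choose_spec.1
    · simp only [rep, dif_neg h]
      exact hne.some_mem
  · have h : ∃ p' ∈ D, ∀ i, ⌊(coord p' i + L) / ε⌋₊ =
        ((⟨_, hcell p hp i⟩ : Fin (⌊2 * L / ε⌋₊ + 1)) : ℕ) := ⟨p, hp, fun i => rfl⟩
    simp only [rep, dif_pos h]
    obtain ⟨h1, h2⟩ := h.choose_spec
    set q := h.choose
    have h3 : ∀ r ∈ D, 0 ≤ (coord r i + L) / ε := fun r hr =>
      div_nonneg (by linarith [(abs_le.mp (hL r hr i)).1]) hε.le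
    have e := h2 i
    simp only at e
    have a1 := Nat.floor_le (h3 p hp)
    have a2 := Nat.lt_floor_add_one ((coord p i + L) / ε)
    have b1 := Nat.floor_le (h3 q h1)
    have b2 := Nat.lt_floor_add_one ((coord q i + L) / ε)
    rw [e] at b1 b2
    have h4 : |(coord p i + L) / ε - (coord q i + L) / ε| ≤ 1 := abs_le.mpr
      ⟨by linarith, by linarith⟩
    rw [← sub_div, abs_div, abs_of_pos hε, div_le_one hε] at h4
    simpa using h4

end Net

/-! ### Regularity of the value functions in the regression parameters. -/

section ValueClass

lemma abs_sqrt_sub_sqrt_le (x y : ℝ) : |√x - √y| ≤ √|x - y| := by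
  wlog h : y ≤ x generalizing x y
  · rw [abs_sub_comm, abs_sub_comm x y]
    exact this y x (le_of_not_ge h)
  rw [abs_of_nonneg (sub_nonneg.mpr (Real.sqrt_le_sqrt h)), abs_of_nonneg (sub_nonneg.mpr h),
    sub_le_iff_le_add]
  rcases le_or_gt 0 y with hy | hy
  · rw [Real.sqrt_le_left (by positivity)]
    nlinarith [Real.sq_sqrt (sub_nonneg.mpr h), Real.sq_sqrt hy,
      mul_nonneg (Real.sqrt_nonneg (x - y)) (Real.sqrt_nonneg y)]
  · rw [Real.sqrt_eq_zero_of_nonpos hy.le, add_zero]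
    exact Real.sqrt_le_sqrt (by linarith)

variable {m : ℕ}

lemma abs_apply_le_one {v : EuclideanSpace ℝ (Fin m)} (hv : ‖v‖ ≤ 1) (i : Fin m) : |v i| ≤ 1 :=
  (PiLp.norm_apply_le v i).trans hv

/-- The square root is only Hölder continuous of order one half, hence `√ε`; this is why the grid
step below is a square. -/
lemma abs_bonus_sub_le {β ε : ℝ} (hβ : 0 ≤ β) {G G' : Fin m → Fin m → ℝ}
    (hG : ∀ i j, |G i j - G' i j| ≤ ε) {v : EuclideanSpace ℝ (Fin m)} (hv : ‖v‖ ≤ 1) :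
    |bonus β G v - bonus β G' v| ≤ β * (m * √ε) := by
  rw [bonus, bonus, ← mul_sub, abs_mul, abs_of_nonneg hβ]
  refine mul_le_mul_of_nonneg_left ((abs_sqrt_sub_sqrt_le _ _).trans ?_) hβ
  have h1 : |v.ofLp ⬝ᵥ (Matrix.of G).mulVec v.ofLp - v.ofLp ⬝ᵥ (Matrix.of G').mulVec v.ofLp|
      ≤ (m : ℝ) ^ 2 * ε := by
    have h2 : v.ofLp ⬝ᵥ (Matrix.of G).mulVec v.ofLp - v.ofLp ⬝ᵥ (Matrix.of G').mulVec v.ofLp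
        = ∑ i, ∑ j, v i * ((G i j - G' i j) * v j) := by
      simp only [dotProduct, Matrix.mulVec, Matrix.of_apply, Finset.mul_sum,
        ← Finset.sum_sub_distrib]
      exact Finset.sum_congr rfl fun i _ => Finset.sum_congr rfl fun j _ => by ring
    rw [h2]
    calc |∑ i, ∑ j, v i * ((G i j - G' i j) * v j)|
        ≤ ∑ i, ∑ j, |v i * ((G i j - G' i j) * v j)| :=
          (Finset.abs_sum_le_sum_abs _ _).trans
            (Finset.sum_le_sum fun i _ => Finset.abs_sum_le_sum_abs _ _)
      _ ≤ ∑ _i : Fin m, ∑ _j : Fin m, ε := by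
          refine Finset.sum_le_sum fun i _ => Finset.sum_le_sum fun j _ => ?_
          rw [abs_mul, abs_mul]
          have hi := abs_apply_le_one hv i
          have hj := abs_apply_le_one hv j
          calc |v i| * (|G i j - G' i j| * |v j|) ≤ 1 * (ε * 1) := by
                have := hG i j
                gcongr
                exact (abs_nonneg _).trans this
            _ = ε := by ring
      _ = (m : ℝ) ^ 2 * ε := by simp; ring
  refine (Real.sqrt_le_sqrt h1).trans_eq ?_
  rw [Real.sqrt_mul (sq_nonneg _), Real.sqrt_sq (Nat.cast_nonneg m)]

lemma abs_inner_sub_le {ε : ℝ} {w w' v : EuclideanSpace ℝ (Fin m)}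
    (hw : ∀ i, |w i - w' i| ≤ ε) (hv : ‖v‖ ≤ 1) : |inner ℝ w v - inner ℝ w' v| ≤ m * ε := by
  rw [← inner_sub_left, inner_eq_dotProduct]
  calc |(w - w').ofLp ⬝ᵥ v.ofLp| ≤ ∑ i, |(w i - w' i) * v i| := Finset.abs_sum_le_sum_abs _ _
    _ ≤ ∑ _i : Fin m, ε := by
        refine Finset.sum_le_sum fun i _ => ?_
        rw [abs_mul]
        have hi := abs_apply_le_one hv i
        have := hw i
        calc |w i - w' i| * |v i| ≤ ε * 1 := by
              gcongr
              exact (abs_nonneg _).trans this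
          _ = ε := mul_one _
    _ = m * ε := by simp

lemma bonus_nonneg {β : ℝ} (hβ : 0 ≤ β) (G : Fin m → Fin m → ℝ) (v : EuclideanSpace ℝ (Fin m)) :
    0 ≤ bonus β G v := mul_nonneg hβ (Real.sqrt_nonneg _)

variable {S A : Type*}

/-- What the analysis needs to know about the functions `Q_p` of the two phases. -/
structure RegularQ [MeasurableSpace S] [MeasurableSpace A] (β : ℝ) (H : ℕ)
    (Q : Param m → S → A → ℝ) : Prop where
  le : ∀ p s a, Q p s a ≤ H
  lip : ∀ (p p' : Param m) (ε : ℝ), (∀ i, |p.1 i - p'.1 i| ≤ ε) →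
    (∀ i j, |p.2 i j - p'.2 i j| ≤ ε) → ∀ s a, |Q p s a - Q p' s a| ≤ m * ε + 2 * β * (m * √ε)
  meas : Measurable fun q : Param m × S × A => Q q.1 q.2.1 q.2.2

variable [MeasurableSpace S] [MeasurableSpace A] {φ : S × A → EuclideanSpace ℝ (Fin m)}

lemma measurable_bonus (hφ : Measurable φ) (β : ℝ) :
    Measurable fun q : Param m × S × A => bonus β q.1.2 (φ (q.2.1, q.2.2)) := by
  have hv : Measurable fun q : Param m × S × A => φ (q.2.1, q.2.2) := hφ.comp measurable_snd
  refine (Measurable.sqrt ?_).const_mul _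
  simp only [dotProduct, Matrix.mulVec, Matrix.of_apply]
  refine Finset.measurable_sum _ fun i _ => (measurable_euclidean_apply hv i).mul
    (Finset.measurable_sum _ fun j _ => Measurable.mul ?_ (measurable_euclidean_apply hv j))
  exact (measurable_pi_apply j).comp ((measurable_pi_apply i).comp
    (measurable_snd.comp measurable_fst))

lemma measurable_inner_feature (hφ : Measurable φ) :
    Measurable fun q : Param m × S × A => (inner ℝ q.1.1 (φ (q.2.1, q.2.2)) : ℝ) :=
  (measurable_fst.comp measurable_fst).inner (hφ.comp measurable_snd)

lemma regularQ_planQ {β : ℝ} (hβ : 0 ≤ β) (H : ℕ) (hφ : Measurable φ) (hφ1 : ∀ z, ‖φ z‖ ≤ 1) :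
    RegularQ β H (planQ β H φ) where
  le p s a := min_le_right _ _
  lip p p' ε h1 h2 s a := by
    refine (abs_min_sub_min_le_max _ _ _ _).trans ?_
    have b := abs_bonus_sub_le hβ h2 (hφ1 (s, a))
    have i := abs_inner_sub_le h1 (hφ1 (s, a))
    have hb0 : 0 ≤ β * (m * √ε) := (abs_nonneg _).trans b
    have hi0 : 0 ≤ m * ε := (abs_nonneg _).trans i
    rw [sub_self, abs_zero]
    refine max_le ?_ (by linarith)
    have e : (inner ℝ p.1 (φ (s, a)) + bonus β p.2 (φ (s, a))) - (inner ℝ p'.1 (φ (s, a))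
        + bonus β p'.2 (φ (s, a))) = (inner ℝ p.1 (φ (s, a)) - inner ℝ p'.1 (φ (s, a)))
        + (bonus β p.2 (φ (s, a)) - bonus β p'.2 (φ (s, a))) := by ring
    rw [e]
    refine (abs_add_le _ _).trans ?_
    linarith
  meas := ((measurable_inner_feature hφ).add (measurable_bonus hφ β)).min measurable_const

/-- The bonus enters twice, directly and through the intrinsic reward, where `H ≥ 1` makes the
division harmless. This is the origin of the factor two in the Lipschitz bound of `RegularQ`. -/
lemma regularQ_exploreQ {β : ℝ} (hβ : 0 ≤ β) {H : ℕ} (hH : 1 ≤ H) (hφ : Measurable φ)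
    (hφ1 : ∀ z, ‖φ z‖ ≤ 1) : RegularQ β H (exploreQ β H φ) where
  le p s a := min_le_right _ _
  lip p p' ε h1 h2 s a := by
    refine (abs_min_sub_min_le_max _ _ _ _).trans ?_
    have b := abs_bonus_sub_le hβ h2 (hφ1 (s, a))
    have i := abs_inner_sub_le h1 (hφ1 (s, a))
    have hb0 : 0 ≤ β * (m * √ε) := (abs_nonneg _).trans b
    have hi0 : 0 ≤ m * ε := (abs_nonneg _).trans i
    have hH' : (1 : ℝ) ≤ H := by exact_mod_cast hH
    have t : |truncBonus β H φ p s a / H - truncBonus β H φ p' s a / H| ≤ β * (m * √ε) := by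
      rw [← sub_div, abs_div, abs_of_pos (by linarith : (0 : ℝ) < H)]
      refine (div_le_self (abs_nonneg _) hH').trans ?_
      refine (abs_min_sub_min_le_max _ _ _ _).trans ?_
      rw [sub_self, abs_zero]
      exact max_le b hb0
    rw [sub_self, abs_zero]
    refine max_le ?_ (by linarith)
    have e : (inner ℝ p.1 (φ (s, a)) + truncBonus β H φ p s a / H + bonus β p.2 (φ (s, a)))
        - (inner ℝ p'.1 (φ (s, a)) + truncBonus β H φ p' s a / H + bonus β p'.2 (φ (s, a)))
        = (inner ℝ p.1 (φ (s, a)) - inner ℝ p'.1 (φ (s, a)))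
        + (truncBonus β H φ p s a / H - truncBonus β H φ p' s a / H)
        + (bonus β p.2 (φ (s, a)) - bonus β p'.2 (φ (s, a))) := by ring
    rw [e]
    refine (abs_add_three _ _ _).trans ?_
    linarith
  meas := (((measurable_inner_feature hφ).add
    (((measurable_bonus hφ β).min measurable_const).div_const _)).add
      (measurable_bonus hφ β)).min measurable_const

section Greedy

variable {β : ℝ} {H : ℕ} {Q : Param m → S → A → ℝ}

/-- The value function `max_a Q_p(s, a)`, truncated below at `-H`. -/
def clipValue (H : ℕ) (G : Greedy Q) (p : Param m) (s : S) : ℝ :=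
  max (Q p s (G.act p s)) (-H)

/-- The measurable greedy rule attains the supremum; measurability of the value functions over an
arbitrary action space rests on this. -/
lemma iSup_eq_greedy (hQ : RegularQ β H Q) (G : Greedy Q) {p : Param m}
    (hp : (Matrix.of p.2).PosDef) (s : S) : ⨆ b, Q p s b = Q p s (G.act p s) :=
  have : Nonempty A := ⟨G.act p s⟩
  le_antisymm (ciSup_le (G.isMax p hp s))
    (le_ciSup (f := fun b => Q p s b) ⟨H, by rintro _ ⟨b, rfl⟩; exact hQ.le p s b⟩ (G.act p s))

lemma measurable_greedy_value (hQ : RegularQ β H Q) (G : Greedy Q) :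
    Measurable fun q : Param m × S => Q q.1 q.2 (G.act q.1 q.2) :=
  hQ.meas.comp (measurable_fst.prodMk (measurable_snd.prodMk G.measurable_act))

lemma measurable_clipValue (hQ : RegularQ β H Q) (G : Greedy Q) (p : Param m) :
    Measurable (clipValue H G p) :=
  ((measurable_greedy_value hQ G).comp (measurable_const.prodMk measurable_id)).max
    measurable_const

lemma abs_clipValue_le (hQ : RegularQ β H Q) (G : Greedy Q) (p : Param m) (s : S) :
    |clipValue H G p s| ≤ H :=
  abs_le.mpr ⟨le_max_right _ _, max_le (hQ.le _ _ _) (by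
    have : (0 : ℝ) ≤ H := Nat.cast_nonneg H
    linarith)⟩

/-- Evaluate each function at the maximizer of the other. Positive definiteness of both matrices is
needed because the greedy rule is a maximizer only there. -/
lemma abs_clipValue_sub_le (hQ : RegularQ β H Q) (G : Greedy Q) {p p' : Param m}
    (hp : (Matrix.of p.2).PosDef) (hp' : (Matrix.of p'.2).PosDef) {ε : ℝ}
    (h1 : ∀ i, |p.1 i - p'.1 i| ≤ ε) (h2 : ∀ i j, |p.2 i j - p'.2 i j| ≤ ε) (s : S) :
    |clipValue H G p s - clipValue H G p' s| ≤ m * ε + 2 * β * (m * √ε) := by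
  have hl := hQ.lip p p' ε h1 h2 s
  have h0 : 0 ≤ m * ε + 2 * β * (m * √ε) := (abs_nonneg _).trans (hl (G.act p s))
  refine (abs_max_sub_max_le_max _ _ _ _).trans ?_
  rw [sub_self, abs_zero]
  refine max_le (abs_le.mpr ⟨?_, ?_⟩) h0
  · linarith [(abs_le.mp (hl (G.act p' s))).1, G.isMax p hp s (G.act p' s)]
  · linarith [(abs_le.mp (hl (G.act p s))).2, G.isMax p' hp' s (G.act p s)]

end Greedy

end ValueClass

/-! ### Least-squares value iteration as a function of the data. -/

section LSVI

variable {S A : Type*} [MeasurableSpace S] [MeasurableSpace A] {m : ℕ} {β : ℝ} {H : ℕ}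
  {φ : S × A → EuclideanSpace ℝ (Fin m)} {Q : Param m → S → A → ℝ}

lemma fit_posDef {S A : Type*} {φ : S × A → EuclideanSpace ℝ (Fin m)} (s : ℕ → ℕ → S) (a : ℕ → ℕ → A) (g : ℕ → ℕ → ℝ) (n h : ℕ) (V : S → ℝ) :
    (Matrix.of (fit φ s a g n h V).2).PosDef := (gram_posDef _ n).inv

lemma lsviValue_succ (hQ : RegularQ β H Q) (G : Greedy Q) (s : ℕ → ℕ → S) (a : ℕ → ℕ → A)
    (g : ℕ → ℕ → ℝ) (n j : ℕ) (x : S) :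
    lsviValue Q H φ s a g n (j + 1) x =
      Q (fit φ s a g n (H - (j + 1)) (lsviValue Q H φ s a g n j)) x
        (G.act (fit φ s a g n (H - (j + 1)) (lsviValue Q H φ s a g n j)) x) :=
  iSup_eq_greedy hQ G (fit_posDef s a g n _ _) x

lemma lsviValue_eq (hQ : RegularQ β H Q) (G : Greedy Q) (s : ℕ → ℕ → S) (a : ℕ → ℕ → A)
    (g : ℕ → ℕ → ℝ) (n : ℕ) {h : ℕ} (hh : h < H) (x : S) :
    lsviValue Q H φ s a g n (H - h) x = Q (lsviParam Q H φ s a g n h) x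
        (G.act (lsviParam Q H φ s a g n h) x) := by
  obtain ⟨j, hj⟩ : ∃ j, H - h = j + 1 := ⟨H - h - 1, by omega⟩
  have h1 : H - (h + 1) = j := by omega
  have h2 : H - (j + 1) = h := by omega
  rw [hj, lsviValue_succ hQ G, lsviParam, h1, h2]

lemma le_lsviValue (hQ : RegularQ β H Q) (G : Greedy Q) (s : ℕ → ℕ → S) (a : ℕ → ℕ → A)
    (g : ℕ → ℕ → ℝ) (n : ℕ) {h : ℕ} (hh : h < H) (x : S) (b : A) :
    Q (lsviParam Q H φ s a g n h) x b ≤ lsviValue Q H φ s a g n (H - h) x := by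
  rw [lsviValue_eq hQ G s a g n hh]
  exact G.isMax _ (fit_posDef s a g n _ _) x b

variable {T : Type*} [MeasurableSpace T] {s : ℕ → ℕ → T → S} {a : ℕ → ℕ → T → A}
  {g : ℕ → ℕ → T → ℝ} {n : ℕ}

lemma measurable_fit (hφ : Measurable φ) {h : ℕ} {V : T → S → ℝ}
    (hs : ∀ i < n, Measurable (s i h)) (ha : ∀ i < n, Measurable (a i h))
    (hV : ∀ i < n, Measurable fun t => V t (s i (h + 1) t))
    (hg : ∀ i < n, Measurable (g i h)) :
    Measurable fun t => fit φ (fun i j => s i j t) (fun i j => a i j t) (fun i j => g i j t) n h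
      (V t) := by
  have hx : ∀ i < n, Measurable fun t => φ (s i h t, a i h t) := fun i hi =>
    hφ.comp ((hs i hi).prodMk (ha i hi))
  have hG := measurable_gram_inv_apply (x := fun i t => φ (s i h t, a i h t)) hx
  refine Measurable.prodMk ?_
    (measurable_pi_lambda _ fun i => measurable_pi_lambda _ fun j => hG i j)
  refine (WithLp.measurable_toLp 2 _).comp (measurable_pi_lambda _ fun i => ?_)
  simp only [Matrix.mulVec, dotProduct]
  refine Finset.measurable_sum _ fun j _ => (hG i j).mul ?_
  simp only [Finset.sum_apply, Pi.smul_apply, smul_eq_mul]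
  refine Finset.measurable_sum _ fun k hk => ?_
  have hk := Finset.mem_range.mp hk
  exact ((hV k hk).add (hg k hk)).mul (measurable_euclidean_apply (hx k hk) j)

/-- Measurability is joint in data and state and involves only the first `n` episodes. It is used
with the history as σ-algebra, to see that the exploration values are predictable. -/
lemma measurable_lsviValue (hφ : Measurable φ) (hQ : RegularQ β H Q) (G : Greedy Q)
    (hs : ∀ i < n, ∀ h ≤ H, Measurable (s i h)) (ha : ∀ i < n, ∀ h < H, Measurable (a i h))
    (hg : ∀ i < n, ∀ h < H, Measurable (g i h)) (j : ℕ) (hj : j ≤ H) :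
    Measurable fun q : T × S => lsviValue Q H φ (fun i j => s i j q.1) (fun i j => a i j q.1)
      (fun i j => g i j q.1) n j q.2 := by
  induction j with
  | zero => exact measurable_const
  | succ j ih =>
    simp only [lsviValue_succ hQ G]
    have hfit := measurable_fit (n := n) (h := H - (j + 1)) (V := fun t =>
      lsviValue Q H φ (fun i j => s i j t) (fun i j => a i j t) (fun i j => g i j t) n j) hφ
      (fun i hi => hs i hi _ (by omega)) (fun i hi => ha i hi _ (by omega))
      (fun i hi => (ih (by omega)).comp (measurable_id.prodMk (hs i hi _ (by omega))))
      (fun i hi => hg i hi _ (by omega))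
    exact (measurable_greedy_value hQ G).comp ((hfit.comp measurable_fst).prodMk measurable_snd)

end LSVI

/-! ### The common confidence radius. -/

section Radius

/-- The confidence radius of the self-normalized bounds. -/
def radius (m H K : ℕ) (δ : ℝ) : ℝ :=
  √((2 * H : ℝ) ^ 2 * (m * Real.log (m + K)) + 4 * (2 * H : ℝ) ^ 2 * Real.log (1 / δ))

/-- The dimension `m'` is free so that one radius serves both the `m`-dimensional regressions and
the one-dimensional martingale. -/
lemma le_sq_radius {m m' H K n : ℕ} {δ : ℝ} (hm' : 1 ≤ m') (hm : m' ≤ m) (hδ : 0 < δ)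
    (hδ1 : δ ≤ 1) (hn : n ≤ K) :
    (2 * H : ℝ) ^ 2 * (m' * Real.log (m' + n)) + 4 * (2 * H : ℝ) ^ 2 * Real.log (1 / δ)
      ≤ radius m H K δ ^ 2 := by
  have h1 : (1 : ℝ) ≤ m' := by exact_mod_cast hm'
  have h2 : (m' : ℝ) ≤ m := by exact_mod_cast hm
  have h3 : (n : ℝ) ≤ K := by exact_mod_cast hn
  have h4 : 0 ≤ Real.log (1 / δ) := Real.log_nonneg (by rw [le_div_iff₀ hδ]; linarith)
  have hn0 : (0 : ℝ) ≤ n := Nat.cast_nonneg n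
  have h5 : Real.log (m' + n) ≤ Real.log (m + K) := Real.log_le_log (by linarith) (by linarith)
  have h6 : 0 ≤ Real.log ((m' : ℝ) + n) := Real.log_nonneg (by linarith)
  have h7 : (m' : ℝ) * Real.log (m' + n) ≤ m * Real.log (m + K) :=
    mul_le_mul h2 h5 h6 (by linarith)
  have h8 : 0 ≤ (m : ℝ) * Real.log (m + K) :=
    (mul_nonneg (by linarith) h6).trans h7
  rw [radius, Real.sq_sqrt (by positivity)]
  gcongr

lemma radius_nonneg (m H K : ℕ) (δ : ℝ) : 0 ≤ radius m H K δ := Real.sqrt_nonneg _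

end Radius

/-! ### The events of small probability. -/

section Events

variable {S A : Type*} [MeasurableSpace S] [MeasurableSpace A] {d m : ℕ}

/-- The regression parameters that the algorithm can produce. -/
def paramClass (m : ℕ) (L : ℝ) : Set (Param m) :=
  {p | (Matrix.of p.2).PosDef ∧ (∀ i, |p.1 i| ≤ L) ∧ ∀ i j, |p.2 i j| ≤ L}

/-- The transition noise `∑_{i < n} (V(s^i_{h+1}) - P_h V(s^i_h, a^i_h)) φ^i_h`. -/
def transNoise (M : VMDP S A d) (φ : S × A → EuclideanSpace ℝ (Fin m)) (s : ℕ → ℕ → S)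
    (a : ℕ → ℕ → A) (h n : ℕ) (V : S → ℝ) : Fin m → ℝ :=
  ∑ i ∈ Finset.range n, (V (s i (h + 1)) - ∫ y, V y ∂M.P h (s i h, a i h))
    • (φ (s i h, a i h)).ofLp

/-- The Gram matrix of step `h` after `n` episodes. -/
abbrev dataGram (φ : S × A → EuclideanSpace ℝ (Fin m)) (s : ℕ → ℕ → S) (a : ℕ → ℕ → A)
    (h n : ℕ) : Matrix (Fin m) (Fin m) ℝ := gram (fun i => φ (s i h, a i h)) n

/-- Passage from a net point to a nearby value function: each residual moves by at most `2 e`, and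
each regressor has norm at most one for `Λ⁻¹`. -/
lemma sqrt_quad_transNoise_le (M : VMDP S A d) {φ : S × A → EuclideanSpace ℝ (Fin m)}
    (hφ : ∀ z, ‖φ z‖ ≤ 1) (s : ℕ → ℕ → S) (a : ℕ → ℕ → A) (h n : ℕ) {V V' : S → ℝ}
    (hV : Measurable V) (hV' : Measurable V') {C : ℝ} (hC : ∀ y, |V y| ≤ C)
    (hC' : ∀ y, |V' y| ≤ C) {e : ℝ} (he : ∀ y, |V y - V' y| ≤ e) :
    √(quad (dataGram φ s a h n)⁻¹ (transNoise M φ s a h n V)) ≤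
      √(quad (dataGram φ s a h n)⁻¹ (transNoise M φ s a h n V')) + n * (2 * e) := by
  have hP : ∀ z, IsProbabilityMeasure (M.P h z) := (M.markov h).isProbabilityMeasure
  have hG := gram_inv_posSemidef (fun i => φ (s i h, a i h)) n
  have hc : ∀ i, |(V (s i (h + 1)) - ∫ y, V y ∂M.P h (s i h, a i h))
      - (V' (s i (h + 1)) - ∫ y, V' y ∂M.P h (s i h, a i h))| ≤ 2 * e := fun i => by
    have h1 : ∫ y, V y ∂M.P h (s i h, a i h) - ∫ y, V' y ∂M.P h (s i h, a i h)
        = ∫ y, (V y - V' y) ∂M.P h (s i h, a i h) :=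
      (integral_sub (integrable_of_measurable_of_abs_le hV hC)
        (integrable_of_measurable_of_abs_le hV' hC')).symm
    have h2 := abs_integral_le_of_abs_le (μ := M.P h (s i h, a i h)) he
    rw [← h1] at h2
    have h3 := he (s i (h + 1))
    rw [abs_le] at *
    constructor <;> linarith
  have hsplit : transNoise M φ s a h n V = transNoise M φ s a h n V'
      + ∑ i ∈ Finset.range n, ((V (s i (h + 1)) - ∫ y, V y ∂M.P h (s i h, a i h))
      - (V' (s i (h + 1)) - ∫ y, V' y ∂M.P h (s i h, a i h))) • (φ (s i h, a i h)).ofLp := by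
    simp only [transNoise, ← Finset.sum_add_distrib, ← add_smul]
    exact Finset.sum_congr rfl fun i _ => by congr 1; ring
  rw [hsplit]
  refine (sqrt_quad_add_le hG _ _).trans (add_le_add le_rfl ?_)
  refine (sqrt_quad_sum_le hG _ _).trans ?_
  calc _ ≤ ∑ _i ∈ Finset.range n, 2 * e := by
        refine Finset.sum_le_sum fun i _ => ?_
        rw [sqrt_quad_smul]
        calc _ ≤ 2 * e * 1 := mul_le_mul (hc i)
              ((sqrt_quad_gram_le _ n _).trans (hφ _)) (Real.sqrt_nonneg _)
              ((abs_nonneg _).trans (hc i))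
          _ = 2 * e := mul_one _
    _ = n * (2 * e) := by simp

variable {Ω : Type*} {mΩ : MeasurableSpace Ω} {H K : ℕ} {M : VMDP S A d} {s₁ : S}
  {rule : (ℕ → ℕ → S) → (ℕ → ℕ → A) → ℕ → ℕ → S → A} {Pr : Measure Ω} [IsProbabilityMeasure Pr]
  {s : ℕ → ℕ → Ω → S} {a : ℕ → ℕ → Ω → A} {r : ℕ → ℕ → Ω → EuclideanSpace ℝ (Fin d)}
  {φ : S × A → EuclideanSpace ℝ (Fin m)} {β δ : ℝ}

lemma measurable_history_feature (hφ : Measurable φ) (h k : ℕ) :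
    Measurable[history H s a r k h] fun ω => φ (s k h ω, a k h ω) :=
  hφ.comp (measurable_history_pair k h)

/-- The number of cells of the grid for the regression parameters. -/
def netSize (m : ℕ) (L ε : ℝ) : ℕ := (⌊2 * L / ε⌋₊ + 1) ^ (m + m * m)

/-- Concentration of the transition noise, uniformly over the value functions that the algorithm
can produce. -/
lemma IsRun.exists_bad_transition (hrun : IsRun M s₁ H K rule Pr s a r) (hM : M.IsLinear H φ)
    (hm : 1 ≤ m) {Q : Param m → S → A → ℝ} (hQ : RegularQ β H Q) (G : Greedy Q)
    {h : ℕ} (hh : h < H) {L ε : ℝ} (hL : 1 ≤ L) (hε : 0 < ε)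
    (hεK : K * (m * ε + 2 * β * (m * √ε)) ≤ 1) (hδ : 0 < δ) (hδ1 : δ ≤ 1) :
    ∃ bad : Set Ω, Pr bad ≤ ((K + 1) * netSize m L ε : ℕ) * ENNReal.ofReal δ ∧
      ∀ ω ∉ bad, ∀ n ≤ K, ∀ p ∈ paramClass m L,
        √(quad (dataGram φ (fun i j => s i j ω) (fun i j => a i j ω) h n)⁻¹
          (transNoise M φ (fun i j => s i j ω) (fun i j => a i j ω) h n (clipValue H G p)))
        ≤ radius m H K δ + 2 := by
  have hone : ∀ i j, |(1 : Matrix (Fin m) (Fin m) ℝ) i j| ≤ L := fun i j => by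
    rw [Matrix.one_apply]
    split_ifs
    · simpa using hL
    · simpa using zero_le_one.trans hL
  obtain ⟨rep, hrep, hnet⟩ := exists_grid_net (T := Param m) (I := Fin m ⊕ Fin m × Fin m)
    (fun p => Sum.elim (fun i => p.1 i) fun ij => p.2 ij.1 ij.2) (D := paramClass m L)
    (L := L) ⟨(0, fun i j => (1 : Matrix (Fin m) (Fin m) ℝ) i j),
      Matrix.PosDef.one, fun i => by simpa using zero_le_one.trans hL, hone⟩ hε
    (fun p hp i => by
      rcases i with i | ij
      · exact hp.2.1 i
      · exact hp.2.2 ij.1 ij.2)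
  have hHpos : (0 : ℝ) < H := by exact_mod_cast (Nat.zero_le h).trans_lt hh
  -- For a fixed net point the test function is deterministic, so no dependence on the data
  -- obstructs the concentration bound. Clipping at `-H` supplies the noise bound `2 H`.
  have hnoise := fun c => hrun.isNoise_transition hh (f := fun _ _ => clipValue H G (rep c))
    (fun k => (measurable_clipValue hQ G (rep c)).comp
      (@measurable_snd Ω S (history H s a r k h) _)) (fun _ _ => abs_clipValue_le hQ G (rep c))
  have htail := fun c (n : ℕ) (hn : n ≤ K) =>
    measure_selfNorm_gt_le (x := fun k ω => φ (s k h ω, a k h ω)) (history_mono hh)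
      (fun n => hrun.history_le n h)
      (measurable_history_feature hM.measurable_feature h) (fun n ω => hM.norm_feature_le _)
      (by positivity) (hnoise c) hδ hn
  refine ⟨⋃ n : Fin (K + 1), ⋃ c, {ω | (2 * H : ℝ) ^ 2 * (m * Real.log (m + (n : ℕ)))
      + 4 * (2 * H : ℝ) ^ 2 * Real.log (1 / δ) < selfNorm (fun k => φ (s k h ω, a k h ω))
      (fun k (_ : Unit) => clipValue H G (rep c) (s k (h + 1) ω)
          - ∫ y, clipValue H G (rep c) y ∂M.P h (s k h ω, a k h ω)) n}, ?_, ?_⟩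
  rotate_left
  · intro ω hω n hn p hp
    simp only [Set.mem_iUnion, not_exists] at hω
    obtain ⟨c, hc⟩ := hnet p hp
    have h1 := hω ⟨n, Nat.lt_succ_of_le hn⟩ c
    rw [Set.mem_ofPred_eq, not_lt] at h1
    have h3 : selfNorm (fun k => φ (s k h ω, a k h ω)) (fun k (_ : Unit) =>
        clipValue H G (rep c) (s k (h + 1) ω)
          - ∫ y, clipValue H G (rep c) y ∂M.P h (s k h ω, a k h ω)) n
        = quad (dataGram φ (fun i j => s i j ω) (fun i j => a i j ω) h n)⁻¹
          (transNoise M φ (fun i j => s i j ω) (fun i j => a i j ω) h n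
            (clipValue H G (rep c))) := by
      simp [selfNorm, noiseSum, transNoise]
    have h4 : √(quad (dataGram φ (fun i j => s i j ω) (fun i j => a i j ω) h n)⁻¹
          (transNoise M φ (fun i j => s i j ω) (fun i j => a i j ω) h n
            (clipValue H G (rep c)))) ≤ radius m H K δ := by
      rw [Real.sqrt_le_left (radius_nonneg _ _ _ _), ← h3]
      exact h1.trans (le_sq_radius hm le_rfl hδ hδ1 hn)
    have h5 := sqrt_quad_transNoise_le M hM.norm_feature_le (fun i j => s i j ω)
      (fun i j => a i j ω) h n (measurable_clipValue hQ G p) (measurable_clipValue hQ G (rep c))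
      (abs_clipValue_le hQ G p) (abs_clipValue_le hQ G (rep c))
      (abs_clipValue_sub_le hQ G hp.1 (hrep c).1 (fun i => hc (Sum.inl i))
        (fun i j => hc (Sum.inr (i, j))))
    have h0 : 0 ≤ m * ε + 2 * β * (m * √ε) :=
      (abs_nonneg _).trans (abs_clipValue_sub_le hQ G hp.1 (hrep c).1 (fun i => hc (Sum.inl i))
        (fun i j => hc (Sum.inr (i, j))) s₁)
    have h6 : (n : ℝ) * (m * ε + 2 * β * (m * √ε)) ≤ 1 :=
      (mul_le_mul_of_nonneg_right (by exact_mod_cast hn) h0).trans hεK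
    linarith
  · refine (measure_iUnion_fintype_le _ _).trans ?_
    refine (Finset.sum_le_sum fun (n : Fin (K + 1)) _ => (measure_iUnion_fintype_le _ _).trans
      (Finset.sum_le_sum fun c _ => htail c n (Nat.lt_succ_iff.mp n.2))).trans_eq ?_
    simp only [Finset.sum_const, Finset.card_univ, nsmul_eq_mul, Fintype.card_fin,
      Fintype.card_fun, Fintype.card_sum, Fintype.card_prod, netSize]
    push_cast
    ring

lemma IsNoise.mono_bound {ι : Type*} [Fintype ι] {Pr : Measure Ω} {ℱ : ℕ → MeasurableSpace Ω}
    {η : ℕ → Ω → ι → ℝ} {B B' : ℝ} (hη : IsNoise Pr ℱ η B K) (hB : 0 ≤ B) (hBB' : B ≤ B') :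
    IsNoise Pr ℱ η B' K :=
  ⟨hη.meas, fun n ω => (hη.bound n ω).trans (pow_le_pow_left₀ hB hBB' 2), hη.mean⟩

/-- Concentration of the noise of the revealed returns. -/
lemma IsRun.exists_bad_return (hrun : IsRun M s₁ H K rule Pr s a r) (hM : M.IsLinear H φ)
    (hm : 1 ≤ m) {h : ℕ} (hh : h < H) (hδ : 0 < δ) (hδ1 : δ ≤ 1) :
    ∃ bad : Set Ω, Pr bad ≤ ENNReal.ofReal δ ∧ ∀ ω ∉ bad,
      selfNorm (fun i => φ (s i h ω, a i h ω)) (fun i j => truncReturn (r i h ω) j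
        - M.r h (s i h ω, a i h ω) j) K ≤ radius m H K δ ^ 2 := by
  have hH1 : (1 : ℝ) ≤ H := by exact_mod_cast (Nat.zero_le h).trans_lt hh
  refine ⟨_, measure_selfNorm_gt_le (x := fun k ω => φ (s k h ω, a k h ω)) (history_mono hh)
      (fun n => hrun.history_le n h)
      (measurable_history_feature hM.measurable_feature h) (fun n ω => hM.norm_feature_le _)
      (by positivity) ((hrun.isNoise_return hh).mono_bound (B' := 2 * H) (by norm_num)
        (by linarith)) hδ le_rfl, fun ω hω => ?_⟩
  exact (le_of_not_gt hω).trans (le_sq_radius hm le_rfl hδ hδ1 le_rfl)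

/-- With the constant regressor `1` in dimension one the Gram matrix is `n + 1`, so the
self-normalized theorem contains a scalar martingale bound. -/
lemma sq_sum_le_selfNorm (η : ℕ → ℝ) (n : ℕ) :
    (∑ i ∈ Finset.range n, η i) ^ 2 ≤
      (n + 1) * selfNorm (fun _ => EuclideanSpace.single (0 : Fin 1) (1 : ℝ))
        (fun i (_ : Unit) => η i) n := by
  have hgram : gram (fun _ => EuclideanSpace.single (0 : Fin 1) (1 : ℝ)) n
      = ((n : ℝ) + 1) • (1 : Matrix (Fin 1) (Fin 1) ℝ) := by
    ext i j
    rw [Subsingleton.elim i 0, Subsingleton.elim j 0]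
    simp only [gram, Matrix.add_apply, Matrix.sum_apply, Matrix.vecMulVec_apply]
    simp
  have hinv : (gram (fun _ => EuclideanSpace.single (0 : Fin 1) (1 : ℝ)) n)⁻¹
      = ((n : ℝ) + 1)⁻¹ • (1 : Matrix (Fin 1) (Fin 1) ℝ) := by
    rw [hgram]
    apply Matrix.inv_eq_right_inv
    rw [Matrix.smul_mul, Matrix.mul_smul, smul_smul, mul_inv_cancel₀ (by positivity), one_smul,
      mul_one]
  have : noiseSum (fun _ => EuclideanSpace.single (0 : Fin 1) (1 : ℝ))
      (fun i (_ : Unit) => η i) n () = fun _ => ∑ i ∈ Finset.range n, η i := by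
    ext i
    rw [Subsingleton.elim i 0]
    simp [noiseSum]
  simp only [selfNorm, Finset.univ_unique, Finset.sum_singleton, PUnit.default_eq_unit, this,
    hinv, quad]
  simp only [Matrix.smul_mulVec, Matrix.one_mulVec, dotProduct, Finset.univ_unique,
    Finset.sum_singleton, Pi.smul_apply, smul_eq_mul]
  refine le_of_eq ?_
  field_simp

/-- Concentration of the martingale of the exploration values. -/
lemma IsRun.exists_bad_martingale (hrun : IsRun M s₁ H K rule Pr s a r) (hM : M.IsLinear H φ)
    (hm : 1 ≤ m) {Q : Param m → S → A → ℝ} (hQ : RegularQ β H Q) (G : Greedy Q) {h : ℕ}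
    (hh : h < H) (hδ : 0 < δ) (hδ1 : δ ≤ 1) :
    ∃ bad : Set Ω, Pr bad ≤ ENNReal.ofReal δ ∧ ∀ ω ∉ bad, ∀ V : ℕ → S → ℝ,
      (∀ k y, V k y = max (lsviValue Q H φ (fun i j => s i j ω) (fun i j => a i j ω)
        (fun _ _ => 0) k (H - (h + 1)) y) (-H)) →
      |∑ k ∈ Finset.range K, (V k (s k (h + 1) ω) - ∫ y, V k y ∂M.P h (s k h ω, a k h ω))|
        ≤ radius m H K δ * √(K + 1) := by
  have hHpos : (0 : ℝ) < H := by exact_mod_cast (Nat.zero_le h).trans_lt hh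
  have hVm : ∀ k, Measurable[(history H s a r k h).prod inferInstance]
      (Function.uncurry fun ω y => max (lsviValue Q H φ (fun i j => s i j ω) (fun i j => a i j ω)
        (fun _ _ => 0) k (H - (h + 1)) y) (-H : ℝ)) := fun k =>
    (@measurable_lsviValue S A _ _ m β H φ Q Ω (history H s a r k h) s a (fun _ _ _ => 0) k
      hM.measurable_feature hQ G (fun i hi j hj => measurable_history_state (Or.inl ⟨hi, hj⟩))
      (fun i hi j hj => measurable_history_action (Or.inl ⟨hi, hj⟩))
      (fun _ _ _ _ => @measurable_const _ _ _ (history H s a r k h) _) _ (by omega)).max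
        (@measurable_const _ _ _ ((history H s a r k h).prod inferInstance) _)
  have hVb : ∀ (k : ℕ) (ω : Ω) (y : S), |max (lsviValue Q H φ (fun i j => s i j ω)
      (fun i j => a i j ω) (fun _ _ => 0) k (H - (h + 1)) y) (-H : ℝ)| ≤ H := fun k ω y => by
    refine abs_le.mpr ⟨le_max_right _ _, max_le ?_ (by linarith)⟩
    rcases Nat.lt_or_ge (h + 1) H with h1 | h1
    · rw [lsviValue_eq hQ G _ _ _ _ h1]
      exact hQ.le _ _ _
    · rw [Nat.sub_eq_zero_of_le h1]
      exact hHpos.le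
  refine ⟨_, measure_selfNorm_gt_le (x := fun _ _ => EuclideanSpace.single (0 : Fin 1) (1 : ℝ))
      (history_mono hh) (fun n => hrun.history_le n h)
      (fun n => @measurable_const _ _ _ (history H s a r n h) _) (fun n ω => by simp)
      (by positivity) (hrun.isNoise_transition hh hVm hVb) hδ le_rfl, fun ω hω V hV => ?_⟩
  have h1 := (le_of_not_gt hω).trans (le_sq_radius (m := m) le_rfl hm hδ hδ1 le_rfl)
  have h2 := sq_sum_le_selfNorm (fun k => V k (s k (h + 1) ω)
    - ∫ y, V k y ∂M.P h (s k h ω, a k h ω)) K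
  obtain rfl : V = fun k y => max (lsviValue Q H φ (fun i j => s i j ω) (fun i j => a i j ω)
        (fun _ _ => 0) k (H - (h + 1)) y) (-H) := by
    funext k y
    exact hV k y
  refine abs_le_of_sq_le_sq ?_ (mul_nonneg (radius_nonneg _ _ _ _) (Real.sqrt_nonneg _))
  rw [mul_pow, Real.sq_sqrt (by positivity), mul_comm]
  exact h2.trans (mul_le_mul_of_nonneg_left h1 (by positivity))

end Events

/-! ### Collecting the events. -/

section GoodData

variable {S A : Type*} [MeasurableSpace S] [MeasurableSpace A] {d m : ℕ}

/-- The properties of the recorded data that hold with high probability and suffice for the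
guarantee. -/
structure GoodData (M : VMDP S A d) (s₁ : S) (H K : ℕ) (φ : S × A → EuclideanSpace ℝ (Fin m))
    (β : ℝ) (Ge : Greedy (exploreQ β H φ)) (Gp : Greedy (planQ β H φ)) (ρ L : ℝ)
    (s : ℕ → ℕ → S) (a : ℕ → ℕ → A) (r : ℕ → ℕ → EuclideanSpace ℝ (Fin d)) : Prop where
  start : ∀ k < K, s k 0 = s₁
  action : ∀ k < K, ∀ h < H, a k h = exploreAct β H φ Ge s a k h (s k h)
  ball : ∀ k < K, ∀ h < H, ‖r k h‖ ≤ 1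
  explore : ∀ h < H, ∀ n ≤ K, ∀ p ∈ paramClass m L,
    √(quad (dataGram φ s a h n)⁻¹ (transNoise M φ s a h n (clipValue H Ge p))) ≤ ρ + 2
  plan : ∀ h < H, ∀ n ≤ K, ∀ p ∈ paramClass m L,
    √(quad (dataGram φ s a h n)⁻¹ (transNoise M φ s a h n (clipValue H Gp p))) ≤ ρ + 2
  returns : ∀ h < H, selfNorm (fun i => φ (s i h, a i h))
    (fun i j => truncReturn (r i h) j - M.r h (s i h, a i h) j) K ≤ ρ ^ 2
  martingale : ∀ h < H, ∀ V : ℕ → S → ℝ,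
    (∀ k y, V k y = max (lsviValue (exploreQ β H φ) H φ s a (fun _ _ => 0) k (H - (h + 1)) y)
      (-H)) →
    |∑ k ∈ Finset.range K, (V k (s k (h + 1)) - ∫ y, V k y ∂M.P h (s k h, a k h))|
      ≤ ρ * √(K + 1)

/-- The recorded data are good with high probability. -/
lemma IsRun.exists_goodData {Ω : Type*} {mΩ : MeasurableSpace Ω} {H K : ℕ} {M : VMDP S A d}
    {s₁ : S} {Pr : Measure Ω} [IsProbabilityMeasure Pr] {s : ℕ → ℕ → Ω → S}
    {a : ℕ → ℕ → Ω → A} {r : ℕ → ℕ → Ω → EuclideanSpace ℝ (Fin d)}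
    {φ : S × A → EuclideanSpace ℝ (Fin m)} {β δ : ℝ} {Ge : Greedy (exploreQ β H φ)}
    (Gp : Greedy (planQ β H φ)) (hrun : IsRun M s₁ H K (exploreAct β H φ Ge) Pr s a r)
    (hM : M.IsLinear H φ) (hm : 1 ≤ m) (hH : 1 ≤ H) (hβ : 0 ≤ β) {L ε : ℝ} (hL : 1 ≤ L)
    (hε : 0 < ε) (hεK : K * (m * ε + 2 * β * (m * √ε)) ≤ 1) (hδ : 0 < δ) (hδ1 : δ ≤ 1) :
    ∃ bad : Set Ω, Pr bad ≤ (4 * H * (K + 1) * netSize m L ε : ℕ) * ENNReal.ofReal δ ∧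
      ∀ ω ∉ bad, GoodData M s₁ H K φ β Ge Gp (radius m H K δ) L (fun i j => s i j ω)
        (fun i j => a i j ω) (fun i j => r i j ω) := by
  have hQe := regularQ_exploreQ hβ hH hM.measurable_feature hM.norm_feature_le
  have hQp := regularQ_planQ hβ H hM.measurable_feature hM.norm_feature_le
  choose! b₁ hb₁ hb₁' using fun (h : ℕ) (hh : h < H) =>
    hrun.exists_bad_transition hM hm hQe Ge hh hL hε hεK hδ hδ1
  choose! b₂ hb₂ hb₂' using fun (h : ℕ) (hh : h < H) =>
    hrun.exists_bad_transition hM hm hQp Gp hh hL hε hεK hδ hδ1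
  choose! b₃ hb₃ hb₃' using fun (h : ℕ) (hh : h < H) =>
    hrun.exists_bad_return hM hm hh hδ hδ1
  choose! b₄ hb₄ hb₄' using fun (h : ℕ) (hh : h < H) =>
    hrun.exists_bad_martingale hM hm hQe Ge hh hδ hδ1
  let sure : Ω → Prop := fun ω => (∀ k < K, s k 0 ω = s₁) ∧ (∀ k < K, ∀ h < H, a k h ω =
      exploreAct β H φ Ge (fun i j => s i j ω) (fun i j => a i j ω) k h (s k h ω)) ∧
      (∀ k < K, ∀ h < H, ‖r k h ω‖ ≤ 1)
  have hae : ∀ᵐ ω ∂Pr, sure ω := by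
    refine Filter.Eventually.and ?_ (Filter.Eventually.and ?_ ?_)
    · exact ae_all_iff.mpr fun k => ae_all_iff.mpr fun hk => hrun.start k hk
    · exact ae_all_iff.mpr fun k => ae_all_iff.mpr fun hk => ae_all_iff.mpr fun h =>
        ae_all_iff.mpr fun hh => hrun.action k hk h hh
    · exact ae_all_iff.mpr fun k => ae_all_iff.mpr fun hk => ae_all_iff.mpr fun h =>
        ae_all_iff.mpr fun hh => hrun.return_ball k hk h hh
  set N := netSize m L ε with hN
  have hN1 : 1 ≤ N := Nat.one_le_pow _ _ (Nat.succ_pos _)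
  refine ⟨{ω | ¬ sure ω} ∪ ⋃ h ∈ Finset.range H, (b₁ h ∪ b₂ h ∪ (b₃ h ∪ b₄ h)), ?_, ?_⟩
  rotate_left
  · intro ω hω
    simp only [Set.mem_union, Set.mem_iUnion, not_or, not_exists, Finset.mem_range] at hω
    obtain ⟨h0, h1⟩ := hω
    obtain ⟨hs, ha, hr⟩ := not_not.mp h0
    exact ⟨hs, ha, hr, fun h hh => hb₁' h hh ω (h1 h hh).1.1, fun h hh => hb₂' h hh ω (h1 h hh).1.2,
      fun h hh => hb₃' h hh ω (h1 h hh).2.1, fun h hh => hb₄' h hh ω (h1 h hh).2.2⟩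
  · refine (measure_union_le _ _).trans ?_
    rw [ae_iff.mp hae, zero_add]
    refine (measure_biUnion_finset_le _ _).trans ?_
    calc ∑ h ∈ Finset.range H, Pr (b₁ h ∪ b₂ h ∪ (b₃ h ∪ b₄ h))
        ≤ ∑ _h ∈ Finset.range H, ((4 * (K + 1) * N : ℕ) : ENNReal) * ENNReal.ofReal δ := by
          refine Finset.sum_le_sum fun h hh => ?_
          have hh := Finset.mem_range.mp hh
          refine (measure_union_le _ _).trans ((add_le_add (measure_union_le _ _)
            (measure_union_le _ _)).trans ((add_le_add (add_le_add (hb₁ h hh) (hb₂ h hh))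
            (add_le_add (hb₃ h hh) (hb₄ h hh))).trans ?_))
          have e : ∀ x : ENNReal, (((K + 1) * N : ℕ) : ENNReal) * x + (((K + 1) * N : ℕ) : ENNReal)
              * x + (x + x) = ((2 * ((K + 1) * N) + 2 : ℕ) : ENNReal) * x := fun x => by
            push_cast; ring
          rw [e]
          gcongr
          have : 1 ≤ (K + 1) * N := Nat.mul_pos (Nat.succ_pos _) hN1
          rw [mul_assoc]
          omega
      _ = _ := by
          rw [Finset.sum_const, Finset.card_range, nsmul_eq_mul]
          push_cast
          ring

end GoodData

/-! ### Prediction errors of the regressions. -/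

section Prediction

variable {S A : Type*} [MeasurableSpace S] [MeasurableSpace A] {d m H K n h : ℕ}
  {M : VMDP S A d} {φ : S × A → EuclideanSpace ℝ (Fin m)} {s : ℕ → ℕ → S} {a : ℕ → ℕ → A}
  {g : ℕ → ℕ → ℝ} {ρ L β : ℝ}

/-- The prediction error of the regression of step `h`, whose targets are the sum of `V` at the
next state and of noisy observations of a linear function of the features. -/
lemma abs_predict_sub_le (hM : M.IsLinear H φ) (hh : h < H) {V : S → ℝ} (hV : Measurable V)
    (hVb : ∀ y, |V y| ≤ H) {w : EuclideanSpace ℝ (Fin m)} {ρ ρ' C : ℝ}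
    (hρ : √(quad (dataGram φ s a h n)⁻¹ (transNoise M φ s a h n V)) ≤ ρ)
    (hρ' : √(quad (dataGram φ s a h n)⁻¹ (∑ i ∈ Finset.range n,
      (g i h - inner ℝ w (φ (s i h, a i h))) • (φ (s i h, a i h)).ofLp)) ≤ ρ')
    (hw : ‖w‖ ≤ C) (z : S × A) :
    |inner ℝ (fit φ s a g n h V).1 (φ z) - (inner ℝ w (φ z) + ∫ y, V y ∂M.P h z)| ≤
      √(quad (dataGram φ s a h n)⁻¹ (φ z).ofLp) * (ρ + ρ' + (H * √m + C)) := by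
  obtain ⟨v, hv, hPv⟩ := hM.exists_weight hh hV (Nat.cast_nonneg H) hVb
  have hG := gram_inv_posSemidef (fun i => φ (s i h, a i h)) n
  have h1 := abs_inner_ridge_sub_le (fun i => φ (s i h, a i h))
    (fun i => V (s i (h + 1)) + g i h) n (w + v) (φ z)
  rw [hPv z, ← inner_add_left]
  refine h1.trans (mul_le_mul_of_nonneg_left (add_le_add ?_ ?_) (Real.sqrt_nonneg _))
  · have h2 : ∑ i ∈ Finset.range n, (V (s i (h + 1)) + g i h
        - inner ℝ (w + v) (φ (s i h, a i h))) • (φ (s i h, a i h)).ofLp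
        = transNoise M φ s a h n V + ∑ i ∈ Finset.range n,
          (g i h - inner ℝ w (φ (s i h, a i h))) • (φ (s i h, a i h)).ofLp := by
      simp only [transNoise, ← Finset.sum_add_distrib, ← add_smul]
      refine Finset.sum_congr rfl fun i _ => ?_
      rw [hPv, inner_add_left]
      congr 1
      ring
    rw [h2]
    exact (sqrt_quad_add_le hG _ _).trans (add_le_add hρ hρ')
  · exact (norm_add_le _ _).trans (by linarith)

/-- At most `K` targets, each bounded by `H + 1 ≤ 2 H`, enter the regression; hence the size `2 H K`
of the class. -/
lemma fit_mem_paramClass {S A : Type*} {φ : S × A → EuclideanSpace ℝ (Fin m)}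
    {s : ℕ → ℕ → S} {a : ℕ → ℕ → A} (hφ : ∀ z, ‖φ z‖ ≤ 1) (hH : 1 ≤ H) (hL : 1 ≤ L)
    (hLK : 2 * H * K ≤ L) (hn : n ≤ K) {V : S → ℝ} (hVb : ∀ y, |V y| ≤ H)
    (hg : ∀ i < n, |g i h| ≤ 1) : fit φ s a g n h V ∈ paramClass m L := by
  refine ⟨fit_posDef s a g n h V, fun i => ?_, fun i j =>
    (abs_gram_inv_apply_le _ n i j).trans hL⟩
  have hH' : (1 : ℝ) ≤ H := by exact_mod_cast hH
  refine (abs_ridge_apply_le _ (fun i => hφ _) _ (C := 2 * H) n (fun i hi => ?_) i).trans ?_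
  · refine (abs_add_le _ _).trans ?_
    linarith [hVb (s i (h + 1)), hg i hi]
  · have : (n : ℝ) ≤ K := by exact_mod_cast hn
    nlinarith

/-- Value functions of least-squares value iteration that are bounded below obey the
concentration bound of the class. -/
lemma lsviValue_concentration {Q : Param m → S → A → ℝ} (hQ : RegularQ β H Q) (G : Greedy Q)
    (hφ : ∀ z, ‖φ z‖ ≤ 1) (hH : 1 ≤ H) (hL : 1 ≤ L) (hLK : 2 * H * K ≤ L) (hρ : 0 ≤ ρ)
    (hE : ∀ h < H, ∀ n ≤ K, ∀ p ∈ paramClass m L,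
      √(quad (dataGram φ s a h n)⁻¹ (transNoise M φ s a h n (clipValue H G p))) ≤ ρ)
    (hn : n ≤ K) (hg : ∀ i < n, ∀ h < H, |g i h| ≤ 1)
    (hlow : ∀ h', h < h' → h' ≤ H → ∀ x, -(H : ℝ) ≤ lsviValue Q H φ s a g n (H - h') x)
    (hh : h < H) :
    Measurable (lsviValue Q H φ s a g n (H - (h + 1))) ∧
      (∀ x, |lsviValue Q H φ s a g n (H - (h + 1)) x| ≤ H) ∧
      √(quad (dataGram φ s a h n)⁻¹
        (transNoise M φ s a h n (lsviValue Q H φ s a g n (H - (h + 1))))) ≤ ρ := by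
  have hH0 : (0 : ℝ) ≤ H := Nat.cast_nonneg H
  have hbound : ∀ h', h < h' → h' ≤ H → ∀ x, |lsviValue Q H φ s a g n (H - h') x| ≤ H := by
    intro h' h1 h2 x
    refine abs_le.mpr ⟨hlow h' h1 h2 x, ?_⟩
    rcases h2.lt_or_eq with h2 | rfl
    · rw [lsviValue_eq hQ G _ _ _ _ h2]
      exact hQ.le _ _ _
    · rw [Nat.sub_self]
      exact hH0
  rcases Nat.lt_or_ge (h + 1) H with h1 | h1
  · have hclip : lsviValue Q H φ s a g n (H - (h + 1))
        = clipValue H G (lsviParam Q H φ s a g n (h + 1)) := by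
      funext x
      rw [clipValue, ← lsviValue_eq hQ G _ _ _ _ h1, max_eq_left (hlow _ (by omega) h1.le x)]
    refine ⟨hclip ▸ measurable_clipValue hQ G _, hbound _ (by omega) h1.le, ?_⟩
    rw [hclip]
    exact hE h hh n hn _ (fit_mem_paramClass hφ hH hL hLK hn
      (hbound (h + 1 + 1) (by omega) h1) fun i hi => hg i hi _ h1)
  -- After the last step the value is zero and does not come from a regression, so it is treated
  -- apart from the class.
  · have h0 : lsviValue Q H φ s a g n (H - (h + 1)) = fun _ => 0 := by
      rw [Nat.sub_eq_zero_of_le h1]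
      rfl
    rw [h0]
    refine ⟨measurable_const, fun _ => by simp, ?_⟩
    simpa [transNoise, quad_zero] using hρ

end Prediction

/-! ### Deterministic analysis on good data: exploration. -/

section Analysis

variable {S A : Type*} [MeasurableSpace S] [MeasurableSpace A] {d m H K : ℕ}
  {M : VMDP S A d} {s₁ : S} {φ : S × A → EuclideanSpace ℝ (Fin m)} {β ρ L : ℝ}
  {Ge : Greedy (exploreQ β H φ)} {Gp : Greedy (planQ β H φ)}
  {s : ℕ → ℕ → S} {a : ℕ → ℕ → A} {r : ℕ → ℕ → EuclideanSpace ℝ (Fin d)}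

/-- The value function of step `h` in episode `k` of the exploration phase. -/
abbrev exploreValue (β : ℝ) (H : ℕ) (φ : S × A → EuclideanSpace ℝ (Fin m)) (s : ℕ → ℕ → S)
    (a : ℕ → ℕ → A) (k h : ℕ) : S → ℝ :=
  lsviValue (exploreQ β H φ) H φ s a (fun _ _ => 0) k (H - h)

/-- The value function of step `h` in the planning phase. -/
abbrev planValue (β : ℝ) (H : ℕ) (φ : S × A → EuclideanSpace ℝ (Fin m)) (K : ℕ)
    (s : ℕ → ℕ → S) (a : ℕ → ℕ → A) (r : ℕ → ℕ → EuclideanSpace ℝ (Fin d))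
    (θ : EuclideanSpace ℝ (Fin d)) (h : ℕ) : S → ℝ :=
  lsviValue (planQ β H φ) H φ s a (fun i j => inner ℝ θ (r i j)) K (H - h)

/-- The bonus of step `h` after `n` episodes. -/
abbrev dataBonus (β : ℝ) (φ : S × A → EuclideanSpace ℝ (Fin m)) (s : ℕ → ℕ → S)
    (a : ℕ → ℕ → A) (h n : ℕ) (z : S × A) : ℝ :=
  β * √(quad (dataGram φ s a h n)⁻¹ (φ z).ofLp)

/-- Standing assumptions on the parameters of the analysis. -/
structure Tuned (m H K : ℕ) (β ρ L : ℝ) : Prop where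
  one_le_horizon : 1 ≤ H
  radius_nonneg : 0 ≤ ρ
  one_le_bound : 1 ≤ L
  bound : 2 * H * K ≤ L
  bonus : 2 * ρ + 4 + 2 * (H * √m) ≤ β

lemma Tuned.bonus_nonneg (hT : Tuned m H K β ρ L) : 0 ≤ β := by
  have := hT.radius_nonneg
  have : 0 ≤ (H : ℝ) * √m := by positivity
  linarith [hT.bonus]

/-- No returns enter the targets, so half of the bonus covers the error; the other half survives as
a lower bound in `min_le_exploreQ`. The hypothesis `hlow` is needed because the algorithm does not
truncate from below; it is supplied by backward induction. -/
lemma explore_step (hT : Tuned m H K β ρ L) (hM : M.IsLinear H φ)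
    (hg : GoodData M s₁ H K φ β Ge Gp ρ L s a r)
    {k : ℕ} (hk : k ≤ K) {h : ℕ} (hh : h < H)
    (hlow : ∀ h', h < h' → h' ≤ H → ∀ x, -(H : ℝ) ≤ exploreValue β H φ s a k h' x) (z : S × A) :
    |inner ℝ (lsviParam (exploreQ β H φ) H φ s a (fun _ _ => 0) k h).1 (φ z)
      - ∫ y, exploreValue β H φ s a k (h + 1) y ∂M.P h z| ≤ dataBonus β φ s a h k z / 2 := by
  have hQ := regularQ_exploreQ hT.bonus_nonneg hT.one_le_horizon hM.measurable_feature
    hM.norm_feature_le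
  obtain ⟨h1, h2, h3⟩ := lsviValue_concentration (h := h) (g := fun _ _ => 0) hQ Ge
    hM.norm_feature_le hT.one_le_horizon hT.one_le_bound hT.bound
    (by linarith [hT.radius_nonneg] : 0 ≤ ρ + 2) hg.explore hk (by simp) hlow hh
  have h4 := abs_predict_sub_le (g := fun _ _ => 0) (n := k) hM hh h1 h2 (w := 0) (ρ' := 0)
    (C := 0) h3 (by simp [quad_zero]) (by simp) z
  rw [inner_zero_left, zero_add] at h4
  refine h4.trans ?_
  have h5 : ρ + 2 + 0 + (H * √m + 0) ≤ β / 2 := by linarith [hT.bonus]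
  calc _ ≤ √(quad (dataGram φ s a h k)⁻¹ (φ z).ofLp) * (β / 2) :=
        mul_le_mul_of_nonneg_left h5 (Real.sqrt_nonneg _)
    _ = _ := by rw [dataBonus]; ring

/-- The net half bonus per step is what lets the exploration value dominate the uncertainty of the
planning phase. -/
lemma min_le_exploreQ (hT : Tuned m H K β ρ L) (hM : M.IsLinear H φ)
    (hg : GoodData M s₁ H K φ β Ge Gp ρ L s a r)
    {k : ℕ} (hk : k ≤ K) {h : ℕ} (hh : h < H)
    (hlow : ∀ h', h < h' → h' ≤ H → ∀ x, -(H : ℝ) ≤ exploreValue β H φ s a k h' x)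
    (x : S) (b : A) :
    min (∫ y, exploreValue β H φ s a k (h + 1) y ∂M.P h (x, b)
      + dataBonus β φ s a h k (x, b) / 2) H ≤
    exploreQ β H φ (lsviParam (exploreQ β H φ) H φ s a (fun _ _ => 0) k h) x b := by
  refine min_le_min ?_ le_rfl
  have h1 := (abs_le.mp (explore_step hT hM hg hk hh hlow (x, b))).1
  have h2 : 0 ≤ truncBonus β H φ
      (lsviParam (exploreQ β H φ) H φ s a (fun _ _ => 0) k h) x b / H :=
    div_nonneg (le_min (bonus_nonneg hT.bonus_nonneg _ _) (Nat.cast_nonneg H)) (Nat.cast_nonneg H)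
  have h3 : bonus β (lsviParam (exploreQ β H φ) H φ s a (fun _ _ => 0) k h).2 (φ (x, b))
    = dataBonus β φ s a h k (x, b) := rfl
  linarith

lemma exploreValue_nonneg (hT : Tuned m H K β ρ L) (hM : M.IsLinear H φ)
    (hg : GoodData M s₁ H K φ β Ge Gp ρ L s a r)
    {k : ℕ} (hk : k ≤ K) {h : ℕ} (hh : h ≤ H) (x : S) :
    0 ≤ exploreValue β H φ s a k h x := by
  have hQ := regularQ_exploreQ hT.bonus_nonneg hT.one_le_horizon hM.measurable_feature
    hM.norm_feature_le
  have hH0 : (0 : ℝ) ≤ H := Nat.cast_nonneg H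
  obtain ⟨j, hj⟩ : ∃ j, H - h = j := ⟨_, rfl⟩
  induction j using Nat.strong_induction_on generalizing h x with
  | _ j ih =>
    rcases hh.lt_or_eq with hh | rfl
    · have hpos : ∀ h', h < h' → h' ≤ H → ∀ x, 0 ≤ exploreValue β H φ s a k h' x :=
        fun h' h1 h2 x => ih (H - h') (by omega) h2 x rfl
      have b := Ge.act (lsviParam (exploreQ β H φ) H φ s a (fun _ _ => 0) k h) x
      refine le_trans ?_ (le_lsviValue hQ Ge s a (fun _ _ => 0) k hh x b)
      refine le_trans (le_min ?_ hH0) (min_le_exploreQ hT hM hg hk hh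
        (fun h' h1 h2 x => by linarith [hpos h' h1 h2 x]) x b)
      have h1 : 0 ≤ dataBonus β φ s a h k (x, b) :=
        mul_nonneg hT.bonus_nonneg (Real.sqrt_nonneg _)
      have h2 : 0 ≤ ∫ y, exploreValue β H φ s a k (h + 1) y ∂M.P h (x, b) :=
        integral_nonneg fun y => hpos (h + 1) (by omega) hh y
      linarith
    · rw [exploreValue, Nat.sub_self]
      exact le_rfl

lemma explore_lower (hT : Tuned m H K β ρ L) (hM : M.IsLinear H φ)
    (hg : GoodData M s₁ H K φ β Ge Gp ρ L s a r)
    {k : ℕ} (hk : k ≤ K) {h : ℕ} (hh : h ≤ H) (x : S) :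
    -(H : ℝ) ≤ exploreValue β H φ s a k h x := by
  have : (0 : ℝ) ≤ H := Nat.cast_nonneg H
  linarith [exploreValue_nonneg hT hM hg hk hh x]

/-- One step of the regret decomposition of the exploration phase. -/
lemma exploreValue_le (hT : Tuned m H K β ρ L) (hM : M.IsLinear H φ)
    (hg : GoodData M s₁ H K φ β Ge Gp ρ L s a r)
    {k : ℕ} (hk : k < K) {h : ℕ} (hh : h < H) :
    exploreValue β H φ s a k h (s k h) ≤ 3 * dataBonus β φ s a h k (s k h, a k h)
      + ∫ y, exploreValue β H φ s a k (h + 1) y ∂M.P h (s k h, a k h) := by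
  have hQ := regularQ_exploreQ hT.bonus_nonneg hT.one_le_horizon hM.measurable_feature
    hM.norm_feature_le
  have hH1 : (1 : ℝ) ≤ H := by exact_mod_cast hT.one_le_horizon
  set p := lsviParam (exploreQ β H φ) H φ s a (fun _ _ => 0) k h with hp
  have h1 : exploreValue β H φ s a k h (s k h) = exploreQ β H φ p (s k h) (a k h) := by
    rw [exploreValue, lsviValue_eq hQ Ge _ _ _ _ hh, hg.action k hk h hh]
    rfl
  rw [h1]
  refine (min_le_left _ _).trans ?_
  have h2 := (abs_le.mp (explore_step hT hM hg hk.le hh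
    (fun h' _ h2 x => explore_lower hT hM hg hk.le h2 x) (s k h, a k h))).2
  have h3 : bonus β p.2 (φ (s k h, a k h)) = dataBonus β φ s a h k (s k h, a k h) := rfl
  have h4 : 0 ≤ dataBonus β φ s a h k (s k h, a k h) :=
    mul_nonneg hT.bonus_nonneg (Real.sqrt_nonneg _)
  have h5 : truncBonus β H φ p (s k h) (a k h) / H ≤ dataBonus β φ s a h k (s k h, a k h) := by
    rw [div_le_iff₀ (by linarith)]
    refine (min_le_left _ _).trans ?_
    rw [h3]
    exact le_mul_of_one_le_right h4 hH1
  linarith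

/-- Unroll `exploreValue_le` along each episode: three bonuses per step plus martingale differences.
The bonuses are summed over episodes by Cauchy-Schwarz and the elliptical potential, the differences
by the martingale event. -/
lemma sum_exploreValue_le (hT : Tuned m H K β ρ L) (hM : M.IsLinear H φ)
    (hg : GoodData M s₁ H K φ β Ge Gp ρ L s a r) :
    ∑ k ∈ Finset.range K, exploreValue β H φ s a k 0 s₁ ≤
      H * (3 * (β * √(K * (2 * (m * Real.log (m + K))))) + ρ * √(K + 1)) := by
  have hβ := hT.bonus_nonneg
  set ζ : ℕ → ℕ → ℝ := fun k h => exploreValue β H φ s a k (h + 1) (s k (h + 1))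
    - ∫ y, exploreValue β H φ s a k (h + 1) y ∂M.P h (s k h, a k h) with hζ
  have htele : ∀ k < K, ∀ n ≤ H, exploreValue β H φ s a k 0 s₁ ≤
      ∑ h ∈ Finset.range n, (3 * dataBonus β φ s a h k (s k h, a k h) - ζ k h)
        + exploreValue β H φ s a k n (s k n) := by
    intro k hk n hn
    induction n with
    | zero => simp [hg.start k hk]
    | succ n ih =>
      rw [Finset.sum_range_succ]
      have h1 := exploreValue_le hT hM hg hk (show n < H from hn)
      have h2 := ih (by omega)
      simp only [hζ] at h2 ⊢
      linarith
  have hbonus : ∀ h, ∑ k ∈ Finset.range K, dataBonus β φ s a h k (s k h, a k h)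
      ≤ β * √(K * (2 * (m * Real.log (m + K)))) := by
    intro h
    rw [← Finset.mul_sum]
    refine mul_le_mul_of_nonneg_left ?_ hβ
    have h1 := Real.sum_sqrt_mul_sqrt_le (Finset.range K) (f := fun _ => (1 : ℝ))
      (g := fun k => quad (dataGram φ s a h k)⁻¹ (φ (s k h, a k h)).ofLp)
      (fun _ => zero_le_one) (fun k => quad_nonneg (gram_inv_posSemidef _ k) _)
    simp only [Real.sqrt_one, one_mul, Finset.sum_const, Finset.card_range, nsmul_eq_mul,
      mul_one] at h1
    refine h1.trans ?_
    rw [← Real.sqrt_mul (Nat.cast_nonneg K)]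
    refine Real.sqrt_le_sqrt (mul_le_mul_of_nonneg_left ?_ (Nat.cast_nonneg K))
    exact sum_lever_le (fun k => φ (s k h, a k h)) (fun k => hM.norm_feature_le _) K
  have hmart : ∀ h < H, -(ρ * √(K + 1)) ≤ ∑ k ∈ Finset.range K, ζ k h := by
    intro h hh
    have h1 := (abs_le.mp (hg.martingale h hh _ fun k y => rfl)).1
    refine h1.trans_eq (Finset.sum_congr rfl fun k hk => ?_)
    have hk := (Finset.mem_range.mp hk).le
    -- The clipping in the martingale event is inactive, since the exploration values are
    -- nonnegative.
    have h2 : ∀ y, max (lsviValue (exploreQ β H φ) H φ s a (fun _ _ => 0) k (H - (h + 1)) y)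
        (-H : ℝ) = exploreValue β H φ s a k (h + 1) y := fun y =>
      max_eq_left (explore_lower hT hM hg hk hh y)
    simp only [h2, hζ]
  calc ∑ k ∈ Finset.range K, exploreValue β H φ s a k 0 s₁
      ≤ ∑ k ∈ Finset.range K, ∑ h ∈ Finset.range H,
          (3 * dataBonus β φ s a h k (s k h, a k h) - ζ k h) := by
        refine Finset.sum_le_sum fun k hk => ?_
        have h1 := htele k (Finset.mem_range.mp hk) H le_rfl
        have h2 : exploreValue β H φ s a k H (s k H) = 0 := by
          rw [exploreValue, Nat.sub_self]
          rfl
        rwa [h2, add_zero] at h1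
    _ = ∑ h ∈ Finset.range H, (3 * ∑ k ∈ Finset.range K, dataBonus β φ s a h k (s k h, a k h)
          - ∑ k ∈ Finset.range K, ζ k h) := by
        rw [Finset.sum_comm]
        simp only [Finset.sum_sub_distrib, Finset.mul_sum]
    _ ≤ ∑ _h ∈ Finset.range H, (3 * (β * √(K * (2 * (m * Real.log (m + K)))))
          + ρ * √(K + 1)) := by
        refine Finset.sum_le_sum fun h hh => ?_
        linarith [hbonus h, hmart h (Finset.mem_range.mp hh)]
    _ = _ := by rw [Finset.sum_const, Finset.card_range, nsmul_eq_mul]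

/-! ### Deterministic analysis on good data: planning and comparison with exploration. -/

variable {θ : EuclideanSpace ℝ (Fin d)}

/-- Here the full bonus is used: transition noise, return noise and the norms of both weights all
count. -/
lemma plan_step (hT : Tuned m H K β ρ L) (hM : M.IsLinear H φ)
    (hg : GoodData M s₁ H K φ β Ge Gp ρ L s a r) (hθ : ‖θ‖ ≤ 1)
    {h : ℕ} (hh : h < H)
    (hlow : ∀ h', h < h' → h' ≤ H → ∀ x, -(H : ℝ) ≤ planValue β H φ K s a r θ h' x)
    (z : S × A) :
    Measurable (planValue β H φ K s a r θ (h + 1)) ∧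
    (∀ y, |planValue β H φ K s a r θ (h + 1) y| ≤ H) ∧
    |inner ℝ (lsviParam (planQ β H φ) H φ s a (fun i j => inner ℝ θ (r i j)) K h).1 (φ z)
      - (inner ℝ θ (M.r h z) + ∫ y, planValue β H φ K s a r θ (h + 1) y ∂M.P h z)|
      ≤ dataBonus β φ s a h K z := by
  have hQ := regularQ_planQ hT.bonus_nonneg H hM.measurable_feature hM.norm_feature_le
  have hH1 : (1 : ℝ) ≤ H := by exact_mod_cast hT.one_le_horizon
  obtain ⟨h1, h2, h3⟩ := lsviValue_concentration (h := h) hQ Gp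
    hM.norm_feature_le hT.one_le_horizon hT.one_le_bound hT.bound
    (by linarith [hT.radius_nonneg] : 0 ≤ ρ + 2) hg.plan le_rfl
    (g := fun i j => inner ℝ θ (r i j))
    (fun i hi j hj => (abs_real_inner_le_norm _ _).trans
      (mul_le_one₀ hθ (norm_nonneg _) (hg.ball i hi j hj))) hlow hh
  obtain ⟨w, hw, hwr⟩ := hM.exists_return_weight hh hθ
  have hnoise : √(quad (dataGram φ s a h K)⁻¹ (∑ i ∈ Finset.range K,
      (inner ℝ θ (r i h) - inner ℝ w (φ (s i h, a i h))) • (φ (s i h, a i h)).ofLp)) ≤ ρ := by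
    -- The scalar noise for `θ` is the `θ`-combination of the coordinate noise sums, so the vector
    -- bound and `‖θ‖ ≤ 1` cover all `θ` on one event.
    have h4 : ∑ i ∈ Finset.range K,
        ((inner ℝ θ (r i h) : ℝ) - inner ℝ w (φ (s i h, a i h))) • (φ (s i h, a i h)).ofLp
        = ∑ j, θ j • noiseSum (fun i => φ (s i h, a i h))
          (fun i j => truncReturn (r i h) j - M.r h (s i h, a i h) j) K j := by
      simp only [noiseSum, Finset.smul_sum]
      rw [Finset.sum_comm]
      refine Finset.sum_congr rfl fun i hi => ?_
      rw [← hwr, truncReturn, if_pos (hg.ball i (Finset.mem_range.mp hi) h hh),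
        ← inner_sub_right, inner_eq_dotProduct, dotProduct, Finset.sum_smul]
      exact Finset.sum_congr rfl fun j _ => by rw [smul_smul]; rfl
    rw [h4]
    refine (sqrt_quad_sum_smul_le (gram_inv_posSemidef _ K) _ _).trans ?_
    have h5 : √(∑ j, θ j ^ 2) ≤ 1 := by
      rw [← EuclideanSpace.real_norm_sq_eq, Real.sqrt_sq (norm_nonneg _)]
      exact hθ
    have h6 : √(∑ j, quad (dataGram φ s a h K)⁻¹ (noiseSum (fun i => φ (s i h, a i h))
        (fun i j => truncReturn (r i h) j - M.r h (s i h, a i h) j) K j)) ≤ ρ := by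
      rw [Real.sqrt_le_left hT.radius_nonneg]
      exact hg.returns h hh
    exact (mul_le_of_le_one_left (Real.sqrt_nonneg _) h5).trans h6
  have h7 := abs_predict_sub_le (n := K) hM hh h1 h2 h3
    (g := fun i j => inner ℝ θ (r i j)) hnoise hw z
  rw [hwr]
  refine ⟨h1, h2, h7.trans ?_⟩
  have h8 : ρ + 2 + ρ + (H * √m + √m) ≤ β := by
    have : √m ≤ H * √m := le_mul_of_one_le_left (Real.sqrt_nonneg _) hH1
    linarith [hT.bonus]
  calc _ ≤ √(quad (dataGram φ s a h K)⁻¹ (φ z).ofLp) * β :=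
        mul_le_mul_of_nonneg_left h8 (Real.sqrt_nonneg _)
    _ = _ := mul_comm _ _

/-- Optimism of the planning phase. -/
lemma valueN_le_planValue (hT : Tuned m H K β ρ L) (hM : M.IsLinear H φ)
    (hg : GoodData M s₁ H K φ β Ge Gp ρ L s a r) (hθ : ‖θ‖ ≤ 1)
    {h : ℕ} (hh : h ≤ H) (π : Policy S A) (x : S) :
    M.valueN θ π (H - h) h x ≤ planValue β H φ K s a r θ h x := by
  have hQ := regularQ_planQ hT.bonus_nonneg H hM.measurable_feature hM.norm_feature_le
  obtain ⟨j, hj⟩ : ∃ j, H - h = j := ⟨_, rfl⟩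
  induction j using Nat.strong_induction_on generalizing h x with
  | _ j ih =>
    rcases hh.lt_or_eq with hh | rfl
    -- Optimism at the later steps itself supplies the lower bound, because true values are at least
    -- `-H`.
    · have hlow : ∀ h', h < h' → h' ≤ H → ∀ x, -(H : ℝ) ≤ planValue β H φ K s a r θ h' x := by
        intro h' h1 h2 x
        have h3 := ih (H - h') (by omega) h2 x rfl
        have h4 := (abs_le.mp (M.abs_valueN_le π hθ (H - h') h' x)).1
        have h5 : ((H - h' : ℕ) : ℝ) ≤ H := by exact_mod_cast Nat.sub_le H h'
        linarith
      have hP : ∀ z, IsProbabilityMeasure (M.P h z) := (M.markov h).isProbabilityMeasure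
      have hπ := (π.markov h).isProbabilityMeasure x
      have e : H - h = (H - (h + 1)) + 1 := by omega
      have hb : ∀ b, inner ℝ θ (M.r h (x, b))
          + ∫ s', M.valueN θ π (H - (h + 1)) (h + 1) s' ∂M.P h (x, b)
          ≤ planValue β H φ K s a r θ h x := by
        intro b
        obtain ⟨h1, h2, h3⟩ := plan_step hT hM hg hθ hh hlow (x, b)
        have hvb := M.abs_valueN_le π hθ (H - (h + 1)) (h + 1)
        have h4 : ∫ s', M.valueN θ π (H - (h + 1)) (h + 1) s' ∂M.P h (x, b)
            ≤ ∫ y, planValue β H φ K s a r θ (h + 1) y ∂M.P h (x, b) :=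
          integral_mono (integrable_of_measurable_of_abs_le (M.measurable_valueN π _ _) hvb)
            (integrable_of_measurable_of_abs_le h1 h2)
            fun y => ih (H - (h + 1)) (by omega) hh y rfl
        have h5 := (abs_le.mp (abs_integral_le_of_abs_le (μ := M.P h (x, b)) hvb)).2
        have h6 := (abs_le.mp (M.abs_inner_r_le hθ h (x, b))).2
        have h7 : ((H - (h + 1) : ℕ) : ℝ) + 1 ≤ H := by
          have : H - (h + 1) + 1 ≤ H := by omega
          exact_mod_cast this
        refine le_trans ?_ (le_lsviValue hQ Gp s a _ K hh x b)
        -- Truncation at `H` does not hurt optimism: one return plus the value of the remaining `H -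
        -- (h + 1)` steps is at most `H`.
        refine le_min ?_ (by linarith)
        have h8 : bonus β (lsviParam (planQ β H φ) H φ s a (fun i j => inner ℝ θ (r i j)) K h).2
          (φ (x, b)) = dataBonus β φ s a h K (x, b) := rfl
        linarith [(abs_le.mp h3).1]
      rw [e, M.valueN_succ π hθ]
      have hvb := M.abs_valueN_le π hθ (H - (h + 1)) (h + 1)
      have hPk := M.markov h
      have hm : Measurable fun b => inner ℝ θ (M.r h (x, b))
          + ∫ s', M.valueN θ π (H - (h + 1)) (h + 1) s' ∂M.P h (x, b) :=
        (((M.measurable_inner_r h).add ((M.measurable_valueN π _ _).stronglyMeasurable.integral_kernel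
          (κ := M.P h)).measurable)).comp measurable_prodMk_left
      have hfint : Integrable (fun b => inner ℝ θ (M.r h (x, b))
          + ∫ s', M.valueN θ π (H - (h + 1)) (h + 1) s' ∂M.P h (x, b)) (π.act h x) :=
        integrable_of_measurable_of_abs_le hm fun b => (abs_add_le _ _).trans
          (add_le_add (M.abs_inner_r_le hθ h (x, b)) (abs_integral_le_of_abs_le hvb))
      calc _ ≤ ∫ _b, planValue β H φ K s a r θ h x ∂π.act h x :=
            integral_mono hfint (integrable_const _) hb
        _ = _ := by simp
    · rw [planValue, Nat.sub_self, M.valueN_zero]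
      exact le_rfl

/-- The suboptimality of the planned policy is dominated by the exploration values. -/
lemma planValue_sub_valueN_le (hT : Tuned m H K β ρ L) (hM : M.IsLinear H φ)
    (hg : GoodData M s₁ H K φ β Ge Gp ρ L s a r) (hθ : ‖θ‖ ≤ 1)
    {k : ℕ} (hk : k ≤ K) {h : ℕ} (hh : h ≤ H) (x : S) :
    planValue β H φ K s a r θ h x
      - M.valueN θ (planPolicy β H φ Gp K s a r θ) (H - h) h x
      ≤ 4 * exploreValue β H φ s a k h x := by
  have hQ := regularQ_planQ hT.bonus_nonneg H hM.measurable_feature hM.norm_feature_le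
  have hQe := regularQ_exploreQ hT.bonus_nonneg hT.one_le_horizon hM.measurable_feature
    hM.norm_feature_le
  set π := planPolicy β H φ Gp K s a r θ with hπ
  have hlow : ∀ h' ≤ H, ∀ x, -(H : ℝ) ≤ planValue β H φ K s a r θ h' x := by
    intro h' h2 x
    have h3 := valueN_le_planValue hT hM hg hθ h2 π x
    have h4 := (abs_le.mp (M.abs_valueN_le π hθ (H - h') h' x)).1
    have h5 : ((H - h' : ℕ) : ℝ) ≤ H := by exact_mod_cast Nat.sub_le H h'
    linarith
  obtain ⟨j, hj⟩ : ∃ j, H - h = j := ⟨_, rfl⟩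
  induction j using Nat.strong_induction_on generalizing h x with
  | _ j ih =>
    rcases hh.lt_or_eq with hh | rfl
    · have hP : ∀ z, IsProbabilityMeasure (M.P h z) := (M.markov h).isProbabilityMeasure
      have hPk := M.markov h
      have e : H - h = (H - (h + 1)) + 1 := by omega
      set p := lsviParam (planQ β H φ) H φ s a (fun i j => inner ℝ θ (r i j)) K h with hp
      set b := Gp.act p x with hb
      have hvb := M.abs_valueN_le π hθ (H - (h + 1)) (h + 1)
      have hval : M.valueN θ π (H - h) h x = inner ℝ θ (M.r h (x, b))
          + ∫ s', M.valueN θ π (H - (h + 1)) (h + 1) s' ∂M.P h (x, b) := by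
        rw [e, M.valueN_succ π hθ]
        have hact : π.act h x = Measure.dirac b := 
          Kernel.deterministic_apply (Gp.measurable_act.comp
            (measurable_const.prodMk measurable_id)) x
        rw [hact]
        refine integral_dirac' _ _ ?_
        exact ((((M.measurable_inner_r h).add
          ((M.measurable_valueN π _ _).stronglyMeasurable.integral_kernel
            (κ := M.P h)).measurable)).comp measurable_prodMk_left).stronglyMeasurable
      obtain ⟨h1, h2, h3⟩ := plan_step hT hM hg hθ hh
        (fun h' _ h2 x => hlow h' h2 x) (x, b)
      have hplan : planValue β H φ K s a r θ h x = planQ β H φ p x b :=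
        lsviValue_eq hQ Gp _ _ _ _ hh x
      have hle1 : planQ β H φ p x b ≤ inner ℝ p.1 (φ (x, b)) + dataBonus β φ s a h K (x, b) :=
        min_le_left _ _
      have hle2 : planQ β H φ p x b ≤ H := min_le_right _ _
      have hmono : dataBonus β φ s a h K (x, b) ≤ dataBonus β φ s a h k (x, b) :=
        mul_le_mul_of_nonneg_left (Real.sqrt_le_sqrt (quad_gram_antitone _ _ hk)) hT.bonus_nonneg
      obtain ⟨c1, c2, -⟩ := lsviValue_concentration (h := h) (g := fun _ _ => 0) (M := M) hQe Ge
        hM.norm_feature_le hT.one_le_horizon hT.one_le_bound hT.bound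
        (by linarith [hT.radius_nonneg] : 0 ≤ ρ + 2) hg.explore hk (by simp)
        (fun h' _ h2 x => explore_lower hT hM hg hk h2 x) hh
      have hI : ∫ y, planValue β H φ K s a r θ (h + 1) y ∂M.P h (x, b)
          - ∫ s', M.valueN θ π (H - (h + 1)) (h + 1) s' ∂M.P h (x, b)
          ≤ 4 * ∫ y, exploreValue β H φ s a k (h + 1) y ∂M.P h (x, b) := by
        have i1 := integrable_of_measurable_of_abs_le (Pr := M.P h (x, b)) h1 h2
        have i2 := integrable_of_measurable_of_abs_le (Pr := M.P h (x, b))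
          (M.measurable_valueN π _ _) hvb
        have i3 := integrable_of_measurable_of_abs_le (Pr := M.P h (x, b)) c1 c2
        rw [← integral_sub i1 i2, ← integral_const_mul]
        exact integral_mono (i1.sub i2) (i3.const_mul 4)
          fun y => ih (H - (h + 1)) (by omega) hh y rfl
      have hexp := (min_le_exploreQ hT hM hg hk hh
        (fun h' _ h2 x => explore_lower hT hM hg hk h2 x) x b).trans
        (le_lsviValue hQe Ge s a (fun _ _ => 0) k hh x b)
      have hv0 := (abs_le.mp (M.abs_valueN_le π hθ (H - h) h x)).1
      have hHh : ((H - h : ℕ) : ℝ) ≤ H := by exact_mod_cast Nat.sub_le H h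
      have h3' := (abs_le.mp h3).2
      have hH0 : (0 : ℝ) ≤ H := Nat.cast_nonneg H
      -- Without truncation, four half bonuses pay for the two bonuses lost by planning and the
      -- induction hypothesis covers the rest. With truncation, the right side is at least `4 H`
      -- while the gap is at most `2 H`.
      rcases min_choice (∫ y, exploreValue β H φ s a k (h + 1) y ∂M.P h (x, b)
        + dataBonus β φ s a h k (x, b) / 2) (H : ℝ) with hc | hc
      · rw [hc] at hexp
        rw [hplan, hval]
        linarith
      · rw [hc] at hexp
        rw [hplan]
        linarith
    · rw [planValue, exploreValue, Nat.sub_self, M.valueN_zero]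
      simp [lsviValue]

/-- The deterministic part of the guarantee. -/
lemma optValue_sub_value_le (hT : Tuned m H K β ρ L) (hM : M.IsLinear H φ)
    (hg : GoodData M s₁ H K φ β Ge Gp ρ L s a r) (hθ : ‖θ‖ ≤ 1) :
    K * (M.optValue H θ 0 s₁ - M.value H θ (planPolicy β H φ Gp K s a r θ) 0 s₁) ≤
      4 * (H * (3 * (β * √(K * (2 * (m * Real.log (m + K))))) + ρ * √(K + 1))) := by
  have hne : Nonempty (Policy S A) := ⟨planPolicy β H φ Gp K s a r θ⟩
  have h1 : M.optValue H θ 0 s₁ ≤ planValue β H φ K s a r θ 0 s₁ :=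
    ciSup_le fun π => valueN_le_planValue hT hM hg hθ (Nat.zero_le H) π s₁
  -- The left side does not depend on `k`, so it may be summed over all exploration episodes.
  have h2 : ∀ k ∈ Finset.range K, M.optValue H θ 0 s₁
      - M.value H θ (planPolicy β H φ Gp K s a r θ) 0 s₁ ≤ 4 * exploreValue β H φ s a k 0 s₁ := by
    intro k hk
    have h3 := planValue_sub_valueN_le hT hM hg hθ (Finset.mem_range.mp hk).le (Nat.zero_le H) s₁
    rw [M.value_eq_valueN]
    linarith
  have h4 := Finset.sum_le_sum h2
  rw [Finset.sum_const, Finset.card_range, nsmul_eq_mul, ← Finset.mul_sum] at h4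
  linarith [sum_exploreValue_le hT hM hg]

end Analysis

/-! ### Choice of grid, failure probability and bonus constant. -/

section Tuning

/-- The resolution of the grid of regression parameters. -/
def gridStep (m K : ℕ) (β : ℝ) : ℝ := (1 / (K * m * (1 + 2 * β))) ^ 2

/-- The failure probability of each of the events in the union bound. -/
def eventProb (m H K : ℕ) (β δ : ℝ) : ℝ :=
  δ / (4 * H * (K + 1) * netSize m (2 * H * K) (gridStep m K β) : ℕ)

/-- The step is `t²` with `t = 1 / (K m (1 + 2 β))`, so that `√` returns `t` and the discretization
error stays at most one over `K` episodes. -/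
lemma gridStep_spec {m K : ℕ} (hm : 1 ≤ m) (hK : 1 ≤ K) {β : ℝ} (hβ : 0 ≤ β) :
    0 < gridStep m K β ∧
      K * (m * gridStep m K β + 2 * β * (m * √(gridStep m K β))) ≤ 1 := by
  have hm' : (1 : ℝ) ≤ m := by exact_mod_cast hm
  have hK' : (1 : ℝ) ≤ K := by exact_mod_cast hK
  have hmK : (1 : ℝ) ≤ K * m := by nlinarith
  have hD : 1 ≤ (K : ℝ) * m * (1 + 2 * β) := by nlinarith
  have ht : 0 < 1 / ((K : ℝ) * m * (1 + 2 * β)) := by positivity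
  set t := 1 / ((K : ℝ) * m * (1 + 2 * β)) with htdef
  have ht1 : t ≤ 1 := by rw [htdef, div_le_one (by positivity)]; exact hD
  have h1 : (K : ℝ) * m * (1 + 2 * β) * t = 1 := mul_one_div_cancel (by positivity)
  refine ⟨by rw [gridStep]; positivity, ?_⟩
  rw [gridStep, ← htdef, Real.sqrt_sq ht.le]
  calc (K : ℝ) * (m * t ^ 2 + 2 * β * (m * t)) = K * m * (t * t + 2 * β * t) := by ring
    _ ≤ K * m * (1 * t + 2 * β * t) := by gcongr
    _ = K * m * (1 + 2 * β) * t := by ring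
    _ = 1 := h1

variable {m d H K : ℕ} {δ : ℝ}

/-- Elementary facts on the argument `X = d_lin d K H / δ` of the logarithm in the bonus. -/
lemma logArg_facts (hm : 2 ≤ m) (hd : 1 ≤ d) (hH : 1 ≤ H) (hK : 2 ≤ K) (hδ : 0 < δ)
    (hδ1 : δ ≤ 1) {X : ℝ} (hX : X = m * d * K * H / δ) :
    4 ≤ X ∧ (m : ℝ) * K ≤ X ∧ (m : ℝ) * H ≤ X ∧ (H : ℝ) * K * m ≤ X ∧ 2 * (H * K / δ) ≤ X ∧
      1 ≤ Real.log X := by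
  have hm' : (2 : ℝ) ≤ m := by exact_mod_cast hm
  have hd' : (1 : ℝ) ≤ d := by exact_mod_cast hd
  have hH' : (1 : ℝ) ≤ H := by exact_mod_cast hH
  have hK' : (2 : ℝ) ≤ K := by exact_mod_cast hK
  have e : X = m * K * H * (d / δ) := by rw [hX]; ring
  have hdδ : 1 ≤ (d : ℝ) / δ := by rw [le_div_iff₀ hδ]; linarith
  have hmKH : (m : ℝ) * K * H ≤ X := by rw [e]; exact le_mul_of_one_le_right (by positivity) hdδ
  have hmK : 4 ≤ (m : ℝ) * K := by nlinarith
  have h1 : (m : ℝ) * K ≤ m * K * H := le_mul_of_one_le_right (by positivity) hH'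
  have h2 : (m : ℝ) * H ≤ m * K * H := by
    have : (m : ℝ) * K * H = m * H * K := by ring
    rw [this]
    exact le_mul_of_one_le_right (by positivity) (by linarith)
  have h4 : 4 ≤ X := by linarith
  refine ⟨h4, by linarith, by linarith, by linarith, ?_, ?_⟩
  · have e2 : X = m * d * (H * K / δ) := by rw [hX]; ring
    rw [e2]
    have : 0 ≤ H * K / δ := by positivity
    have : (2 : ℝ) ≤ m * d := by nlinarith
    gcongr
  · rw [Real.le_log_iff_exp_le (by linarith)]
    linarith [Real.exp_one_lt_d9]

/-- The choice of `β` is circular: it must exceed the radius, which depends on the grid, which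
depends on `β`. That dependence is logarithmic, so a bound polynomial in `X` is enough to close the
loop. -/
lemma bonusCoeff_facts (hm : 2 ≤ m) (hd : 1 ≤ d) (hH : 1 ≤ H) (hK : 2 ≤ K) (hδ : 0 < δ)
    (hδ1 : δ ≤ 1) {X : ℝ} (hX : X = m * d * K * H / δ) :
    0 ≤ bonusCoeff 100 m d H K δ ∧ 1 + 2 * bonusCoeff 100 m d H K δ ≤ 201 * X ^ 2 := by
  obtain ⟨hX4, -, hX2, -, -, hι⟩ := logArg_facts hm hd hH hK hδ hδ1 hX
  have hβe : bonusCoeff 100 m d H K δ = 100 * (m * H * √(Real.log X)) := by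
    rw [bonusCoeff, hX]; ring
  have hιX : Real.log X ≤ X := (Real.log_le_sub_one_of_pos (by linarith)).trans (by linarith)
  have hsι : √(Real.log X) ≤ X := by
    refine le_trans ?_ hιX
    rw [Real.sqrt_le_left (by linarith)]
    nlinarith
  rw [hβe]
  refine ⟨by positivity, ?_⟩
  have h1 : m * H * √(Real.log X) ≤ X * X :=
    mul_le_mul hX2 hsι (Real.sqrt_nonneg _) (by linarith)
  nlinarith

lemma floor_gridStep_le {X β : ℝ} (hX4 : 4 ≤ X) (hKX : (K : ℝ) ≤ X) (hmK : (m : ℝ) * K ≤ X)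
    (hHKm : (H : ℝ) * K * m ≤ X) (hβ0 : 0 ≤ β) (hβX : 1 + 2 * β ≤ 201 * X ^ 2) :
    ((⌊2 * (2 * H * K : ℝ) / gridStep m K β⌋₊ + 1 : ℕ) : ℝ) ≤ X ^ 16 := by
  have h0 : 0 ≤ 2 * (2 * H * K : ℝ) / gridStep m K β :=
    div_nonneg (by positivity) (sq_nonneg _)
  push_cast
  refine (add_le_add (Nat.floor_le h0) le_rfl).trans ?_
  have e : 2 * (2 * H * K : ℝ) / gridStep m K β
      = 4 * ((H * K * m) * (m * K) * K) * (1 + 2 * β) ^ 2 := by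
    rw [gridStep, one_div, inv_pow, div_inv_eq_mul]
    ring
  rw [e]
  have h1 : (H * K * m : ℝ) * (m * K) * K ≤ X * X * X := by gcongr
  have h2 : (1 + 2 * β) ^ 2 ≤ (201 * X ^ 2) ^ 2 := by gcongr
  have h3 : 4 * ((H * K * m : ℝ) * (m * K) * K) * (1 + 2 * β) ^ 2
      ≤ 4 * (X * X * X) * (201 * X ^ 2) ^ 2 := by gcongr
  have h4 : 4 * (X * X * X) * (201 * X ^ 2) ^ 2 = 161604 * X ^ 7 := by ring
  have h5 : (1 : ℝ) ≤ X ^ 7 := one_le_pow₀ (by linarith)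
  have h6 : (262144 : ℝ) ≤ X ^ 9 := by
    calc (262144 : ℝ) = 4 ^ 9 := by norm_num
      _ ≤ X ^ 9 := by gcongr
  have h7 : 262144 * X ^ 7 ≤ X ^ 16 := by
    calc _ ≤ X ^ 9 * X ^ 7 := by gcongr
      _ = _ := by ring
  linarith

lemma log_netSize_le (hm : 1 ≤ m) {B t ι : ℝ}
    (h : Real.log ((⌊2 * B / t⌋₊ + 1 : ℕ) : ℝ) ≤ 16 * ι) :
    Real.log (netSize m B t) ≤ 32 * m ^ 2 * ι := by
  have hm' : (1 : ℝ) ≤ m := by exact_mod_cast hm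
  rw [netSize, Nat.cast_pow, Real.log_pow]
  have h2 : ((m + m * m : ℕ) : ℝ) ≤ 2 * m ^ 2 := by push_cast; nlinarith
  calc _ ≤ 2 * (m : ℝ) ^ 2 * (16 * ι) := mul_le_mul h2 h
        (Real.log_natCast_nonneg _) (by positivity)
    _ = _ := by ring

/-- The grid contributes `32 m² log X` and the remaining factor at most `2 log X`, whence `34`. -/
lemma log_inv_eventProb_le (hm : 2 ≤ m) (hd : 1 ≤ d) (hH : 1 ≤ H) (hK : 2 ≤ K) (hδ : 0 < δ)
    (hδ1 : δ ≤ 1) {X : ℝ} (hX : X = m * d * K * H / δ) :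
    Real.log (1 / eventProb m H K (bonusCoeff 100 m d H K δ) δ)
      ≤ 34 * m ^ 2 * Real.log X := by
  obtain ⟨hX4, hX1, hX2, hX3, hX5, hι⟩ := logArg_facts hm hd hH hK hδ hδ1 hX
  obtain ⟨hβ0, hβX⟩ := bonusCoeff_facts hm hd hH hK hδ hδ1 hX
  generalize bonusCoeff 100 m d H K δ = β at *
  have hm' : (2 : ℝ) ≤ m := by exact_mod_cast hm
  have hH' : (1 : ℝ) ≤ H := by exact_mod_cast hH
  have hK' : (2 : ℝ) ≤ K := by exact_mod_cast hK
  have hKX : (K : ℝ) ≤ X := by nlinarith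
  have hlogN : Real.log (netSize m (2 * H * K) (gridStep m K β)) ≤ 32 * m ^ 2 * Real.log X := by
    refine log_netSize_le (by omega) ?_
    refine (Real.log_le_log (by positivity)
      (floor_gridStep_le hX4 hKX hX1 hX3 hβ0 hβX)).trans_eq ?_
    rw [Real.log_pow]
    norm_num
  have hN1 : (1 : ℝ) ≤ netSize m (2 * H * K) (gridStep m K β) := by
    exact_mod_cast Nat.one_le_pow _ _ (Nat.succ_pos _)
  have e : 1 / eventProb m H K β δ
      = (4 * H * (K + 1) / δ) * netSize m (2 * H * K) (gridStep m K β) := by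
    rw [eventProb, one_div_div]
    push_cast
    ring
  rw [e, Real.log_mul (by positivity) (by positivity)]
  have h2 : 4 * (H : ℝ) * (K + 1) / δ ≤ 8 * (H * K / δ) := by
    rw [mul_div_assoc', div_le_div_iff_of_pos_right hδ]
    nlinarith
  have h1 : 4 * (H : ℝ) * (K + 1) / δ ≤ X ^ 2 := by nlinarith
  have h3 : Real.log (4 * (H : ℝ) * (K + 1) / δ) ≤ 2 * Real.log X := by
    refine (Real.log_le_log (by positivity) h1).trans_eq ?_
    rw [Real.log_pow]
    norm_num
  have h4 : Real.log X ≤ m ^ 2 * Real.log X :=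
    le_mul_of_one_le_left (by linarith) (by nlinarith)
  linarith

/-- Squared, the potential term contributes `4` and the union bound `16 · 34 = 544`; together they
stay below `24² = 576`. -/
lemma radius_eventProb_le (hm : 2 ≤ m) (hd : 1 ≤ d) (hH : 1 ≤ H) (hK : 2 ≤ K) (hδ : 0 < δ)
    (hδ1 : δ ≤ 1) :
    radius m H K (eventProb m H K (bonusCoeff 100 m d H K δ) δ)
      ≤ 24 * (m * H * √(Real.log (m * d * K * H / δ))) := by
  obtain ⟨X, hX⟩ : ∃ X : ℝ, X = m * d * K * H / δ := ⟨_, rfl⟩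
  have hlog := log_inv_eventProb_le hm hd hH hK hδ hδ1 hX
  obtain ⟨hX4, hX1, -, -, -, hι⟩ := logArg_facts hm hd hH hK hδ hδ1 hX
  rw [← hX]
  generalize eventProb m H K (bonusCoeff 100 m d H K δ) δ = p at *
  have hm' : (2 : ℝ) ≤ m := by exact_mod_cast hm
  have hK' : (2 : ℝ) ≤ K := by exact_mod_cast hK
  have hmK : Real.log (m + K) ≤ Real.log X :=
    Real.log_le_log (by positivity) (by nlinarith)
  generalize Real.log X = ι at *
  have hι0 : 0 ≤ ι := by linarith
  rw [radius, Real.sqrt_le_left (by positivity)]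
  have hsq : (24 * (m * H * √ι)) ^ 2 = 576 * (m ^ 2 * H ^ 2 * ι) := by
    rw [mul_pow, mul_pow, mul_pow, Real.sq_sqrt hι0]
    norm_num
  rw [hsq]
  have h1 : (2 * (H : ℝ)) ^ 2 * (m * Real.log (m + K)) ≤ 4 * (m ^ 2 * H ^ 2 * ι) := by
    have : (m : ℝ) * Real.log (m + K) ≤ m ^ 2 * ι := by
      rw [sq, mul_assoc]
      refine mul_le_mul_of_nonneg_left (hmK.trans ?_) (by positivity)
      exact le_mul_of_one_le_left hι0 (by linarith)
    calc _ ≤ (2 * (H : ℝ)) ^ 2 * (m ^ 2 * ι) := by gcongr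
      _ = _ := by ring
  have h2 : 4 * (2 * (H : ℝ)) ^ 2 * Real.log (1 / p) ≤ 544 * (m ^ 2 * H ^ 2 * ι) := by
    calc _ ≤ 4 * (2 * (H : ℝ)) ^ 2 * (34 * m ^ 2 * ι) := by gcongr
      _ = _ := by ring
  have h3 : 0 ≤ (m : ℝ) ^ 2 * H ^ 2 * ι := by positivity
  linarith

/-- In units of `m H √ι` the requirement is `2 · 24 + 4 + 2 = 54`, well below `100`. -/
lemma tuned_bonusCoeff (hm : 2 ≤ m) (hd : 1 ≤ d) (hH : 1 ≤ H) (hK : 2 ≤ K) (hδ : 0 < δ)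
    (hδ1 : δ ≤ 1) :
    Tuned m H K (bonusCoeff 100 m d H K δ)
      (radius m H K (eventProb m H K (bonusCoeff 100 m d H K δ) δ)) (2 * H * K) := by
  have hr := radius_eventProb_le hm hd hH hK hδ hδ1
  set X : ℝ := m * d * K * H / δ with hX
  obtain ⟨-, -, -, -, -, hι⟩ := logArg_facts hm hd hH hK hδ hδ1 hX
  have hm' : (2 : ℝ) ≤ m := by exact_mod_cast hm
  have hH' : (1 : ℝ) ≤ H := by exact_mod_cast hH
  have hK' : (2 : ℝ) ≤ K := by exact_mod_cast hK
  have hs : 1 ≤ √(Real.log X) := Real.one_le_sqrt.mpr hι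
  have hHK : (1 : ℝ) ≤ H * K := by nlinarith
  refine ⟨hH, radius_nonneg _ _ _ _, by linarith, le_rfl, ?_⟩
  have hβe : bonusCoeff 100 m d H K δ = 100 * (m * H * √(Real.log X)) := by
    rw [bonusCoeff]; ring
  have h1 : (H : ℝ) * √m ≤ m * H * √(Real.log X) := by
    have : √(m : ℝ) ≤ m := by
      rw [Real.sqrt_le_left (by linarith)]
      nlinarith
    calc (H : ℝ) * √m ≤ H * m := by gcongr
      _ = m * H * 1 := by ring
      _ ≤ _ := by gcongr
  have h2 : 1 ≤ m * H * √(Real.log X) := by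
    have : (1 : ℝ) ≤ m * H := by nlinarith
    nlinarith
  linarith

end Tuning

/-! ### From the number of episodes to accuracy `ε`. -/

section Rate

variable {m d H K : ℕ} {ε δ : ℝ}

/-- Since `ε δ ≤ H`, the ratio is at least `m ≥ 2`; this keeps `ι'` away from zero. -/
lemma log_two_le_log_ratio (hm : 2 ≤ m) (hd : 1 ≤ d) (hε : 0 < ε) (hεH : ε ≤ H)
    (hδ : 0 < δ) (hδ1 : δ ≤ 1) {R : ℝ} (hR : R = m * d * H / (ε * δ)) :
    (m : ℝ) ≤ R ∧ 1 / 2 ≤ Real.log R := by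
  have hm' : (2 : ℝ) ≤ m := by exact_mod_cast hm
  have hd' : (1 : ℝ) ≤ d := by exact_mod_cast hd
  have h1 : (m : ℝ) ≤ R := by
    rw [hR, le_div_iff₀ (by positivity)]
    have h2 : ε * δ ≤ H * 1 := mul_le_mul hεH hδ1 hδ.le (hε.le.trans hεH)
    have h3 : (H : ℝ) * 1 ≤ d * H := by nlinarith
    calc (m : ℝ) * (ε * δ) ≤ m * (d * H) :=
          mul_le_mul_of_nonneg_left (by linarith) (by positivity)
      _ = _ := by ring
  refine ⟨h1, ?_⟩
  calc (1 / 2 : ℝ) ≤ Real.log 2 := by linarith [Real.log_two_gt_d9]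
    _ ≤ Real.log R := Real.log_le_log (by norm_num) (by linarith)

lemma one_le_rate (hm : 2 ≤ m) (hd : 1 ≤ d) (hH : 1 ≤ H) (hε : 0 < ε) (hεH : ε ≤ H)
    (hδ : 0 < δ) (hδ1 : δ ≤ 1) : 1 ≤ rate m d H ε δ := by
  obtain ⟨-, h2⟩ := log_two_le_log_ratio hm hd hε hεH hδ hδ1 rfl
  have hm' : (2 : ℝ) ≤ m := by exact_mod_cast hm
  have hH' : (1 : ℝ) ≤ H := by exact_mod_cast hH
  rw [rate, le_div_iff₀ (by positivity), one_mul]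
  set l := Real.log (m * d * H / (ε * δ))
  have h3 : ε ^ 2 ≤ (H : ℝ) ^ 2 := by gcongr
  have h4 : (H : ℝ) ^ 2 ≤ H ^ 6 := pow_le_pow_right₀ hH' (by norm_num)
  have h5 : (1 / 2 : ℝ) ^ 2 ≤ l ^ 2 := by gcongr
  have h6 : (2 : ℝ) ^ 3 ≤ (m : ℝ) ^ 3 := by gcongr
  calc ε ^ 2 ≤ (H : ℝ) ^ 6 := h3.trans h4
    _ ≤ 2 ^ 3 * (H : ℝ) ^ 6 * (1 / 2) ^ 2 := by
        have : 0 ≤ (H : ℝ) ^ 6 := by positivity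
        linarith
    _ ≤ _ := by gcongr

/-- The constant in the lower bound on the number of episodes. -/
def episodeConst : ℝ := 240000 ^ 2

lemma two_le_of_rate_le (hm : 2 ≤ m) (hd : 1 ≤ d) (hH : 1 ≤ H) (hε : 0 < ε) (hεH : ε ≤ H)
    (hδ : 0 < δ) (hδ1 : δ ≤ 1) (hK : episodeConst * rate m d H ε δ ≤ K) : 2 ≤ K := by
  have h := one_le_rate hm hd hH hε hεH hδ hδ1
  have : (2 : ℝ) ≤ K := by
    refine le_trans ?_ hK
    rw [episodeConst]
    linarith
  exact_mod_cast this

/-- The logarithm in the bonus is of lower order in the number of episodes. -/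
lemma log_bonus_le (hm : 2 ≤ m) (hd : 1 ≤ d) (hH : 1 ≤ H) (hε : 0 < ε) (hεH : ε ≤ H)
    (hδ : 0 < δ) (hδ1 : δ ≤ 1) (hK : episodeConst * rate m d H ε δ ≤ K) :
    2400 * (m * √m * H ^ 2) * Real.log (m * d * K * H / δ) ≤ √K * ε := by
  have hK2 := two_le_of_rate_le hm hd hH hε hεH hδ hδ1 hK
  have hm' : (2 : ℝ) ≤ m := by exact_mod_cast hm
  have hd' : (1 : ℝ) ≤ d := by exact_mod_cast hd
  have hH' : (1 : ℝ) ≤ H := by exact_mod_cast hH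
  have hK' : (2 : ℝ) ≤ K := by exact_mod_cast hK2
  set R : ℝ := m * d * H / (ε * δ) with hR
  obtain ⟨hmR, hlR⟩ := log_two_le_log_ratio hm hd hε hεH hδ hδ1 hR
  set l := Real.log R with hl
  set D : ℝ := 2400 * (m * √m * H ^ 2) with hD
  have hD0 : 0 < D := by positivity
  -- The claim becomes `ι ≤ a`. Expressing `K` through `a` leaves only `log a` on the left, which is
  -- of lower order.
  set a : ℝ := √K * ε / D with ha
  have haD : a * D = √K * ε := div_mul_cancel₀ _ hD0.ne'
  have ha0 : 0 < a := by positivity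
  have hsm : √(m : ℝ) ^ 2 = m := Real.sq_sqrt (by positivity)
  have hKε : K * ε ^ 2 = 2400 ^ 2 * (m ^ 3 * H ^ 4 * a ^ 2) := by
    have h1 : (a * D) ^ 2 = (√K * ε) ^ 2 := by rw [haD]
    rw [mul_pow (√K), Real.sq_sqrt (by positivity)] at h1
    rw [← h1, hD]
    calc (a * (2400 * (m * √m * H ^ 2))) ^ 2
        = 2400 ^ 2 * (m ^ 2 * (√m) ^ 2 * H ^ 4 * a ^ 2) := by ring
      _ = _ := by rw [hsm]; ring
  -- Here `240000 = 100 · 2400` is used, and `H⁶` against the `H⁴` in `D²` leaves a spare factor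
  -- `H`. That factor is needed: when `ε` is close to `H`, `log H` is not controlled by `ι'`, only
  -- by `H`.
  have hal : 100 * (H * l) ≤ a := by
    rw [rate, ← hR, ← hl, episodeConst, mul_div_assoc', div_le_iff₀ (by positivity), hKε] at hK
    have h1 : (100 * (H * l)) ^ 2 * (2400 ^ 2 * (m ^ 3 * H ^ 4))
        ≤ a ^ 2 * (2400 ^ 2 * (m ^ 3 * H ^ 4)) := by
      calc _ = 240000 ^ 2 * ((m : ℝ) ^ 3 * H ^ 6 * l ^ 2) := by ring
        _ ≤ _ := hK
        _ = _ := by ring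
    have h2 := le_of_mul_le_mul_right h1 (by positivity)
    exact (pow_le_pow_iff_left₀ (by positivity) ha0.le (by norm_num)).mp h2
  have hRε : 1 / ε ≤ R := by
    rw [hR, div_le_div_iff₀ hε (by positivity)]
    have h1 : (1 : ℝ) ≤ m * d := by nlinarith
    have h2 : (1 : ℝ) ≤ m * d * H := by nlinarith
    nlinarith
  have hR0 : 0 < R := by linarith
  have hX : m * d * K * H / δ ≤ 2400 ^ 2 * (R ^ 5 * H ^ 4 * a ^ 2) := by
    have e : (m : ℝ) * d * K * H / δ = R * (K * ε ^ 2) * (1 / ε) := by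
      rw [hR]; field_simp
    rw [e, hKε]
    calc R * (2400 ^ 2 * (m ^ 3 * H ^ 4 * a ^ 2)) * (1 / ε)
        ≤ R * (2400 ^ 2 * (R ^ 3 * H ^ 4 * a ^ 2)) * R := by gcongr
      _ = _ := by ring
  have hlog : Real.log (m * d * K * H / δ)
      ≤ 2 * Real.log 2400 + (5 * l + 4 * Real.log H + 2 * Real.log a) := by
    refine (Real.log_le_log (by positivity) hX).trans_eq ?_
    rw [Real.log_mul (by positivity) (by positivity), Real.log_mul (by positivity) (by positivity),
      Real.log_mul (by positivity) (by positivity), Real.log_pow, Real.log_pow, Real.log_pow,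
      Real.log_pow, ← hl]
    norm_num
  have h2400 : Real.log 2400 ≤ 8 := by
    rw [Real.log_le_iff_le_exp (by norm_num)]
    have h1 : (2.718 : ℝ) ≤ Real.exp 1 := by linarith [Real.exp_one_gt_d9]
    calc (2400 : ℝ) ≤ 2.718 ^ 8 := by norm_num
      _ ≤ Real.exp 1 ^ 8 := by gcongr
      _ = Real.exp 8 := by rw [← Real.exp_nat_mul]; norm_num
  have hlogH : Real.log H ≤ H := (Real.log_le_sub_one_of_pos (by linarith)).trans (by linarith)
  have hloga : Real.log a ≤ a / 4 + 1 := by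
    have h1 := Real.log_le_sub_one_of_pos (x := a / 4) (by positivity)
    rw [Real.log_div ha0.ne' (by norm_num)] at h1
    have h4 : Real.log 4 ≤ 2 := by
      rw [show (4 : ℝ) = 2 ^ 2 by norm_num, Real.log_pow]
      push_cast
      linarith [Real.log_two_lt_d9]
    linarith
  -- All terms except `a / 2` add up to at most `49 H l`, hence to less than `a / 2`.
  have hfin : Real.log (m * d * K * H / δ) ≤ a := by
    have h1 : (H : ℝ) ≤ 2 * (H * l) := by nlinarith
    have h2 : 1 / 2 ≤ H * l := by nlinarith
    have h3 : l ≤ H * l := le_mul_of_one_le_left (by linarith) hH'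
    linarith
  calc D * Real.log (m * d * K * H / δ) ≤ D * a := mul_le_mul_of_nonneg_left hfin hD0.le
    _ = √K * ε := by rw [mul_comm, haD]

/-- Both square roots are at most `(3/2) √K √m √ι`, which gives the constant `4 (300 + 24) · 3/2 =
1944 ≤ 2400` in front of `m √m H² ι √K`. -/
lemma error_le (hm : 2 ≤ m) (hd : 1 ≤ d) (hH : 1 ≤ H) (hε : 0 < ε) (hεH : ε ≤ H)
    (hδ : 0 < δ) (hδ1 : δ ≤ 1) (hK : episodeConst * rate m d H ε δ ≤ K) :
    4 * (H * (3 * (bonusCoeff 100 m d H K δ * √(K * (2 * (m * Real.log (m + K)))))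
      + radius m H K (eventProb m H K (bonusCoeff 100 m d H K δ) δ) * √(K + 1))) ≤ K * ε := by
  have hK2 := two_le_of_rate_le hm hd hH hε hεH hδ hδ1 hK
  have hlog := log_bonus_le hm hd hH hε hεH hδ hδ1 hK
  have hr := radius_eventProb_le hm hd hH hK2 hδ hδ1
  set X : ℝ := m * d * K * H / δ with hX
  obtain ⟨-, hX1, -, -, -, hι⟩ := logArg_facts hm hd hH hK2 hδ hδ1 hX
  have hm' : (2 : ℝ) ≤ m := by exact_mod_cast hm
  have hH' : (1 : ℝ) ≤ H := by exact_mod_cast hH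
  have hK' : (2 : ℝ) ≤ K := by exact_mod_cast hK2
  set ι := Real.log X with hιdef
  have hβe : bonusCoeff 100 m d H K δ = 100 * (m * H * √ι) := by
    rw [bonusCoeff]; ring
  rw [hβe] at hr ⊢
  set ρ := radius m H K (eventProb m H K (100 * (m * H * √ι)) δ) with hρ
  set b := m * H * √ι with hb
  have hb0 : 0 ≤ b := by positivity
  have hmK : Real.log (m + K) ≤ ι := Real.log_le_log (by positivity) (by nlinarith)
  have hs1 : √(K * (2 * (m * Real.log (m + K)))) ≤ √K * (3 / 2 * (√m * √ι)) := by
    have h0 : 0 ≤ √(K : ℝ) * (3 / 2 * (√m * √ι)) := by positivity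
    rw [Real.sqrt_le_left h0, mul_pow, mul_pow, mul_pow, Real.sq_sqrt (by positivity),
      Real.sq_sqrt (by positivity), Real.sq_sqrt (by linarith)]
    have h1 : (m : ℝ) * Real.log (m + K) ≤ m * ι := by gcongr
    have h2 : 0 ≤ m * ι := by positivity
    refine mul_le_mul_of_nonneg_left ?_ (by positivity)
    linarith
  have hs2 : √(K + 1 : ℝ) ≤ √K * (3 / 2 * (√m * √ι)) := by
    have h0 : 0 ≤ √(K : ℝ) * (3 / 2 * (√m * √ι)) := by positivity
    rw [Real.sqrt_le_left h0, mul_pow, mul_pow, mul_pow, Real.sq_sqrt (by positivity),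
      Real.sq_sqrt (by positivity), Real.sq_sqrt (by linarith)]
    have : 2 ≤ m * ι := by nlinarith
    nlinarith
  set T := √(K : ℝ) * (3 / 2 * (√m * √ι)) with hTdef
  have hT0 : 0 ≤ T := by positivity
  have h1 : 3 * (100 * b * √(K * (2 * (m * Real.log (m + K))))) + ρ * √(K + 1)
      ≤ 3 * (100 * b * T) + 24 * b * T := by gcongr
  have h2 : 4 * (H * (3 * (100 * b * T) + 24 * b * T))
      = 1944 * (m * √m * H ^ 2) * (√ι) ^ 2 * √K := by
    rw [hTdef, hb]
    ring
  rw [Real.sq_sqrt (by linarith)] at h2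
  calc _ ≤ 4 * (H * (3 * (100 * b * T) + 24 * b * T)) := by gcongr
    _ = 1944 * (m * √m * H ^ 2) * ι * √K := h2
    _ ≤ 2400 * (m * √m * H ^ 2) * ι * √K := by gcongr; norm_num
    _ ≤ √K * ε * √K := by gcongr
    _ = K * ε := by
        rw [mul_right_comm, Real.mul_self_sqrt (by positivity)]

end Rate

/-! ### The two cases of the guarantee. -/

section Main

/-- All policies have the same value, so every output is optimal on the sure event, whatever `K` is,
even `K = 0`. -/
lemma guarantee_of_dim_one (cβ : ℝ) (d H K : ℕ) {ε δ : ℝ} (hε : 0 < ε) (hδ : 0 < δ) :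
    Guarantee.{u, v, w} cβ 1 d H K ε δ := by
  intro S A Ω _ _ _ φ M s₁ Ge Gp Pr _ s a r hM hrun
  refine ⟨Set.univ, MeasurableSet.univ, by simp; linarith, fun ω _ θ hθ => ?_⟩
  set π := planPolicy (bonusCoeff cβ 1 d H K δ) H φ Gp K (fun i j => s i j ω)
            (fun i j => a i j ω) (fun i j => r i j ω) θ
  have hne : Nonempty (Policy S A) := ⟨π⟩
  have h1 : M.optValue H θ 0 s₁ ≤ M.value H θ π 0 s₁ := ciSup_le fun π' =>
    (M.valueN_eq_of_returns_const (H := H) (fun h hh z z' => hM.returns_const_of_dim_one hh z z')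
      π' π (H - 0) 0 (by omega) s₁).le
  linarith

lemma guarantee_of_two_le_dim {m d H K : ℕ} {ε δ : ℝ} (hm : 2 ≤ m) (hd : 1 ≤ d) (hH : 1 ≤ H)
    (hε : 0 < ε) (hεH : ε ≤ H) (hδ : 0 < δ) (hδ1 : δ ≤ 1)
    (hK : episodeConst * rate m d H ε δ ≤ K) : Guarantee.{u, v, w} 100 m d H K ε δ := by
  intro S A Ω _ _ _ φ M s₁ Ge Gp Pr _ s a r hM hrun
  have hK2 := two_le_of_rate_le hm hd hH hε hεH hδ hδ1 hK
  have hT := tuned_bonusCoeff hm hd hH hK2 hδ hδ1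
  have herr := error_le hm hd hH hε hεH hδ hδ1 hK
  obtain ⟨hg0, hg1⟩ := gridStep_spec (by omega : 1 ≤ m) (by omega : 1 ≤ K) hT.bonus_nonneg
  obtain ⟨n, hn⟩ : ∃ n, n = 4 * H * (K + 1) *
      netSize m (2 * H * K) (gridStep m K (bonusCoeff 100 m d H K δ)) := ⟨_, rfl⟩
  have hn1 : 1 ≤ n := hn ▸ Nat.mul_pos (Nat.mul_pos (Nat.mul_pos (by norm_num) hH) (Nat.succ_pos K))
    (Nat.one_le_pow _ _ (Nat.succ_pos _))
  have hn1' : (1 : ℝ) ≤ n := by exact_mod_cast hn1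
  have hp : eventProb m H K (bonusCoeff 100 m d H K δ) δ = δ / n := by rw [hn, eventProb]
  have hp0 : 0 < eventProb m H K (bonusCoeff 100 m d H K δ) δ := by rw [hp]; positivity
  have hp1 : eventProb m H K (bonusCoeff 100 m d H K δ) δ ≤ 1 := by
    rw [hp, div_le_one (by linarith)]
    linarith
  obtain ⟨bad, hbad, hgood⟩ := hrun.exists_goodData Gp hM (by omega) hH hT.bonus_nonneg
    hT.one_le_bound hg0 hg1 hp0 hp1
  -- The exceptional set comes without measurability, so it is replaced by a measurable hull of the
  -- same measure.
  have hbad' : Pr.real (toMeasurable Pr bad) ≤ δ := by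
    rw [measureReal_def, measure_toMeasurable]
    refine ENNReal.toReal_le_of_le_ofReal hδ.le (hbad.trans_eq ?_)
    rw [← ENNReal.ofReal_natCast, ← ENNReal.ofReal_mul (Nat.cast_nonneg _), ← hn, hp,
      mul_div_cancel₀ _ (by positivity)]
  refine ⟨(toMeasurable Pr bad)ᶜ, (measurableSet_toMeasurable _ _).compl, ?_, fun ω hω θ hθ => ?_⟩
  · rw [probReal_compl_eq_one_sub (measurableSet_toMeasurable _ _)]
    linarith
  · have hω' : ω ∉ bad := fun h => hω (subset_toMeasurable _ _ h)
    have h1 := (optValue_sub_value_le hT hM (hgood ω hω') hθ).trans herr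
    have hK0 : (0 : ℝ) < K := by exact_mod_cast (by omega : 0 < K)
    exact le_of_mul_le_mul_left h1 hK0

end Main

end RewardFree

end

theorem mainTheorem4 :
    ∃ cβ : ℝ, 0 < cβ ∧
      (∃ cK : ℝ, 0 < cK ∧ ∀ (m d H : ℕ), 1 ≤ m → 1 ≤ d → 1 ≤ H →
        ∀ ε δ : ℝ, 0 < ε → ε ≤ H → 0 < δ → δ ≤ 1 →
          ∀ K : ℕ, cK * RewardFree.rate m d H ε δ ≤ K →
            RewardFree.Guarantee.{u, v, w} cβ m d H K ε δ) ∧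
      (∃ C : ℝ, 0 < C ∧ ∀ (m d H : ℕ), 1 ≤ m → 1 ≤ d → 1 ≤ H →
        ∀ ε δ : ℝ, 0 < ε → ε ≤ H → 0 < δ → δ ≤ 1 →
          ∃ K : ℕ, (K : ℝ) ≤ C * RewardFree.rate m d H ε δ ∧
            RewardFree.Guarantee.{u, v, w} cβ m d H K ε δ) := by
  have hc : 0 < RewardFree.episodeConst := by norm_num [RewardFree.episodeConst]
  -- The additional `1` in the second constant absorbs rounding up to an integer `K`, as the rate is
  -- at least one for `m ≥ 2`.
  refine ⟨100, by norm_num, ⟨RewardFree.episodeConst, hc, ?_⟩,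
    ⟨RewardFree.episodeConst + 1, by linarith, ?_⟩⟩
  · intro m d H hm hd hH ε δ hε hεH hδ hδ1 K hK
    rcases hm.eq_or_lt with rfl | hm
    · exact RewardFree.guarantee_of_dim_one 100 d H K hε hδ
    · exact RewardFree.guarantee_of_two_le_dim hm hd hH hε hεH hδ hδ1 hK
  · intro m d H hm hd hH ε δ hε hεH hδ hδ1
    rcases hm.eq_or_lt with rfl | hm
    -- In dimension one the rate can vanish, as for `d = H = 1` and `ε = δ = 1`, so zero episodes
    -- have to suffice.
    · refine ⟨0, ?_, RewardFree.guarantee_of_dim_one 100 d H 0 hε hδ⟩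
      have : 0 ≤ RewardFree.rate 1 d H ε δ := by rw [RewardFree.rate]; positivity
      rw [Nat.cast_zero]
      positivity
    · refine ⟨⌈RewardFree.episodeConst * RewardFree.rate m d H ε δ⌉₊, ?_,
        RewardFree.guarantee_of_two_le_dim hm hd hH hε hεH hδ hδ1 (Nat.le_ceil _)⟩
      have h1 := RewardFree.one_le_rate hm hd hH hε hεH hδ hδ1
      have h2 := Nat.ceil_lt_add_one (mul_nonneg hc.le (zero_le_one.trans h1))
      linarith
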